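/- **Conventions.** A partition $\lambda=(\lambda_1\ge\lambda_2\ge\dots)$ is identified with its Young diagram $Y(\lambda)=\{(i,j): 1\le j\le\lambda_i\}$, $\lambda'$ is its conjugate, $\ell(\lambda)$ its number of parts. For an integer $e>1$, $\lambda$ is *$e$-regular* if it does not have $e$ equal positive parts. For $(i,j)\in Y(\lambda)$ the *rim hook* $R_{i,j}$ is the set of $(i',j')\in Y(\lambda)$ with $i'\ge i$, $j'\ge j$ and $(i'+1,j'+1)\notin Y(\lambda)$; the *rim* is $R_{1,1}$ (empty if $\lambda=\varnothing$). An *$e$-core* is a partition with no rim hook of size $e$. Removing rim hooks of size $e$ one after another from $\lambda$ until none is left produces the *$e$-core* of $\lambda$, and the number of hooks removed is the *$e$-weight* of $\lambda$. The dominance order on partitions of the same size is: $\mu\unlhd\lambda$ if $\mu_1+\dots+\mu_k\le\lambda_1+\dots+\lambda_k$ for all $k$. The *$2$-runner matrix* of $\lambda$ is the $1\times e$ matrix whose entry in column $y\in\{0,\dots,e-1\}$ is the number of indices $i\geq 1$ such that $\lambda_i$ is odd and $\lambda_i\equiv i+y\pmod e$. For an $e$-core $\gamma$ and a $1\times e$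 matrix $\mathcal R$ of non-negative integers, $E_{\mathcal R}(\gamma)$ is the set of partitions with $e$-core $\gamma$ and $2$-runner matrix $\mathcal R$ whose $e$-weight is minimal among all partitions with $e$-core $\gamma$ and $2$-runner matrix $\mathcal R$. The *Mullineux map* $m_e$ on $e$-regular partitions is defined as follows. The *$e$-rim* of $\lambda\neq\varnothing$ is the subset of the rim obtained by traversing the rim from $(1,\lambda_1)$ to $(\ell(\lambda),1)$ and repeating: include the next $e$ boxes (or all the remaining ones if there are fewer than $e$), then move to the rightmost box of the next row (stop if there is no next row). Put $\lambda^{(0)}=\lambda$, and let $\lambda^{(k+1)}$ be $\lambda^{(k)}$ with its $e$-rim removed, until the empty partition is reached. Let $A_k$ be the size of the $e$-rim of $\lambda^{(k)}$ and $r_k=\ell(\lambda^{(k)})$. The *Mullineux symbol* of $\lambda$ is the array with columns $(A_k,r_k)$, one for each non-empty $\lambda^{(k)}$. Then $m_e(\lambda)$ is the unique $e$-regular partition whose Mullineux symbol has columns $(A_k,\,A_k-r_k+\varepsilon_k)$, where $\varepsilon_k=0$ if $e\mid A_k$ and $\varepsilon_k=1$ otherwise. **Statement.** Let $e>1$ be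 odd, let $\gamma$ be an $e$-core partition, and let $\mathcal R$ be a $1\times e$ matrix of non-negative integers with at least one entry equal to $0$. Then $E_{\mathcal R}(\gamma)$ has a unique maximal element $\lambda$ in the dominance order. Moreover $\lambda$ is $e$-regular, so that $m_e(\lambda)$ is defined, and $m_e(\lambda)'$ is the unique minimal element of $E_{\mathcal R}(\gamma)$ in the dominance order. -/

import Mathlib

/-!
Partitions are Young diagrams, with rows and columns indexed from `0`; the parts of `μ` are the
numbers `μ.rowLen 0 ≥ μ.rowLen 1 ≥ …`, and `μ.colLen 0` is the number of (positive) parts.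
The conjugate of `μ` is `μ.transpose`.
-/

namespace YoungDiagram

/-- A partition is `e`-regular if it does not have `e` equal (positive) parts. -/
def IsRegular (e : ℕ) (μ : YoungDiagram) : Prop :=
  ∀ a : ℕ, μ.rowLens.count a < e

/-- The dominance order `μ ⊴ ν` on partitions of the same size. -/
def DominatedBy (μ ν : YoungDiagram) : Prop :=
  μ.card = ν.card ∧
    ∀ k : ℕ, ∑ i ∈ Finset.range k, μ.rowLen i ≤ ∑ i ∈ Finset.range k, ν.rowLen i

/-- `μ` is the unique maximal element of `E` in the dominance order. -/
def IsUniqueMaximal (E : Set YoungDiagram) (μ : YoungDiagram) : Prop :=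
  ∀ ν : YoungDiagram, (ν ∈ E ∧ ∀ κ ∈ E, ν.DominatedBy κ → κ = ν) ↔ ν = μ

/-- `μ` is the unique minimal element of `E` in the dominance order. -/
def IsUniqueMinimal (E : Set YoungDiagram) (μ : YoungDiagram) : Prop :=
  ∀ ν : YoungDiagram, (ν ∈ E ∧ ∀ κ ∈ E, κ.DominatedBy ν → κ = ν) ↔ ν = μ

/-! ### Rim hooks, cores and weights -/

/-- The rim hook of the box `c`: the boxes weakly below and weakly to the right of `c` that lie
on the rim. -/
def rimHook (μ : YoungDiagram) (c : ℕ × ℕ) : Finset (ℕ × ℕ) :=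
  μ.cells.filter fun b => c.1 ≤ b.1 ∧ c.2 ≤ b.2 ∧ (b.1 + 1, b.2 + 1) ∉ μ

/-- The rim of a partition. -/
def rim (μ : YoungDiagram) : Finset (ℕ × ℕ) :=
  μ.rimHook (0, 0)

/-- A partition is an `e`-core if it has no rim hook of size `e`. -/
def IsCore (e : ℕ) (μ : YoungDiagram) : Prop :=
  ∀ c ∈ μ, (μ.rimHook c).card ≠ e

/-- `RemovesHooks e k μ ν`: one can get from `μ` to `ν` by removing a rim hook of size `e`
exactly `k` times in succession. -/
inductive RemovesHooks (e : ℕ) : ℕ → YoungDiagram → YoungDiagram → Prop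
  | refl (μ : YoungDiagram) : RemovesHooks e 0 μ μ
  | step {k : ℕ} {μ ν κ : YoungDiagram} (c : ℕ × ℕ) (hc : c ∈ μ)
      (hcard : (μ.rimHook c).card = e) (hν : ν.cells = μ.cells \ μ.rimHook c)
      (h : RemovesHooks e k ν κ) : RemovesHooks e (k + 1) μ κ

/-- `μ` has `e`-core `γ` and `e`-weight `w`. -/
def HasCoreAndWeight (e : ℕ) (μ γ : YoungDiagram) (w : ℕ) : Prop :=
  γ.IsCore e ∧ RemovesHooks e w μ γ

/-! ### Runner matrices and the sets `E_R(γ)` -/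

/-- The `d`-runner matrix, a `(d - 1) × e` matrix. The row index `x : Fin (d - 1)` stands for
the residue `x + 1`, and the `i`-th row of `μ` (from `0`) for the part of index `i + 1`. -/
def runnerMatrix (d e : ℕ) (μ : YoungDiagram) : Matrix (Fin (d - 1)) (Fin e) ℕ :=
  Matrix.of fun x y =>
    ((Finset.range (μ.colLen 0)).filter fun i =>
      μ.rowLen i ≡ (x : ℕ) + 1 [MOD d] ∧ μ.rowLen i ≡ (i + 1) + (y : ℕ) [MOD e]).card

/-- The minimal `e`-weight of a partition with `e`-core `γ` and `d`-runner matrix `R`. -/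
noncomputable def minWeight (d e : ℕ) (γ : YoungDiagram)
    (R : Matrix (Fin (d - 1)) (Fin e) ℕ) : ℕ :=
  sInf {w | ∃ μ : YoungDiagram, HasCoreAndWeight e μ γ w ∧ μ.runnerMatrix d e = R}

/-- The set `E_R(γ)` of the partitions with `e`-core `γ` and `d`-runner matrix `R` whose
`e`-weight is minimal among all such partitions. -/
def minWeightSet (d e : ℕ) (γ : YoungDiagram)
    (R : Matrix (Fin (d - 1)) (Fin e) ℕ) : Set YoungDiagram :=
  {μ | HasCoreAndWeight e μ γ (minWeight d e γ R) ∧ μ.runnerMatrix d e = R}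

/-! ### The `e`-rim, Mullineux symbols and the Mullineux map -/

/-- The content of a box. It drops by exactly one at each step when the rim is traversed from
its top right end to its bottom left end. -/
def content (c : ℕ × ℕ) : ℤ := (c.2 : ℤ) - (c.1 : ℤ)

/-- The first `e` boxes (all the boxes, if fewer than `e` remain) of the rim, traversed from the
rightmost box `(r, μ.rowLen r - 1)` of row `r` towards the bottom left end of the rim. -/
def eRimSegment (e : ℕ) (μ : YoungDiagram) (r : ℕ) : Finset (ℕ × ℕ) :=
  μ.rim.filter fun c =>
    content c ≤ (μ.rowLen r : ℤ) - 1 - r ∧ (μ.rowLen r : ℤ) - 1 - r < content c + e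

theorem rightmost_mem_eRimSegment {e : ℕ} (he : 0 < e) (μ : YoungDiagram) {r : ℕ}
    (hr : r < μ.colLen 0) : (r, μ.rowLen r - 1) ∈ μ.eRimSegment e r := by
  have h0 : 0 < μ.rowLen r := mem_iff_lt_rowLen.1 (mem_iff_lt_colLen.2 hr)
  have h1 : (r, μ.rowLen r - 1) ∈ μ := mem_iff_lt_rowLen.2 (by omega)
  have h2 : (r + 1, μ.rowLen r - 1 + 1) ∉ μ := by
    rw [mem_iff_lt_rowLen]
    have := μ.rowLen_anti r (r + 1) (by omega)
    omega
  simp only [eRimSegment, rim, rimHook, content, Finset.mem_filter, mem_cells]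
  refine ⟨⟨h1, by omega, by omega, h2⟩, ?_, ?_⟩ <;> omega

/-- The part of the `e`-rim that is produced from row `r` on: the segment that starts in row `r`,
and then what is produced from the row after the last row of that segment. -/
def eRimFrom (e : ℕ) (μ : YoungDiagram) (r : ℕ) : Finset (ℕ × ℕ) :=
  if h : 0 < e ∧ r < μ.colLen 0 then
    μ.eRimSegment e r ∪ eRimFrom e μ ((μ.eRimSegment e r).sup Prod.fst + 1)
  else ∅
termination_by μ.colLen 0 - r
decreasing_by
  have := Finset.le_sup (f := Prod.fst) (rightmost_mem_eRimSegment h.1 μ h.2)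
  simp only at this
  omega

/-- The `e`-rim of a partition. -/
def eRim (e : ℕ) (μ : YoungDiagram) : Finset (ℕ × ℕ) :=
  μ.eRimFrom e 0

/-- `HasMullineuxSymbol e μ s`: the columns of the Mullineux symbol of `μ` are the pairs in the
list `s`. The first column consists of the size of the `e`-rim of `μ` and the number of parts of
`μ`; the other columns form the Mullineux symbol of `μ` with its `e`-rim removed. -/
inductive HasMullineuxSymbol (e : ℕ) : YoungDiagram → List (ℕ × ℕ) → Prop
  | nil : HasMullineuxSymbol e ⊥ []
  | cons {μ ν : YoungDiagram} {s : List (ℕ × ℕ)} (hμ : μ ≠ ⊥)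
      (hν : ν.cells = μ.cells \ μ.eRim e) (h : HasMullineuxSymbol e ν s) :
      HasMullineuxSymbol e μ (((μ.eRim e).card, μ.colLen 0) :: s)

/-- The operation on the columns `(A, r)` of Mullineux symbols that defines the Mullineux map:
`r` is replaced by `A - r` if `e` divides `A`, and by `A - r + 1` otherwise. (In a column of a
Mullineux symbol one always has `r ≤ A`.) -/
def mullineuxColumn (e : ℕ) (c : ℕ × ℕ) : ℕ × ℕ :=
  (c.1, c.1 - c.2 + if e ∣ c.1 then 0 else 1)

/-- `ν` is an image of `μ` under the Mullineux map: an `e`-regular partition whose Mullineux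
symbol is obtained from that of the `e`-regular partition `μ` by `mullineuxColumn`. -/
def IsMullineuxImage (e : ℕ) (μ ν : YoungDiagram) : Prop :=
  μ.IsRegular e ∧ ν.IsRegular e ∧
    ∃ s, HasMullineuxSymbol e μ s ∧ HasMullineuxSymbol e ν (s.map (mullineuxColumn e))

open Classical in
/-- The Mullineux map `m_e`, with junk value `⊥` where there is no image. -/
noncomputable def mullineux (e : ℕ) (μ : YoungDiagram) : YoungDiagram :=
  if h : ∃ ν, IsMullineuxImage e μ ν then h.choose else ⊥

end YoungDiagram

/-! Encode a partition with at most `N` parts by its `N` beads and read the positions upwards as a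
walk in `ZMod (2 * e)`: a gap is a step by `a`, a bead a step by `a + e`. For `a = 1` and odd `e`
the node at which a bead sits records, by the Chinese remainder theorem, its residue mod `e` and the
parity of its part (`node_one_eq_iff`). For fixed `N`, the numbers of beads at the nodes therefore
amount to the `e`-core together with the runner matrix (`beadCount_eq_iff`), and $E_{\mathcal
R}(\gamma)$ consists of the configurations of least size with given counts.

A configuration is good if no gap has a bead with the same node above it. A gap and a higher bead at
the same node bound a closed circuit of the walk; the circuit can be cut out and put back where the
walk next meets it (`exists_exchange`). Either the size drops, which is impossible in a class of
minimal size, or the size is kept and the partition moves up in the dominance order. So every member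
of the class is dominated by a good one, and good configurations are determined by their bead counts
(`Good.eq_of_beadCount`). This gives the maximum.

The minimum comes from the same argument for conjugates. Conjugation is complement and reversal, and
turns step `1` into step `1 + e`. Only one exchange has to be excluded, the descent of a lone bead
over gaps, for which the gap counts are not controlled. Such a bead would give every residue an odd
part in the conjugate (`oddCount_conj_pos`), against the zero entry of the runner matrix. The zero
entry also makes the maximum regular.

For the Mullineux map, let `S` be the maximum and `T` the conjugate of the minimum. Then `S` and
`conj H T` have equal numbers of beads and of gaps at every node (`sameData_of_beadCount`), the
first being `Good` and the second `EGood`. From the top, follow gap steps backwards for as long as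
some unused gap leads to the node reached. The length of this path depends on the gap counts alone.
In `conj H T` it consists of the gaps above the topmost bead; in `S` it is traced by the `e`-rim.
Hence peeling `S` changes the counts exactly as deleting the top bead of `conj H T` does
(`SameData.peel`), and that deletion fills the first gap of `T`. Then the roles are exchanged: `T`
is peeled while the first gap of the peeled `S` is filled. In the end both have lost their `e`-rims
and are still paired (`Paired.next`). Comparing sums of beads gives equal rim sizes `A` and numbers
of parts adding up to `A + ε`; here `ε` is visible in whether peeling moves the first gap
(`dvd_card_eRim_iff`). Induction yields the two symbols, and a symbol determines its partition
because the peeled set and the sum determine the beads (`eq_of_peel_eq`,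
`HasMullineuxSymbol.injective`). -/

/-! ### Sets of beads -/

namespace BeadSet

/-- The number of beads below `v`. -/
def below (S : Finset ℕ) (v : ℕ) : ℕ := (S.filter (· < v)).card

theorem below_zero (S : Finset ℕ) : below S 0 = 0 := by simp [below]

theorem below_succ_of_mem {S : Finset ℕ} {v : ℕ} (h : v ∈ S) :
    below S (v + 1) = below S v + 1 := by
  have : S.filter (· < v + 1) = insert v (S.filter (· < v)) := by
    ext x; simp only [Finset.mem_filter, Finset.mem_insert]
    constructor
    · rintro ⟨h1, h2⟩
      rcases Nat.lt_succ_iff_lt_or_eq.1 h2 with h3 | h3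
      · exact Or.inr ⟨h1, h3⟩
      · exact Or.inl h3
    · rintro (rfl | ⟨h1, h2⟩)
      · exact ⟨h, by omega⟩
      · exact ⟨h1, by omega⟩
  rw [below, this, Finset.card_insert_of_notMem (by simp), below]

theorem below_succ_of_notMem {S : Finset ℕ} {v : ℕ} (h : v ∉ S) :
    below S (v + 1) = below S v := by
  unfold below
  congr 1
  ext x; simp only [Finset.mem_filter]
  constructor
  · rintro ⟨h1, h2⟩
    exact ⟨h1, lt_of_le_of_ne (by omega) (fun h3 => h (h3 ▸ h1))⟩
  · rintro ⟨h1, h2⟩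
    exact ⟨h1, by omega⟩

theorem below_mono (S : Finset ℕ) {v w : ℕ} (h : v ≤ w) : below S v ≤ below S w :=
  Finset.card_le_card fun x => by
    simp only [Finset.mem_filter]; rintro ⟨h1, h2⟩; exact ⟨h1, by omega⟩

theorem below_le_card (S : Finset ℕ) (v : ℕ) : below S v ≤ S.card := Finset.card_filter_le _ _

theorem below_eq_card {S : Finset ℕ} {v : ℕ} (h : ∀ b ∈ S, b < v) : below S v = S.card := by
  unfold below
  rw [Finset.filter_true_of_mem h]

theorem below_congr {S S' : Finset ℕ} {v : ℕ} (h : ∀ w < v, w ∈ S ↔ w ∈ S') :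
    below S v = below S' v := by
  unfold below
  congr 1
  ext x; simp only [Finset.mem_filter]
  constructor <;> rintro ⟨h1, h2⟩
  · exact ⟨(h x h2).1 h1, h2⟩
  · exact ⟨(h x h2).2 h1, h2⟩

theorem below_le (S : Finset ℕ) (v : ℕ) : below S v ≤ v := by
  calc below S v ≤ (Finset.range v).card := Finset.card_le_card fun x => by simp
    _ = v := by simp

/-- The node at which a bead configuration arrives before position `v`: a gap is a step by `a`,
and a bead is a step by `a + e`. -/
def node (e : ℕ) (a : ZMod (2 * e)) (S : Finset ℕ) (v : ℕ) : ZMod (2 * e) :=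
  a * v + e * below S v

section node

variable {e : ℕ} {a : ZMod (2 * e)} {S S' : Finset ℕ} {v : ℕ}

theorem node_zero : node e a S 0 = 0 := by simp [node, below_zero]

theorem node_succ_of_mem (h : v ∈ S) : node e a S (v + 1) = node e a S v + a + e := by
  simp only [node, below_succ_of_mem h]; push_cast; ring

theorem node_succ_of_notMem (h : v ∉ S) : node e a S (v + 1) = node e a S v + a := by
  simp only [node, below_succ_of_notMem h]; push_cast; ring

theorem node_congr (h : ∀ w < v, w ∈ S ↔ w ∈ S') : node e a S v = node e a S' v := by
  rw [node, node, below_congr h]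

theorem e_add_e (e : ℕ) : (e : ZMod (2 * e)) + e = 0 := by
  have := ZMod.natCast_self (2 * e)
  push_cast at this
  linear_combination this

/-- The two kinds of colourings of the beads that matter. -/
def IsStep (e : ℕ) (a : ZMod (2 * e)) : Prop :=
  ZMod.castHom (dvd_mul_left e 2) (ZMod e) a = 1

theorem isStep_one (e : ℕ) : IsStep e 1 := map_one _

theorem IsStep.add (h : IsStep e a) : IsStep e (a + e) := by
  unfold IsStep at *
  rw [map_add, h, map_natCast, ZMod.natCast_self, add_zero]

theorem cast_node (ha : IsStep e a) (S : Finset ℕ) (v : ℕ) :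
    ZMod.castHom (dvd_mul_left e 2) (ZMod e) (node e a S v) = v := by
  unfold IsStep at ha
  rw [node, map_add, map_mul, map_mul, ha, map_natCast, map_natCast, ZMod.natCast_self]
  ring

theorem modEq_of_node_eq (ha : IsStep e a) {w : ℕ} (h : node e a S v = node e a S' w) :
    v ≡ w [MOD e] := by
  rw [← ZMod.natCast_eq_natCast_iff, ← cast_node ha S v, ← cast_node ha S' w, h]

theorem modEq_of_node_eq_add (ha : IsStep e a) {w : ℕ}
    (h : node e a S v = node e a S' w + e) : v ≡ w [MOD e] := by
  rw [← ZMod.natCast_eq_natCast_iff, ← cast_node ha S v, ← cast_node ha S' w, h, map_add,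
    map_natCast, ZMod.natCast_self, add_zero]

/-- The kernel of `ZMod (2 * e) → ZMod e` is `{0, e}`, so just two nodes lie over each residue. In a
good set this turns "congruent, but not the same node" into "differing by `e`". -/
theorem node_eq_or (he : 0 < e) (ha : IsStep e a) {w : ℕ} (h : v ≡ w [MOD e]) :
    node e a S v = node e a S' w ∨ node e a S v = node e a S' w + e := by
  have : NeZero (2 * e) := ⟨by omega⟩
  have h1 : ZMod.castHom (dvd_mul_left e 2) (ZMod e) (node e a S v - node e a S' w) = 0 := by
    rw [map_sub, cast_node ha, cast_node ha, (ZMod.natCast_eq_natCast_iff _ _ _).2 h, sub_self]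
  obtain ⟨n, hn⟩ : ∃ n : ℕ, node e a S v - node e a S' w = n :=
    ⟨_, (ZMod.natCast_zmod_val _).symm⟩
  rw [hn, map_natCast, ZMod.natCast_eq_zero_iff] at h1
  obtain ⟨k, rfl⟩ := h1
  rcases Nat.even_or_odd' k with ⟨m, rfl | rfl⟩
  · left
    have : ((e * (2 * m) : ℕ) : ZMod (2 * e)) = 0 := by
      push_cast; linear_combination m * e_add_e e
    rw [this] at hn
    exact sub_eq_zero.1 hn
  · right
    have : ((e * (2 * m + 1) : ℕ) : ZMod (2 * e)) = e := by
      push_cast; linear_combination m * e_add_e e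
    rw [this] at hn
    linear_combination hn

end node

/-- No gap has a bead with the same node above it. -/
def Good (e : ℕ) (a : ZMod (2 * e)) (S : Finset ℕ) : Prop :=
  ∀ p b, p < b → p ∉ S → b ∈ S → node e a S p ≠ node e a S b

/-- No gap has a bead above it such that the gap and the bead lead to the same node. -/
def EGood (e : ℕ) (a : ZMod (2 * e)) (S : Finset ℕ) : Prop :=
  ∀ p b, p < b → p ∉ S → b ∈ S → node e a S p ≠ node e a S b + e

/-- The number of beads at the node `w`. -/
def beadCount (e : ℕ) (a : ZMod (2 * e)) (S : Finset ℕ) (w : ZMod (2 * e)) : ℕ :=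
  (S.filter fun v => node e a S v = w).card

/-- The number of gaps below `H` at the node `w`. -/
def gapCount (e : ℕ) (a : ZMod (2 * e)) (H : ℕ) (S : Finset ℕ) (w : ZMod (2 * e)) : ℕ :=
  ((Finset.range H).filter fun v => v ∉ S ∧ node e a S v = w).card

/-- Two sets of beads have the same numbers of beads and of gaps at each node. -/
def SameData (e : ℕ) (a : ZMod (2 * e)) (H : ℕ) (S S' : Finset ℕ) : Prop :=
  S.card = S'.card ∧ beadCount e a S = beadCount e a S' ∧ gapCount e a H S = gapCount e a H S'

theorem card_eq_sum_beadCount {e : ℕ} [NeZero (2 * e)] (a : ZMod (2 * e)) (S : Finset ℕ) :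
    S.card = ∑ w, beadCount e a S w :=
  Finset.card_eq_sum_card_fiberwise (fun _ _ => Finset.mem_univ _)

/-- A good set of beads is determined by the numbers of beads at the nodes. -/
theorem Good.eq_of_beadCount {e : ℕ} {a : ZMod (2 * e)} {S S' : Finset ℕ} (hS : Good e a S)
    (hS' : Good e a S') (h : beadCount e a S = beadCount e a S') : S = S' := by
  have key : ∀ S S' : Finset ℕ, Good e a S' → beadCount e a S = beadCount e a S' →
      ∀ p, (∀ w < p, w ∈ S ↔ w ∈ S') → p ∈ S → p ∈ S' := by
    intro S S' hS' h p hp hpS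
    by_contra hpS'
    have hn : node e a S p = node e a S' p := node_congr hp
    have h1 := congrFun h (node e a S p)
    -- At the first difference `p`, goodness keeps all beads of `S'` with this node below the gap
    -- `p`, where the two sets agree; `S` has these beads and `p` besides.
    have h2 : S'.filter (fun v => node e a S' v = node e a S p) ⊂
        S.filter (fun v => node e a S v = node e a S p) := by
      refine (Finset.ssubset_iff_of_subset fun v hv => ?_).2
        ⟨p, by simp [hpS], by simp [hpS']⟩
      simp only [Finset.mem_filter] at hv ⊢
      have hvp : v < p := by
        rcases lt_trichotomy v p with h | h | h
        · exact h
        · exact absurd (h ▸ hv.1) hpS'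
        · exact absurd (hn.symm.trans hv.2.symm) (hS' p v h hpS' hv.1)
      exact ⟨(hp v hvp).2 hv.1, by
        rw [← hv.2]; exact node_congr fun w hw => hp w (by omega)⟩
    have := Finset.card_lt_card h2
    unfold beadCount at h1
    omega
  ext p
  induction p using Nat.strong_induction_on with
  | _ p ih =>
    exact ⟨key S S' hS' h p ih, key S' S hS h.symm p fun w hw => (ih w hw).symm⟩

/-! ### Conjugation -/

/-- Complement and reversal in the window `[0, H)`. -/
def conj (H : ℕ) (S : Finset ℕ) : Finset ℕ := (Finset.range H).filter fun v => H - 1 - v ∉ S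

theorem mem_conj {H v : ℕ} {S : Finset ℕ} : v ∈ conj H S ↔ v < H ∧ H - 1 - v ∉ S := by
  simp [conj]

theorem conj_subset (H : ℕ) (S : Finset ℕ) : conj H S ⊆ Finset.range H := Finset.filter_subset _ _

theorem conj_conj {H : ℕ} {S : Finset ℕ} (h : S ⊆ Finset.range H) : conj H (conj H S) = S := by
  ext v
  simp only [mem_conj, not_and, not_not]
  constructor
  · rintro ⟨h1, h2⟩
    have := h2 (by omega)
    rwa [show H - 1 - (H - 1 - v) = v by omega] at this
  · intro h1
    have h2 := Finset.mem_range.1 (h h1)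
    exact ⟨h2, fun _ => by rwa [show H - 1 - (H - 1 - v) = v by omega]⟩

theorem card_conj {H : ℕ} {S : Finset ℕ} (h : S ⊆ Finset.range H) :
    (conj H S).card + S.card = H := by
  have : (conj H S).card = (Finset.range H \ S).card := by
    refine Finset.card_bij (fun v _ => H - 1 - v) ?_ ?_ ?_
    · intro v hv
      rw [mem_conj] at hv
      simp only [Finset.mem_sdiff, Finset.mem_range]
      exact ⟨by omega, hv.2⟩
    · intro v hv w hw hvw
      rw [mem_conj] at hv hw
      omega
    · intro v hv
      simp only [Finset.mem_sdiff, Finset.mem_range] at hv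
      refine ⟨H - 1 - v, mem_conj.2 ⟨by omega, ?_⟩, by omega⟩
      rw [show H - 1 - (H - 1 - v) = v by omega]
      exact hv.2
  rw [this, Finset.card_sdiff_of_subset h, Finset.card_range]
  have := Finset.card_le_card h
  rw [Finset.card_range] at this
  omega

section conjNode

variable {e : ℕ} {a : ZMod (2 * e)} {H : ℕ} {S S' : Finset ℕ}

/-- The conjugate walks the same steps backwards: a bead becomes a gap with step `a + e`, and a gap
becomes a bead with step `a + e + e = a`. -/
theorem node_conj {k : ℕ} (hk : k ≤ H) :
    node e (a + e) (conj H S) k = node e a S H - node e a S (H - k) := by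
  induction k with
  | zero => simp [node_zero]
  | succ k ih =>
    have ih := ih (by omega)
    have h1 : H - k = (H - (k + 1)) + 1 := by omega
    have h2 : H - 1 - k = H - (k + 1) := by omega
    by_cases h : H - (k + 1) ∈ S
    · have h3 : k ∉ conj H S := by rw [mem_conj, h2]; simp [h]
      rw [node_succ_of_notMem h3, ih, h1, node_succ_of_mem h]
      ring
    · have h3 : k ∈ conj H S := by rw [mem_conj, h2]; exact ⟨by omega, h⟩
      rw [node_succ_of_mem h3, ih, h1, node_succ_of_notMem h]
      linear_combination e_add_e e

theorem node_conj_of_mem {v : ℕ} (hv : v < H) (h : v ∈ S) :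
    node e (a + e) (conj H S) (H - 1 - v) = node e a S H - a - e - node e a S v := by
  rw [node_conj (by omega), show H - (H - 1 - v) = v + 1 by omega, node_succ_of_mem h]
  ring

theorem node_conj_of_notMem {v : ℕ} (hv : v < H) (h : v ∉ S) :
    node e (a + e) (conj H S) (H - 1 - v) = node e a S H - a - node e a S v := by
  rw [node_conj (by omega), show H - (H - 1 - v) = v + 1 by omega, node_succ_of_notMem h]
  ring

theorem mem_conj_flip {v : ℕ} (hv : v < H) : H - 1 - v ∈ conj H S ↔ v ∉ S := by
  rw [mem_conj, show H - 1 - (H - 1 - v) = v by omega]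
  exact ⟨fun h => h.2, fun h => ⟨by omega, h⟩⟩

/-- Reversing a step exchanges its start and its end, so coinciding starts become coinciding ends.
This is why goodness has the companion notion `EGood`. -/
theorem good_conj (hS : S ⊆ Finset.range H) : Good e (a + e) (conj H S) ↔ EGood e a S := by
  constructor
  · intro h p b hpb hp hb heq
    have hb' := Finset.mem_range.1 (hS hb)
    refine h (H - 1 - b) (H - 1 - p) (by omega) ?_ ?_ ?_
    · rw [mem_conj_flip hb']; simpa using hb
    · rwa [mem_conj_flip (by omega)]
    · rw [node_conj_of_mem hb' hb, node_conj_of_notMem (by omega) hp, heq]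
      ring
  · intro h p b hpb hp hb heq
    have hb' := Finset.mem_range.1 (conj_subset H S hb)
    obtain ⟨p, hp', rfl⟩ : ∃ q, q < H ∧ p = H - 1 - q := ⟨H - 1 - p, by omega, by omega⟩
    obtain ⟨b, hb'', rfl⟩ : ∃ q, q < H ∧ b = H - 1 - q := ⟨H - 1 - b, by omega, by omega⟩
    rw [mem_conj_flip hp', not_not] at hp
    rw [mem_conj_flip hb''] at hb
    refine h b p (by omega) hb hp ?_
    rw [node_conj_of_mem hp' hp, node_conj_of_notMem hb'' hb] at heq
    linear_combination heq

theorem beadCount_conj (w : ZMod (2 * e)) :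
    beadCount e (a + e) (conj H S) w = gapCount e a H S (node e a S H - a - w) := by
  refine Finset.card_bij (fun v _ => H - 1 - v) ?_ ?_ ?_
  · intro v hv
    simp only [Finset.mem_filter, mem_conj, Finset.mem_range] at hv ⊢
    refine ⟨by omega, hv.1.2, ?_⟩
    have := node_conj_of_notMem (e := e) (a := a) (H := H) (v := H - 1 - v) (by omega) hv.1.2
    rw [show H - 1 - (H - 1 - v) = v by omega] at this
    rw [← hv.2, this]; ring
  · intro v hv w hw hvw
    simp only [Finset.mem_filter, mem_conj] at hv hw
    omega
  · intro v hv
    simp only [Finset.mem_filter, Finset.mem_range] at hv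
    have hvH : v < H := hv.1
    refine ⟨H - 1 - v, ?_, show H - 1 - (H - 1 - v) = v by omega⟩
    simp only [Finset.mem_filter]
    rw [mem_conj_flip hv.1, node_conj_of_notMem hv.1 hv.2.1, hv.2.2]
    exact ⟨hv.2.1, by ring⟩

theorem gapCount_conj (hS : S ⊆ Finset.range H) (w : ZMod (2 * e)) :
    gapCount e (a + e) H (conj H S) w = beadCount e a S (node e a S H - a - e - w) := by
  symm
  refine Finset.card_bij (fun v _ => H - 1 - v) ?_ ?_ ?_
  · intro v hv
    simp only [Finset.mem_filter, Finset.mem_range] at hv ⊢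
    have hv' := Finset.mem_range.1 (hS hv.1)
    refine ⟨by omega, ?_, ?_⟩
    · rw [mem_conj_flip hv']; simpa using hv.1
    · rw [node_conj_of_mem hv' hv.1, hv.2]; ring
  · intro v hv w hw hvw
    simp only [Finset.mem_filter] at hv hw
    have := Finset.mem_range.1 (hS hv.1)
    have := Finset.mem_range.1 (hS hw.1)
    omega
  · intro v hv
    simp only [Finset.mem_filter, Finset.mem_range] at hv
    have hm : H - 1 - v ∈ S := by
      by_contra h
      exact hv.2.1 (mem_conj.2 ⟨hv.1, h⟩)
    have hvH : v < H := hv.1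
    refine ⟨H - 1 - v, ?_, show H - 1 - (H - 1 - v) = v by omega⟩
    simp only [Finset.mem_filter]
    have := node_conj_of_mem (e := e) (a := a) (H := H) (v := H - 1 - v) (by omega) hm
    rw [show H - 1 - (H - 1 - v) = v by omega] at this
    refine ⟨hm, ?_⟩
    rw [← hv.2.2, this]; ring

theorem node_top (hS : S ⊆ Finset.range H) : node e a S H = a * H + e * S.card := by
  rw [node, below_eq_card fun b hb => Finset.mem_range.1 (hS hb)]

theorem SameData.conj (hS : S ⊆ Finset.range H) (hS' : S' ⊆ Finset.range H)
    (h : SameData e a H S S') : SameData e (a + e) H (conj H S) (BeadSet.conj H S') := by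
  obtain ⟨h1, h2, h3⟩ := h
  refine ⟨by have := card_conj hS; have := card_conj hS'; omega, ?_, ?_⟩
  · ext w
    rw [beadCount_conj, beadCount_conj, node_top hS, node_top hS', h1, h3]
  · ext w
    rw [gapCount_conj hS, gapCount_conj hS', node_top hS, node_top hS', h1, h2]

theorem SameData.symm (h : SameData e a H S S') : SameData e a H S' S :=
  ⟨h.1.symm, h.2.1.symm, h.2.2.symm⟩

end conjNode

/-- In the colouring with step `1`, the numbers of beads at the nodes determine the numbers of
gaps at the nodes. -/
theorem sameData_of_beadCount {e : ℕ} (he : 0 < e) {H : ℕ} {S S' : Finset ℕ}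
    (hS : S ⊆ Finset.range H) (hS' : S' ⊆ Finset.range H)
    (h : beadCount e 1 S = beadCount e 1 S') : SameData e 1 H S S' := by
  have hz : NeZero (2 * e) := ⟨by omega⟩
  have hcard : S.card = S'.card := by
    rw [card_eq_sum_beadCount (e := e) 1 S, card_eq_sum_beadCount (e := e) 1 S', h]
  refine ⟨hcard, h, ?_⟩
  -- conservation of the flow through the nodes
  have flow : ∀ (S : Finset ℕ), S ⊆ Finset.range H → ∀ w : ZMod (2 * e),
      (gapCount e 1 H S w : ℤ) + beadCount e 1 S w + (if node e 1 S H = w then 1 else 0) =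
        gapCount e 1 H S (w - 1) + beadCount e 1 S (w - 1 - e) + (if 0 = w then 1 else 0) := by
    intro S hS w
    have h1 : ∀ w, ((gapCount e 1 H S w : ℕ) : ℤ) = ∑ v ∈ Finset.range H,
        if v ∉ S ∧ node e 1 S v = w then (1 : ℤ) else 0 := by
      intro w; rw [gapCount, Finset.card_filter]; push_cast; rfl
    have h2 : ∀ w, ((beadCount e 1 S w : ℕ) : ℤ) = ∑ v ∈ Finset.range H,
        if v ∈ S ∧ node e 1 S v = w then (1 : ℤ) else 0 := by
      intro w
      have : S.filter (fun v => node e 1 S v = w) =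
          (Finset.range H).filter fun v => v ∈ S ∧ node e 1 S v = w := by
        ext v; simp only [Finset.mem_filter]
        exact ⟨fun h => ⟨hS h.1, h⟩, fun h => h.2⟩
      rw [beadCount, this, Finset.card_filter]; push_cast; rfl
    rw [h1, h1, h2, h2, ← Finset.sum_add_distrib, ← Finset.sum_add_distrib]
    have h3 : ∀ v, (if v ∉ S ∧ node e 1 S v = w then (1 : ℤ) else 0) +
        (if v ∈ S ∧ node e 1 S v = w then (1 : ℤ) else 0) =
        if node e 1 S v = w then 1 else 0 := by
      intro v; by_cases h : v ∈ S <;> simp [h]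
    have h4 : ∀ v, (if v ∉ S ∧ node e 1 S v = w - 1 then (1 : ℤ) else 0) +
        (if v ∈ S ∧ node e 1 S v = w - 1 - e then (1 : ℤ) else 0) =
        if node e 1 S (v + 1) = w then 1 else 0 := by
      intro v; by_cases h : v ∈ S
      · rw [node_succ_of_mem h]
        simp only [h, not_true_eq_false, false_and, if_false, true_and, zero_add]
        congr 1
        exact propext ⟨fun h => by rw [h]; ring, fun h => by rw [← h]; ring⟩
      · rw [node_succ_of_notMem h]
        simp only [h, not_false_eq_true, false_and, if_false, true_and, add_zero]
        congr 1
        exact propext ⟨fun h => by rw [h]; ring, fun h => by rw [← h]; ring⟩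
    simp only [h3, h4]
    have h5 := Finset.sum_range_succ (fun v => if node e 1 S v = w then (1 : ℤ) else 0) H
    have h6 := Finset.sum_range_succ' (fun v => if node e 1 S v = w then (1 : ℤ) else 0) H
    rw [node_zero] at h6
    linarith
  -- The end of the walk depends only on the number of beads, so in the difference of the two flow
  -- equations only gap counts survive.
  have hδ : ∀ w, (gapCount e 1 H S w : ℤ) - gapCount e 1 H S' w =
      gapCount e 1 H S (w - 1) - gapCount e 1 H S' (w - 1) := by
    intro w
    have h1 := flow S hS w
    have h2 := flow S' hS' w
    rw [node_top hS, h] at h1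
    rw [node_top hS', ← hcard] at h2
    linarith
  have hconst : ∀ n : ℕ, (gapCount e 1 H S (n : ZMod (2 * e)) : ℤ) - gapCount e 1 H S' n =
      gapCount e 1 H S 0 - gapCount e 1 H S' 0 := by
    intro n
    induction n with
    | zero => simp
    | succ n ih => rw [hδ, ← ih]; push_cast; rw [add_sub_cancel_right]
  have hconst' : ∀ w, (gapCount e 1 H S w : ℤ) - gapCount e 1 H S' w =
      gapCount e 1 H S 0 - gapCount e 1 H S' 0 := by
    intro w
    have := hconst w.val
    rwa [ZMod.natCast_zmod_val] at this
  have htot : ∀ S : Finset ℕ, S ⊆ Finset.range H → ∑ w, (gapCount e 1 H S w : ℤ) = H - S.card := by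
    intro S hS
    have h1 : (Finset.range H \ S).card = ∑ w, gapCount e 1 H S w := by
      rw [Finset.card_eq_sum_card_fiberwise (f := node e 1 S) (t := Finset.univ)
        (fun _ _ => Finset.mem_univ _)]
      refine Finset.sum_congr rfl fun w _ => ?_
      rw [gapCount]
      congr 1
      ext v; simp [and_assoc]
    rw [Finset.card_sdiff_of_subset hS, Finset.card_range] at h1
    have := Finset.card_le_card hS
    rw [Finset.card_range] at this
    zify [this] at h1
    exact h1.symm
  -- The step `1` generates `ZMod (2 * e)`, so the difference is one constant; equal total numbers
  -- of gaps force it to vanish.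
  have h0 : ∑ w : ZMod (2 * e), ((gapCount e 1 H S w : ℤ) - gapCount e 1 H S' w) = 0 := by
    rw [Finset.sum_sub_distrib, htot S hS, htot S' hS', hcard, sub_self]
  simp only [hconst'] at h0
  rw [Finset.sum_const, Finset.card_univ, ZMod.card, nsmul_eq_mul] at h0
  have h7 : (gapCount e 1 H S 0 : ℤ) - gapCount e 1 H S' 0 = 0 := by
    rcases mul_eq_zero.1 h0 with h | h
    · exact absurd h (by exact_mod_cast hz.out)
    · exact h
  ext w
  have := hconst' w
  omega

end BeadSet

/-! ### The exchange -/

namespace BeadSet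

/-- The representative of `v` modulo `M` in `[p, p + M)`. -/
def wrap (p M v : ℕ) : ℕ := p + (v - p) % M

theorem wrap_lt {p M : ℕ} (hM : 0 < M) (v : ℕ) : wrap p M v < p + M := by
  have := Nat.mod_lt (v - p) hM
  unfold wrap; omega

theorem le_wrap (p M v : ℕ) : p ≤ wrap p M v := by unfold wrap; omega

theorem wrap_of_lt {p M v : ℕ} (h1 : p ≤ v) (h2 : v < p + M) : wrap p M v = v := by
  rw [wrap, Nat.mod_eq_of_lt (by omega)]; omega

theorem wrap_add {p M v : ℕ} (h1 : p ≤ v) : wrap p M (v + M) = wrap p M v := by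
  rw [wrap, wrap, show v + M - p = v - p + M by omega, Nat.add_mod_right]

theorem wrap_self {p M : ℕ} : wrap p M p = p := by simp [wrap]

theorem wrap_succ {p M v : ℕ} (hM : 0 < M) (h1 : p ≤ v) :
    wrap p M (v + 1) = wrap p M v + 1 ∨ (wrap p M v + 1 = p + M ∧ wrap p M (v + 1) = p) := by
  have h := Nat.mod_add_div (v - p) M
  have hlt := Nat.mod_lt (v - p) hM
  have h2 : v + 1 - p = ((v - p) % M + 1) + M * ((v - p) / M) := by omega
  unfold wrap
  rw [h2, Nat.add_mul_mod_self_left]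
  rcases Nat.lt_or_ge ((v - p) % M + 1) M with h3 | h3
  · left; rw [Nat.mod_eq_of_lt h3]; omega
  · right
    have h4 : (v - p) % M + 1 = M := by omega
    rw [h4, Nat.mod_self]; omega

theorem wrap_injOn {p M v w : ℕ} (h1 : p ≤ v) (h2 : v ≤ w) (h3 : w < v + M)
    (h : wrap p M v = wrap p M w) : v = w := by
  have h4 : v - p ≡ w - p [MOD M] := by unfold wrap at h; exact Nat.add_left_cancel h
  have h5 := (Nat.modEq_iff_dvd' (by omega)).1 h4
  have h6 := Nat.eq_zero_of_dvd_of_lt h5 (by omega)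
  omega

section

variable {e : ℕ} {a : ZMod (2 * e)} {S : Finset ℕ} {p M t : ℕ}

theorem node_wrap_succ (hM : 0 < M) (hn : node e a S p = node e a S (p + M)) {v : ℕ}
    (hv : p ≤ v) : node e a S (wrap p M v + 1) = node e a S (wrap p M (v + 1)) := by
  rcases wrap_succ hM hv with h | ⟨h, h'⟩
  · rw [h]
  · rw [h, h', hn]

/-- The permutation of the positions in the exchange. -/
def shuffle (p M t v : ℕ) : ℕ :=
  if p ≤ v ∧ v + M ≤ t then v + M else if t < v + M ∧ v ≤ t then wrap p M v else v

theorem shuffle_lt {H v : ℕ} (hM : 0 < M) (ht : p + M < t) (htH : t < H) (hv : v < H) :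
    shuffle p M t v < H := by
  have := wrap_lt (p := p) hM v
  unfold shuffle
  split_ifs <;> omega

theorem shuffle_injective (hM : 0 < M) (ht : p + M < t) : Function.Injective (shuffle p M t) := by
  intro v w h
  have h1 := wrap_lt (p := p) hM v
  have h2 := wrap_lt (p := p) hM w
  have h3 := le_wrap p M v
  have h4 := le_wrap p M w
  unfold shuffle at h
  split_ifs at h
  any_goals omega
  rcases le_total v w with h5 | h5
  · exact wrap_injOn (by omega) h5 (by omega) h
  · exact (wrap_injOn (by omega) h5 (by omega) h.symm).symm

theorem card_filter_shuffle {H : ℕ} (hM : 0 < M) (ht : p + M < t) (htH : t < H) (P : ℕ → Prop)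
    [DecidablePred P] : ((Finset.range H).filter fun v => P (shuffle p M t v)).card =
      ((Finset.range H).filter P).card := by
  have himg : (Finset.range H).image (shuffle p M t) = Finset.range H := by
    apply Finset.eq_of_subset_of_card_le
    · intro v hv
      obtain ⟨w, hw, rfl⟩ := Finset.mem_image.1 hv
      exact Finset.mem_range.2 (shuffle_lt hM ht htH (Finset.mem_range.1 hw))
    · rw [Finset.card_image_of_injective _ (shuffle_injective hM ht)]
  conv_rhs => rw [← himg]
  rw [Finset.filter_image, Finset.card_image_of_injective _ (shuffle_injective hM ht)]

variable (hM : 0 < M) (hp : p ∉ S) (hb : p + M ∈ S) (hn : node e a S p = node e a S (p + M))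
  (ht : p + M < t) (hbt : ∀ v, p + M < v → v < t → (v ∈ S ↔ wrap p M v ∈ S))
  (htt : t ∈ S ↔ wrap p M t ∉ S)

-- The gap `p` and the bead `p + M` leave the same node by steps that differ by `e`; as long as the
-- later steps repeat the circuit, the offset `e` persists.
include hM hp hb hn hbt in
theorem node_eq_node_wrap_add {v : ℕ} (hv : p + M < v) (hvt : v ≤ t) :
    node e a S v = node e a S (wrap p M v) + e := by
  induction v with
  | zero => omega
  | succ v ih =>
    rcases Nat.lt_or_ge (p + M) v with h | h
    · have ih := ih h (by omega)
      rw [← node_wrap_succ hM hn (by omega)]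
      by_cases hvS : v ∈ S
      · rw [node_succ_of_mem hvS, node_succ_of_mem ((hbt v h (by omega)).1 hvS), ih]; ring
      · rw [node_succ_of_notMem hvS,
          node_succ_of_notMem (fun h' => hvS ((hbt v h (by omega)).2 h')), ih]; ring
    · obtain rfl : v = p + M := by omega
      rw [← node_wrap_succ hM hn (by omega), wrap_add le_rfl, wrap_self, node_succ_of_mem hb,
        node_succ_of_notMem hp, hn]

-- At the first disagreement one step is a bead and the other a gap, which adds a second offset `e`
-- and cancels the first. Here the walk meets the circuit again.
include hM hp hb hn ht hbt htt in
theorem node_succ_wrap_eq : node e a S (wrap p M t + 1) = node e a S (t + 1) := by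
  have h := node_eq_node_wrap_add hM hp hb hn hbt ht le_rfl
  by_cases h1 : t ∈ S
  · rw [node_succ_of_mem h1, node_succ_of_notMem (htt.1 h1), h]
    linear_combination -e_add_e e
  · have h2 : wrap p M t ∈ S := by by_contra h2; exact h1 (htt.2 h2)
    rw [node_succ_of_notMem h1, node_succ_of_mem h2, h]; ring

-- The new walk skips the circuit at `p`, follows the old positions from `p + M` to `t`, and then
-- goes once round the circuit from the vertex met there. It uses the same steps at the same nodes
-- in another order, so all counts are kept.
include hM hp hb hn ht hbt htt in
theorem node_shuffle {S2 : Finset ℕ} (h2 : ∀ v, v ∈ S2 ↔ shuffle p M t v ∈ S) (v : ℕ) :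
    node e a S2 v = node e a S (shuffle p M t v) := by
  have hstep : ∀ v w, (v ∈ S2 ↔ w ∈ S) → node e a S2 v = node e a S w →
      node e a S2 (v + 1) = node e a S (w + 1) := by
    intro v w h h'
    by_cases hv : v ∈ S2
    · rw [node_succ_of_mem hv, node_succ_of_mem (h.1 hv), h']
    · rw [node_succ_of_notMem hv, node_succ_of_notMem (fun h'' => hv (h.2 h'')), h']
  induction v with
  | zero =>
    rw [node_zero]
    by_cases h0 : p = 0
    · subst h0
      rw [shuffle, if_pos (by omega), ← node_zero (e := e) (a := a) (S := S), hn]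
    · rw [shuffle, if_neg (by omega), if_neg (by omega), node_zero]
  | succ v ih =>
    rw [hstep v _ (h2 v) ih]
    rcases Nat.lt_or_ge (v + 1) p with h | h
    · simp only [shuffle]
      rw [if_neg (by omega), if_neg (by omega), if_neg (by omega), if_neg (by omega)]
    rcases Nat.lt_or_ge v p with h3 | h3
    · obtain rfl : p = v + 1 := by omega
      simp only [shuffle]
      rw [if_neg (by omega), if_neg (by omega), if_pos (by omega), hn]
    rcases Nat.lt_or_ge t (v + M) with h4 | h4
    · have e1 : shuffle p M t v = if v ≤ t then wrap p M v else v := by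
        rw [shuffle, if_neg (by omega)]; simp [h4]
      have e2 : shuffle p M t (v + 1) = if v + 1 ≤ t then wrap p M (v + 1) else v + 1 := by
        rw [shuffle, if_neg (by omega)]; simp [show t < v + 1 + M by omega]
      rw [e1, e2]
      split_ifs with h5 h6
      · exact node_wrap_succ hM hn h3
      · obtain rfl : v = t := by omega
        exact node_succ_wrap_eq hM hp hb hn ht hbt htt
      · omega
      · rfl
    · have e1 : shuffle p M t v = v + M := by rw [shuffle, if_pos ⟨h3, h4⟩]
      rw [e1]
      rcases Nat.lt_or_ge t (v + 1 + M) with h5 | h5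
      · have e2 : shuffle p M t (v + 1) = wrap p M (v + 1) := by
          rw [shuffle, if_neg (by omega), if_pos (by omega)]
        obtain rfl : t = v + M := by omega
        rw [e2, ← node_wrap_succ hM hn h3, ← wrap_add h3]
        exact (node_succ_wrap_eq hM hp hb hn ht hbt htt).symm
      · rw [shuffle, if_pos (by omega)]
        congr 1; omega

-- By periodicity, shifting by `M` alters membership only at `p`, `p + M`, `t - M` and `t`. The
-- middle two may coincide, and then their contributions cancel.
include hM hp hb ht hbt htt in
theorem sum_shuffle {S2 : Finset ℕ} (h2 : ∀ v, v ∈ S2 ↔ shuffle p M t v ∈ S) (f : ℕ → ℤ) :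
    ∑ v ∈ S2, f v = ∑ v ∈ S, f v + f p - f (p + M) +
      (if t ∈ S then f (t - M) - f t else f t - f (t - M)) := by
  obtain ⟨H, hH⟩ : ∃ H, t < H ∧ S ⊆ Finset.range H :=
    ⟨t + 1 + S.sup id + 1, by omega, fun x hx => by
      have := Finset.le_sup (f := id) hx
      simp only [id] at this
      simp; omega⟩
  have hS2 : S2 ⊆ Finset.range H := by
    intro x hx
    have h3 := Finset.mem_range.1 (hH.2 ((h2 x).1 hx))
    rw [Finset.mem_range]
    unfold shuffle at h3
    split_ifs at h3 <;> omega
  have hind : ∀ S : Finset ℕ, S ⊆ Finset.range H → ∑ v ∈ S, f v =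
      ∑ v ∈ Finset.range H, if v ∈ S then f v else 0 := by
    intro S hS
    rw [← Finset.sum_filter, Finset.filter_mem_eq_inter, Finset.inter_eq_right.2 hS]
  have hpt : ∀ u, u < H → f u = ∑ v ∈ Finset.range H, if v = u then f v else 0 := by
    intro u hu
    rw [Finset.sum_ite_eq' (Finset.range H) u f, if_pos (Finset.mem_range.2 hu)]
  have hite : (if t ∈ S then f (t - M) - f t else f t - f (t - M)) =
      (if t ∈ S then 1 else -1) * (f (t - M) - f t) := by split_ifs <;> ring
  rw [hite, hind S2 hS2, hind S hH.2, hpt p (by omega), hpt (p + M) (by omega),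
    hpt (t - M) (by omega), hpt t hH.1, ← Finset.sum_add_distrib, ← Finset.sum_sub_distrib,
    ← Finset.sum_sub_distrib, Finset.mul_sum, ← Finset.sum_add_distrib]
  refine Finset.sum_congr rfl fun v _ => ?_
  have hwt : wrap p M (t - M) = wrap p M t := by
    rw [← wrap_add (show p ≤ t - M by omega), show t - M + M = t by omega]
  have hmem : v ∈ S2 ↔ if v = t then t ∉ S else if v = t - M then t ∈ S
      else if v = p then True else if v = p + M then False else v ∈ S := by
    rw [h2]
    by_cases h3 : v = t
    · subst h3
      rw [if_pos rfl, shuffle, if_neg (by omega), if_pos (by omega), htt, not_not]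
    rw [if_neg h3]
    by_cases h4 : v = t - M
    · subst h4
      rw [if_pos rfl, shuffle, if_pos (by omega), show t - M + M = t by omega]
    rw [if_neg h4]
    by_cases h5 : v = p
    · subst h5
      rw [if_pos rfl, shuffle, if_pos (by omega)]
      simp [hb]
    rw [if_neg h5]
    by_cases h6 : v = p + M
    · subst h6
      rw [if_pos rfl, iff_false]
      unfold shuffle
      split_ifs with h7 h8
      · rw [hbt (p + M + M) (by omega) (by omega), wrap_add (by omega), wrap_add le_rfl, wrap_self]
        exact hp
      · rwa [wrap_add le_rfl, wrap_self]
      · omega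
    rw [if_neg h6]
    unfold shuffle
    split_ifs with h7 h8
    · rw [hbt (v + M) (by omega) (by omega), wrap_add h7.1]
      rcases Nat.lt_or_ge v (p + M) with h9 | h9
      · rw [wrap_of_lt h7.1 h9]
      · rw [hbt v (by omega) (by omega)]
    · rcases Nat.lt_or_ge v (p + M) with h9 | h9
      · rw [wrap_of_lt (by omega) h9]
      · rw [hbt v (by omega) (by omega)]
    · rfl
  by_cases h3 : v = t
  · subst h3
    by_cases h4 : v ∈ S <;>
      simp [hmem, h4, show v ≠ p by omega, show v ≠ p + M by omega, show v ≠ v - M by omega]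
  by_cases h4 : v = t - M
  · subst h4
    by_cases h6 : t - M = p + M
    · have h8 : t ∈ S := by
        rw [htt, show t = p + M + M by omega, wrap_add (by omega), wrap_add le_rfl, wrap_self]
        exact hp
      rw [if_neg h3, if_pos rfl] at hmem
      simp [hmem, h3, h8, h6 ▸ hb, h6.symm, show t - M ≠ p by omega]
    · have h9 : t - M ∈ S ↔ t ∉ S := by
        rw [htt, not_not, ← hwt]
        rcases Nat.lt_or_ge (t - M) (p + M) with h9 | h9
        · rw [wrap_of_lt (by omega) h9]
        · exact hbt (t - M) (by omega) (by omega)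
      by_cases h8 : t ∈ S <;>
        simp [hmem, h3, h6, h9, h8, show t - M ≠ p by omega]
  by_cases h5 : v = p
  · subst h5
    simp [hmem, h3, h4, hp, hM.ne']
  by_cases h6 : v = p + M
  · subst h6
    simp [hmem, h3, h4, hb, hM.ne']
  simp [hmem, h3, h4, h5, h6]

end

/-- A set of beads that is not good can be improved, keeping the numbers of beads. -/
theorem exists_exchange {e : ℕ} {a : ZMod (2 * e)} (ha : IsStep e a) {S : Finset ℕ}
    (hS : ¬ Good e a S) :
    (∃ p b, p + e ≤ b ∧ b ∈ S ∧ (∀ v ∈ S, p ≤ v → v = b) ∧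
      ∃ S2, beadCount e a S2 = beadCount e a S ∧ ∑ v ∈ S2, v < ∑ v ∈ S, v) ∨
    ∃ S2, beadCount e a S2 = beadCount e a S ∧
      (∀ H, S ⊆ Finset.range H → S2 ⊆ Finset.range H → gapCount e a H S2 = gapCount e a H S) ∧
      (∑ v ∈ S2, v < ∑ v ∈ S, v ∨
        (∑ v ∈ S2, v = ∑ v ∈ S, v ∧ (∀ x, ∑ v ∈ S, (v - x) ≤ ∑ v ∈ S2, (v - x)) ∧
          ∑ v ∈ S, v ^ 2 < ∑ v ∈ S2, v ^ 2)) := by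
  unfold Good at hS
  push Not at hS
  obtain ⟨p, b, hpb, hp, hb, hn⟩ := hS
  obtain ⟨M, hM, rfl⟩ : ∃ M, 0 < M ∧ b = p + M := ⟨b - p, by omega, by omega⟩
  have hMe : e ≤ M := by
    have h1 := (Nat.modEq_iff_dvd' (by omega)).1 (modEq_of_node_eq ha hn)
    exact Nat.le_of_dvd hM (by simpa using h1)
  -- Such a `t` breaks the periodic continuation of the circuit; the least one is used.
  by_cases hex : ∃ t, p + M < t ∧ ¬ (t ∈ S ↔ wrap p M t ∈ S)
  · right
    classical
    obtain ⟨ht, htt⟩ := Nat.find_spec hex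
    have hbt : ∀ v, p + M < v → v < Nat.find hex → (v ∈ S ↔ wrap p M v ∈ S) := by
      intro v h1 h2
      have := Nat.find_min hex h2
      by_contra h3
      exact this ⟨h1, h3⟩
    generalize Nat.find hex = t at ht htt hbt
    replace htt : t ∈ S ↔ wrap p M t ∉ S := by tauto
    obtain ⟨K, hK⟩ : ∃ K, t < K ∧ S ⊆ Finset.range K :=
      ⟨t + 1 + S.sup id + 1, by omega, fun x hx => by
        have := Finset.le_sup (f := id) hx
        simp only [id] at this
        simp; omega⟩
    let S2 := (Finset.range K).filter fun v => shuffle p M t v ∈ S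
    have h2 : ∀ v, v ∈ S2 ↔ shuffle p M t v ∈ S := by
      intro v
      simp only [S2, Finset.mem_filter, Finset.mem_range, and_iff_right_iff_imp]
      intro hv
      have h3 := Finset.mem_range.1 (hK.2 hv)
      unfold shuffle at h3
      split_ifs at h3 <;> omega
    have hnode := node_shuffle hM hp hb hn ht hbt htt h2
    have hsum := sum_shuffle hM hp hb ht hbt htt h2
    have hcount : ∀ (P : ZMod (2 * e) → Prop) [DecidablePred P],
        (S2.filter fun v => P (node e a S2 v)).card = (S.filter fun v => P (node e a S v)).card := by
      intro P _
      have h3 := card_filter_shuffle hM ht hK.1 fun v => v ∈ S ∧ P (node e a S v)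
      convert h3 using 2
      · ext v
        simp only [Finset.mem_filter, hnode, h2, Finset.mem_range]
        refine ⟨fun h => ⟨?_, h⟩, fun h => h.2⟩
        have := (h2 v).2 h.1
        simp only [S2, Finset.mem_filter, Finset.mem_range] at this
        exact this.1
      · ext v
        simp only [Finset.mem_filter]
        exact ⟨fun h => ⟨hK.2 h.1, h⟩, fun h => h.2⟩
    refine ⟨S2, funext fun w => hcount (· = w), ?_, ?_⟩
    · intro H hH hH2
      have htH : t < H := by
        by_cases h3 : t ∈ S
        · exact Finset.mem_range.1 (hH h3)
        · refine Finset.mem_range.1 (hH2 ((h2 t).2 ?_))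
          rw [shuffle, if_neg (by omega), if_pos (by omega)]
          by_contra h4
          exact h3 (htt.2 h4)
      ext w
      have h3 := card_filter_shuffle hM ht htH fun v => v ∉ S ∧ node e a S v = w
      rw [gapCount, gapCount, ← h3]
      simp only [hnode, h2]
    -- If `t` is a bead, two beads descend by `M`. Otherwise one descends and a higher one rises by
    -- `M`, which keeps the sum and spreads the beads.
    · by_cases h3 : t ∈ S
      · left
        have := hsum fun v => v
        rw [if_pos h3] at this
        zify
        push_cast [show M ≤ t by omega] at this
        omega
      · right
        refine ⟨?_, ?_, ?_⟩
        · have := hsum fun v => v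
          rw [if_neg h3] at this
          zify
          push_cast [show M ≤ t by omega] at this
          omega
        · intro x
          have := hsum fun v => ((v - x : ℕ) : ℤ)
          rw [if_neg h3] at this
          zify
          omega
        · have := hsum fun v => (v : ℤ) ^ 2
          rw [if_neg h3] at this
          zify
          push_cast [show M ≤ t by omega] at this
          rw [this]
          have h5 : (0 : ℤ) < M := by exact_mod_cast hM
          have h6 : (p : ℤ) + M < t := by exact_mod_cast ht
          nlinarith
  · left
    have hx : ∀ t, p + M < t → (t ∈ S ↔ wrap p M t ∈ S) := by
      intro t ht
      by_contra h
      exact hex ⟨t, ht, h⟩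
    -- A bead inside the circuit would be repeated in every later period, but there are finitely
    -- many beads.
    have hgap : ∀ v, p ≤ v → v < p + M → v ∉ S := by
      intro v h1 h2 h3
      have hall : ∀ k, v + (k + 2) * M ∈ S := by
        intro k
        rw [hx _ (by nlinarith)]
        have : wrap p M (v + (k + 2) * M) = v := by
          rw [wrap, show v + (k + 2) * M - p = v - p + (k + 2) * M by omega,
            Nat.add_mul_mod_self_right, Nat.mod_eq_of_lt (by omega)]
          omega
        rwa [this]
      have h4 := Finset.le_sup (f := id) (hall (S.sup id))
      simp only [id] at h4
      nlinarith
    have hone : ∀ v ∈ S, p ≤ v → v = p + M := by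
      intro v hv h1
      by_contra h2
      rcases Nat.lt_or_ge v (p + M) with h3 | h3
      · exact hgap v h1 h3 hv
      · exact hgap _ (le_wrap p M v) (wrap_lt hM v) ((hx v (by omega)).1 hv)
    refine ⟨p, p + M, by omega, hb, hone, insert p (S.erase (p + M)), ?_, ?_⟩
    · have hlow : ∀ v ≤ p, node e a (insert p (S.erase (p + M))) v = node e a S v := by
        intro v hv
        refine node_congr fun w hw => ?_
        simp only [Finset.mem_insert, Finset.mem_erase]
        constructor
        · rintro (h | h)
          · omega
          · exact h.2
        · intro h; exact Or.inr ⟨by omega, h⟩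
      ext w
      rw [beadCount, beadCount]
      have h1 : (insert p (S.erase (p + M))).filter
          (fun v => node e a (insert p (S.erase (p + M))) v = w) =
          (insert p (S.erase (p + M))).filter fun v => node e a S v = w := by
        refine Finset.filter_congr fun v hv => ?_
        rw [hlow]
        rcases Finset.mem_insert.1 hv with h | h
        · omega
        · rw [Finset.mem_erase] at h
          by_contra h2
          exact h.1 (hone v h.2 (by omega))
      rw [h1, Finset.filter_insert]
      have h2 : S.filter (fun v => node e a S v = w) =
          (insert (p + M) (S.erase (p + M))).filter fun v => node e a S v = w := by
        rw [Finset.insert_erase hb]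
      rw [h2, Finset.filter_insert, ← hn]
      split_ifs
      · rw [Finset.card_insert_of_notMem (by simp [hp]), Finset.card_insert_of_notMem (by simp)]
      · rfl
    · rw [Finset.sum_insert (by simp [hp])]
      have := Finset.add_sum_erase S (fun v => v) hb
      omega

end BeadSet

/-! ### Peeling a set of beads -/

namespace BeadSet

/-- `Peel e S t J L`: below `t`, peeling `S` gives `J`, and `L` is the length of the path of gaps
that leads to the node at `t`. -/
inductive Peel (e : ℕ) (S : Finset ℕ) : ℕ → Finset ℕ → ℕ → Prop
  | gap {t L : ℕ} {J : Finset ℕ} (ht : t ∉ S) (h : Peel e S t J L) : Peel e S (t + 1) J (L + 1)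
  | free {t : ℕ} (ht : t ∈ S) (h : ∀ q < t, q ≡ t [MOD e] → q ∈ S) :
      Peel e S (t + 1) (S.filter (· < t)) 0
  | hook {t q L : ℕ} {J : Finset ℕ} (ht : t ∈ S) (hq : q ∉ S) (hqt : q < t)
      (hmod : q ≡ t [MOD e]) (hlast : ∀ v, q < v → v < t → v ≡ t [MOD e] → v ∈ S)
      (h : Peel e S q J L) :
      Peel e S (t + 1) (S.filter (fun v => q < v ∧ v < t) ∪ insert q J) (L + 1)

/-- The number of beads below `t` at the node `w`. -/
def beadsTo (e : ℕ) (a : ZMod (2 * e)) (t : ℕ) (S : Finset ℕ) (w : ZMod (2 * e)) : ℕ :=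
  ((Finset.range t).filter fun v => v ∈ S ∧ node e a S v = w).card

/-- The sum of the beads below `t`. -/
def sumTo (t : ℕ) (S : Finset ℕ) : ℕ := ∑ v ∈ Finset.range t, if v ∈ S then v else 0

/-! ### Counts and sums below a given height -/

section counting

variable {e : ℕ} {a : ZMod (2 * e)} {S S' : Finset ℕ} {t : ℕ} {w : ZMod (2 * e)}

theorem beadsTo_succ_of_mem (h : t ∈ S) :
    beadsTo e a (t + 1) S w = beadsTo e a t S w + if w = node e a S t then 1 else 0 := by
  simp only [beadsTo, Finset.card_filter, Finset.sum_range_succ, h, true_and, eq_comm]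

theorem beadsTo_succ_of_notMem (h : t ∉ S) : beadsTo e a (t + 1) S w = beadsTo e a t S w := by
  rw [beadsTo, beadsTo, Finset.card_filter, Finset.card_filter, Finset.sum_range_succ,
    if_neg fun h' => h h'.1, add_zero]

theorem gapCount_succ_of_mem (h : t ∈ S) : gapCount e a (t + 1) S w = gapCount e a t S w := by
  rw [gapCount, gapCount, Finset.card_filter, Finset.card_filter, Finset.sum_range_succ,
    if_neg fun h' => h'.1 h, add_zero]

theorem gapCount_succ_of_notMem (h : t ∉ S) :
    gapCount e a (t + 1) S w = gapCount e a t S w + if w = node e a S t then 1 else 0 := by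
  simp only [gapCount, Finset.card_filter, Finset.sum_range_succ, h, true_and, eq_comm,
    not_false_eq_true]

theorem sumTo_succ_of_mem (h : t ∈ S) : sumTo (t + 1) S = sumTo t S + t := by
  rw [sumTo, sumTo, Finset.sum_range_succ, if_pos h]

theorem sumTo_succ_of_notMem (h : t ∉ S) : sumTo (t + 1) S = sumTo t S := by
  rw [sumTo, sumTo, Finset.sum_range_succ, if_neg h, add_zero]

theorem beadsTo_congr (h : ∀ v < t, v ∈ S ↔ v ∈ S') : beadsTo e a t S w = beadsTo e a t S' w := by
  unfold beadsTo
  congr 1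
  refine Finset.filter_congr fun v hv => ?_
  have hv := Finset.mem_range.1 hv
  rw [h v hv, node_congr fun u hu => h u (hu.trans hv)]

theorem gapCount_congr (h : ∀ v < t, v ∈ S ↔ v ∈ S') :
    gapCount e a t S w = gapCount e a t S' w := by
  unfold gapCount
  congr 1
  refine Finset.filter_congr fun v hv => ?_
  have hv := Finset.mem_range.1 hv
  rw [h v hv, node_congr fun u hu => h u (hu.trans hv)]

theorem sumTo_congr (h : ∀ v < t, v ∈ S ↔ v ∈ S') : sumTo t S = sumTo t S' := by
  unfold sumTo
  refine Finset.sum_congr rfl fun v hv => ?_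
  simp only [h v (Finset.mem_range.1 hv)]

theorem beadsTo_eq_beadCount (h : S ⊆ Finset.range t) : beadsTo e a t S = beadCount e a S := by
  ext w
  rw [beadsTo, beadCount]
  congr 1
  ext v
  simp only [Finset.mem_filter]
  exact ⟨fun h => h.2, fun h' => ⟨h h'.1, h'⟩⟩

theorem sumTo_eq_sum (h : S ⊆ Finset.range t) : sumTo t S = ∑ v ∈ S, v := by
  rw [sumTo, ← Finset.sum_filter, Finset.filter_mem_eq_inter, Finset.inter_eq_right.2 h]

end counting

/-! ### Nodes, counts and goodness of the peeled set -/

section hook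

variable {e : ℕ} {S J : Finset ℕ} {q t : ℕ}

theorem mem_hook_of_lt {v : ℕ} (hv : v < q) :
    v ∈ S.filter (fun v => q < v ∧ v < t) ∪ insert q J ↔ v ∈ J := by
  simp only [Finset.mem_union, Finset.mem_filter, Finset.mem_insert]
  constructor
  · rintro (h | h | h)
    · omega
    · omega
    · exact h
  · exact fun h => Or.inr (Or.inr h)

theorem mem_hook_self : q ∈ S.filter (fun v => q < v ∧ v < t) ∪ insert q J := by simp

theorem mem_hook_of_gt (hJ : J ⊆ Finset.range q) {v : ℕ} (hv : q < v) (hvt : v < t) :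
    v ∈ S.filter (fun v => q < v ∧ v < t) ∪ insert q J ↔ v ∈ S := by
  simp only [Finset.mem_union, Finset.mem_filter, Finset.mem_insert]
  constructor
  · rintro (h | h | h)
    · exact h.1
    · omega
    · have := Finset.mem_range.1 (hJ h); omega
  · exact fun h => Or.inl ⟨h, hv, hvt⟩

theorem notMem_hook (hJ : J ⊆ Finset.range q) (hqt : q < t) :
    t ∉ S.filter (fun v => q < v ∧ v < t) ∪ insert q J := by
  simp only [Finset.mem_union, Finset.mem_filter, Finset.mem_insert]
  rintro (h | h | h)
  · omega
  · omega
  · have := Finset.mem_range.1 (hJ h); omega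

theorem Peel.subset {t L : ℕ} {J : Finset ℕ} (h : Peel e S t J L) : J ⊆ Finset.range t := by
  induction h with
  | gap ht h ih => exact ih.trans (Finset.range_subset_range.2 (by omega))
  | free ht h =>
    intro v hv
    simp only [Finset.mem_filter, Finset.mem_range] at hv ⊢
    omega
  | hook ht hq hqt hmod hlast h ih =>
    intro v hv
    simp only [Finset.mem_union, Finset.mem_filter, Finset.mem_insert, Finset.mem_range] at hv ⊢
    rcases hv with h | h | h
    · omega
    · omega
    · have := Finset.mem_range.1 (ih h); omega

theorem mem_filter_lt {t v : ℕ} (h : v < t) : v ∈ S.filter (· < t) ↔ v ∈ S := by simp [h]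

/-- A free bead creates the deficit of one bead and gaps carry it upwards. In a hook it is closed at
`q` by the inserted bead and reopened at `t` by the lost one. -/
theorem below_add_one_of_peel {t L : ℕ} {J : Finset ℕ} (h : Peel e S t J L) :
    below J t + 1 = below S t := by
  induction h with
  | gap ht h ih =>
    rw [below_succ_of_notMem ht, below_succ_of_notMem, ih]
    intro h'; simpa using h.subset h'
  | @free t ht h =>
    rw [below_succ_of_mem ht, below_succ_of_notMem (by simp), below_congr fun v hv => mem_filter_lt hv]
  | @hook t q L J ht hq hqt hmod hlast h ih =>
    have key : ∀ n, q + 1 + n ≤ t → below (S.filter (fun v => q < v ∧ v < t) ∪ insert q J)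
        (q + 1 + n) = below S (q + 1 + n) := by
      intro n
      induction n with
      | zero =>
        intro _
        rw [below_succ_of_mem mem_hook_self, below_congr fun v hv => mem_hook_of_lt hv, ih,
          below_succ_of_notMem hq]
      | succ n ihn =>
        intro hn
        have ihn := ihn (by omega)
        rw [← add_assoc]
        by_cases hm : q + 1 + n ∈ S
        · rw [below_succ_of_mem hm, below_succ_of_mem, ihn]
          exact (mem_hook_of_gt h.subset (by omega) (by omega)).2 hm
        · rw [below_succ_of_notMem hm, below_succ_of_notMem, ihn]
          exact fun h' => hm ((mem_hook_of_gt h.subset (by omega) (by omega)).1 h')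
    rw [below_succ_of_mem ht, below_succ_of_notMem (notMem_hook h.subset hqt)]
    have := key (t - q - 1) (by omega)
    rw [show q + 1 + (t - q - 1) = t by omega] at this
    rw [this]

variable {a : ZMod (2 * e)}

theorem Peel.node_eq {t L : ℕ} {J : Finset ℕ} (h : Peel e S t J L) :
    node e a J t = node e a S t + e := by
  rw [node, node, ← below_add_one_of_peel h]
  push_cast
  linear_combination -e_add_e e

/-- After a hook the nodes agree with the original ones. -/
theorem Peel.node_hook {L : ℕ} {J : Finset ℕ} (h : Peel e S q J L) (hq : q ∉ S) {v : ℕ}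
    (hv : q < v) (hvt : v ≤ t) :
    node e a (S.filter (fun v => q < v ∧ v < t) ∪ insert q J) v = node e a S v := by
  induction v with
  | zero => omega
  | succ v ih =>
    rcases Nat.lt_or_ge q v with h1 | h1
    · have ih := ih h1 (by omega)
      have hm := mem_hook_of_gt (S := S) (t := t) h.subset h1 (by omega)
      by_cases hv : v ∈ S
      · rw [node_succ_of_mem hv, node_succ_of_mem (hm.2 hv), ih]
      · rw [node_succ_of_notMem hv, node_succ_of_notMem (fun h' => hv (hm.1 h')), ih]
    · obtain rfl : v = q := by omega
      rw [node_succ_of_mem mem_hook_self, node_succ_of_notMem hq,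
        node_congr fun u hu => mem_hook_of_lt hu, h.node_eq]
      linear_combination e_add_e e

theorem node_hook_of_le {v : ℕ} (hv : v ≤ q) :
    node e a (S.filter (fun v => q < v ∧ v < t) ∪ insert q J) v = node e a J v :=
  node_congr fun _ hu => mem_hook_of_lt (by omega)

/-- This converts the length of the path into the number of removed boxes, from which the equality
of the rim sizes of a pair is read off. -/
theorem Peel.sumTo_eq {t L : ℕ} {J : Finset ℕ} (h : Peel e S t J L) :
    sumTo t S + L + 1 = sumTo t J + t := by
  induction h with
  | gap ht h ih =>
    rw [sumTo_succ_of_notMem ht, sumTo_succ_of_notMem]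
    · omega
    · intro h'; simpa using h.subset h'
  | @free t ht h =>
    rw [sumTo_succ_of_mem ht, sumTo_succ_of_notMem (by simp),
      sumTo_congr (S := S.filter (· < t)) fun v hv => mem_filter_lt hv]
    omega
  | @hook t q L J ht hq hqt hmod hlast h ih =>
    have key : ∀ n, q + 1 + n ≤ t → sumTo (q + 1 + n) S + L + 1 + q + q=
        sumTo (q + 1 + n) (S.filter (fun v => q < v ∧ v < t) ∪ insert q J) + q + q := by
      intro n
      induction n with
      | zero =>
        intro _
        rw [sumTo_succ_of_mem (S := _ ∪ _) mem_hook_self,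
          sumTo_congr (S := _ ∪ _) fun v hv => mem_hook_of_lt hv, sumTo_succ_of_notMem hq]
        omega
      | succ n ihn =>
        intro hn
        have ihn := ihn (by omega)
        rw [← add_assoc]
        by_cases hm : q + 1 + n ∈ S
        · rw [sumTo_succ_of_mem hm, sumTo_succ_of_mem (S := _ ∪ _)]
          · omega
          · exact (mem_hook_of_gt h.subset (by omega) (by omega)).2 hm
        · rw [sumTo_succ_of_notMem hm, sumTo_succ_of_notMem (S := _ ∪ _)]
          · omega
          · exact fun h' => hm ((mem_hook_of_gt h.subset (by omega) (by omega)).1 h')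
    rw [sumTo_succ_of_mem ht, sumTo_succ_of_notMem (notMem_hook h.subset hqt)]
    have := key (t - q - 1) (by omega)
    rw [show q + 1 + (t - q - 1) = t by omega] at this
    omega

/-- The nodes on the path of gaps have gaps. -/
theorem Peel.exists_gap {t L : ℕ} {J : Finset ℕ} (h : Peel e S t J L) (ha : IsStep e a)
    (hg : Good e a S) (he : 0 < e) {i : ℕ} (hi : 0 < i) (hiL : i ≤ L) :
    ∃ p < t, p ∉ S ∧ node e a S p = node e a S t - i * a := by
  induction h generalizing i with
  | @gap t L J ht h ih =>
    rcases Nat.lt_or_ge 1 i with h1 | h1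
    · obtain ⟨p, hp, hpS, hn⟩ := ih (i := i - 1) (by omega) (by omega)
      refine ⟨p, by omega, hpS, ?_⟩
      rw [hn, node_succ_of_notMem ht]
      push_cast [show 1 ≤ i by omega]; ring
    · obtain rfl : i = 1 := by omega
      refine ⟨t, by omega, ht, ?_⟩
      rw [node_succ_of_notMem ht]; push_cast; ring
  | free ht h => omega
  | @hook t q L J ht hq hqt hmod hlast h ih =>
    have hnq : node e a S q = node e a S t + e :=
      (node_eq_or he ha hmod).resolve_left (hg q t hqt hq ht)
    rcases Nat.lt_or_ge 1 i with h1 | h1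
    · obtain ⟨p, hp, hpS, hn⟩ := ih (i := i - 1) (by omega) (by omega)
      refine ⟨p, by omega, hpS, ?_⟩
      rw [hn, node_succ_of_mem ht, hnq]
      push_cast [show 1 ≤ i by omega]; ring
    · obtain rfl : i = 1 := by omega
      refine ⟨q, by omega, hq, ?_⟩
      rw [node_succ_of_mem ht, hnq]; push_cast; ring

/-- Inside a hook the path of gaps is avoided. -/
theorem Peel.node_ne {L : ℕ} {J : Finset ℕ} (h : Peel e S q J L) (ha : IsStep e a)
    (hg : Good e a S) (he : 0 < e) (ht : t ∈ S) (hq : q ∉ S)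
    (hmod : q ≡ t [MOD e]) (hlast : ∀ v, q < v → v < t → v ≡ t [MOD e] → v ∈ S) {i : ℕ}
    (hi : i ≤ L) {v : ℕ} (hqv : q < v) (hvt : v ≤ t) :
    node e a S v ≠ node e a S q - i * a := by
  induction i generalizing v with
  | zero =>
    intro h1
    replace h1 : node e a S v = node e a S q := by rw [h1]; simp
    have hv : v ∈ S := by
      rcases Nat.lt_or_ge v t with h2 | h2
      · exact hlast v hqv h2 ((modEq_of_node_eq ha h1).trans hmod)
      · rwa [show v = t by omega]
    exact hg q v hqv hq hv h1.symm
  | succ i ih =>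
    intro h1
    -- A lower gap already sits at this node, so by goodness `v` is a gap; then `v + 1` is one step
    -- nearer to the start of the path.
    obtain ⟨p, hp, hpS, hn⟩ := h.exists_gap ha hg he (i := i + 1) (by omega) hi
    have hv : v ∉ S := fun hv => hg p v (by omega) hpS hv (hn.trans h1.symm)
    have hvt' : v ≠ t := fun h2 => hv (h2 ▸ ht)
    refine ih (by omega) (v := v + 1) (by omega) (by omega) ?_
    rw [node_succ_of_notMem hv, h1]
    push_cast; ring

/-- The gaps of the peeled set. -/
theorem Peel.gap_cases {t L : ℕ} {J : Finset ℕ} (h : Peel e S t J L) (ha : IsStep e a)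
    (hg : Good e a S) (he : 0 < e) {p : ℕ} (hp : p < t) (hpJ : p ∉ J) :
    (∃ p' < t, p' ∉ S ∧ node e a S p' = node e a J p) ∨
      ∃ i ≤ L, node e a J p + a + e = node e a S t - i * a := by
  induction h generalizing p with
  | @gap t L J ht h ih =>
    rcases Nat.lt_or_ge p t with h1 | h1
    · rcases ih h1 hpJ with ⟨p', h2, h3, h4⟩ | ⟨i, h2, h3⟩
      · exact Or.inl ⟨p', by omega, h3, h4⟩
      · refine Or.inr ⟨i + 1, by omega, ?_⟩
        rw [h3, node_succ_of_notMem ht]; push_cast; ring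
    · obtain rfl : p = t := by omega
      refine Or.inr ⟨0, by omega, ?_⟩
      rw [h.node_eq, node_succ_of_notMem ht]
      push_cast
      linear_combination e_add_e e
  | @free t ht h =>
    have hn : node e a (S.filter (· < t)) p = node e a S p :=
      node_congr fun v hv => mem_filter_lt (by omega)
    rcases Nat.lt_or_ge p t with h1 | h1
    · exact Or.inl ⟨p, by omega, fun h2 => hpJ ((mem_filter_lt h1).2 h2), hn.symm⟩
    · obtain rfl : p = t := by omega
      refine Or.inr ⟨0, le_rfl, ?_⟩
      rw [hn, node_succ_of_mem ht]; simp
  | @hook t q L J ht hq hqt hmod hlast h ih =>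
    have hnq : node e a S q = node e a S t + e :=
      (node_eq_or he ha hmod).resolve_left (hg q t hqt hq ht)
    rcases lt_trichotomy p q with h1 | h1 | h1
    · rw [node_hook_of_le h1.le]
      rcases ih h1 (fun h2 => hpJ ((mem_hook_of_lt h1).2 h2)) with ⟨p', h2, h3, h4⟩ | ⟨i, h2, h3⟩
      · exact Or.inl ⟨p', by omega, h3, h4⟩
      · refine Or.inr ⟨i + 1, by omega, ?_⟩
        rw [h3, node_succ_of_mem ht, hnq]; push_cast; ring
    · exact absurd (h1 ▸ mem_hook_self) hpJ
    · rw [h.node_hook hq h1 (by omega)]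
      rcases Nat.lt_or_ge p t with h2 | h2
      · exact Or.inl ⟨p, by omega, fun h3 => hpJ ((mem_hook_of_gt h.subset h1 h2).2 h3), rfl⟩
      · obtain rfl : p = t := by omega
        refine Or.inr ⟨0, by omega, ?_⟩
        rw [node_succ_of_mem ht]; simp

/-- Peeling preserves goodness. -/
theorem Peel.good {t L : ℕ} {J : Finset ℕ} (h : Peel e S t J L) (ha : IsStep e a)
    (hg : Good e a S) (he : 0 < e) : Good e a J := by
  induction h with
  | gap ht h ih => exact ih
  | @free t ht h =>
    intro p b hpb hp hb
    have hb' := Finset.mem_filter.1 hb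
    rw [node_congr (S' := S) fun v hv => mem_filter_lt (by omega),
      node_congr (v := b) (S' := S) fun v hv => mem_filter_lt (by omega)]
    exact hg p b hpb (fun h2 => hp ((mem_filter_lt (by omega)).2 h2)) hb'.1
  | @hook t q L J ht hq hqt hmod hlast h ih =>
    have hnq : node e a S q = node e a S t + e :=
      (node_eq_or he ha hmod).resolve_left (hg q t hqt hq ht)
    -- The mixed cases below, with a new gap under an old bead or a moved one, would put an endpoint
    -- inside the hook on the path of gaps.
    have hK := fun i v => h.node_ne ha hg he ht hq hmod hlast (i := i) (v := v)
    intro p b hpb hp hb heq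
    have hbt : b < t := by
      have h1 := (Peel.hook ht hq hqt hmod hlast h).subset hb
      have h2 : b ≠ t := fun h2 => notMem_hook h.subset hqt (h2 ▸ hb)
      have := Finset.mem_range.1 h1
      omega
    rcases lt_trichotomy b q with h1 | rfl | h1
    · rw [node_hook_of_le h1.le, node_hook_of_le (by omega)] at heq
      exact ih p b hpb (fun h2 => hp ((mem_hook_of_lt (by omega)).2 h2))
        ((mem_hook_of_lt h1).1 hb) heq
    · rw [node_hook_of_le le_rfl, node_hook_of_le hpb.le, h.node_eq] at heq
      rcases h.gap_cases ha hg he hpb (fun h2 => hp ((mem_hook_of_lt (by omega)).2 h2)) with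
        ⟨p', h2, h3, h4⟩ | ⟨i, h2, h3⟩
      · refine hg p' t (by omega) h3 ht ?_
        rw [h4, heq, hnq]
        linear_combination e_add_e e
      · refine hK i (b + 1) h2 (by omega) (by omega) ?_
        rw [← h3, heq, node_succ_of_notMem hq]
        linear_combination -e_add_e e
    · have hbS := (mem_hook_of_gt h.subset h1 hbt).1 hb
      rw [h.node_hook hq h1 hbt.le] at heq
      rcases lt_trichotomy p q with h2 | h2 | h2
      · rw [node_hook_of_le h2.le] at heq
        rcases h.gap_cases ha hg he h2 (fun h3 => hp ((mem_hook_of_lt h2).2 h3)) with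
          ⟨p', h4, h5, h6⟩ | ⟨i, h4, h5⟩
        · exact hg p' b (by omega) h5 hbS (h6.trans heq)
        · refine hK i (b + 1) h4 (by omega) (by omega) ?_
          rw [← h5, heq, node_succ_of_mem hbS]
      · exact hp (h2 ▸ mem_hook_self)
      · rw [h.node_hook hq h2 (by omega)] at heq
        exact hg p b hpb (fun h3 => hp ((mem_hook_of_gt h.subset h2 (by omega)).2 h3)) hbS heq

/-- The number of indices `i < L` with `z + i a = w`. -/
def pathCount (e : ℕ) (a z : ZMod (2 * e)) (L : ℕ) (w : ZMod (2 * e)) : ℕ :=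
  ∑ i ∈ Finset.range L, if w = z + i * a then 1 else 0

/-- A bead moved from `t` to `q` keeps its node: the old nodes differ by `e`, and so do the old and
the new node at `q`. Only the free bead at the end of the path is lost. -/
theorem Peel.beadsTo_eq {t L : ℕ} {J : Finset ℕ} (h : Peel e S t J L) (ha : IsStep e a)
    (hg : Good e a S) (he : 0 < e) (w : ZMod (2 * e)) :
    beadsTo e a t J w + (if w = node e a S t - L * a - a - e then 1 else 0) =
      beadsTo e a t S w := by
  induction h with
  | @gap t L J ht h ih =>
    rw [beadsTo_succ_of_notMem ht, beadsTo_succ_of_notMem, ← ih, node_succ_of_notMem ht]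
    · congr 3
      push_cast; ring
    · intro h'; simpa using h.subset h'
  | @free t ht h =>
    rw [beadsTo_succ_of_mem ht, beadsTo_succ_of_notMem (by simp), node_succ_of_mem ht,
      beadsTo_congr (S := S.filter (· < t)) fun v hv => mem_filter_lt hv]
    congr 3
    push_cast; ring
  | @hook t q L J ht hq hqt hmod hlast h ih =>
    have hnq : node e a S q = node e a S t + e :=
      (node_eq_or he ha hmod).resolve_left (hg q t hqt hq ht)
    have key : ∀ n, q + 1 + n ≤ t → beadsTo e a (q + 1 + n)
        (S.filter (fun v => q < v ∧ v < t) ∪ insert q J) w +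
        (if w = node e a S q - L * a - a - e then 1 else 0) =
        beadsTo e a (q + 1 + n) S w + if w = node e a S t then 1 else 0 := by
      intro n
      induction n with
      | zero =>
        intro _
        rw [beadsTo_succ_of_mem (S := _ ∪ _) mem_hook_self, beadsTo_succ_of_notMem hq, ← ih,
          beadsTo_congr (S := _ ∪ _) fun v hv => mem_hook_of_lt hv,
          node_hook_of_le le_rfl, h.node_eq, hnq,
          show node e a S t + e + (e : ZMod (2 * e)) = node e a S t by
            linear_combination e_add_e e]
        ring
      | succ n ihn =>
        intro hn
        have ihn := ihn (by omega)
        have hm := mem_hook_of_gt (S := S) (t := t) h.subset (v := q + 1 + n) (by omega) (by omega)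
        rw [← add_assoc]
        by_cases hv : q + 1 + n ∈ S
        · rw [beadsTo_succ_of_mem hv, beadsTo_succ_of_mem (hm.2 hv),
            h.node_hook hq (by omega) (by omega)]
          omega
        · rw [beadsTo_succ_of_notMem hv, beadsTo_succ_of_notMem fun h' => hv (hm.1 h')]
          omega
    rw [beadsTo_succ_of_mem ht, beadsTo_succ_of_notMem (notMem_hook h.subset hqt)]
    have := key (t - q - 1) (by omega)
    rw [show q + 1 + (t - q - 1) = t by omega] at this
    rw [← this, node_succ_of_mem ht, hnq]
    congr 3
    push_cast; ring

/-- The nodes of the gaps on the path are shifted by `e`: a skipped gap sees one bead fewer below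
it, while in a hook the gap `q` is replaced by a gap at `t`. The free bead turns into a gap at its
own node. -/
theorem Peel.gapCount_eq {t L : ℕ} {J : Finset ℕ} (h : Peel e S t J L) (ha : IsStep e a)
    (hg : Good e a S) (he : 0 < e) (w : ZMod (2 * e)) :
    gapCount e a t J w + pathCount e a (node e a S t - L * a) L w = gapCount e a t S w +
      (if w = node e a S t - L * a - a - e then 1 else 0) +
      pathCount e a (node e a S t - L * a + e) L w := by
  induction h with
  | @gap t L J ht h ih =>
    have hz : node e a S (t + 1) - (L + 1 : ℕ) * a = node e a S t - L * a := by
      rw [node_succ_of_notMem ht]; push_cast; ring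
    rw [hz, gapCount_succ_of_notMem ht, gapCount_succ_of_notMem, pathCount, pathCount,
      Finset.sum_range_succ, Finset.sum_range_succ, ← pathCount, ← pathCount, h.node_eq,
      sub_add_cancel, show node e a S t - L * a + e + L * a = node e a S t + e by ring]
    · omega
    · intro h'; simpa using h.subset h'
  | @free t ht h =>
    rw [gapCount_succ_of_mem ht, gapCount_succ_of_notMem (by simp), node_succ_of_mem ht,
      gapCount_congr (S := S.filter (· < t)) fun v hv => mem_filter_lt hv,
      node_congr (S := S.filter (· < t)) fun v hv => mem_filter_lt hv]
    simp only [pathCount, Finset.range_zero, Finset.sum_empty, add_zero]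
    congr 3
    push_cast; ring
  | @hook t q L J ht hq hqt hmod hlast h ih =>
    have hnq : node e a S q = node e a S t + e :=
      (node_eq_or he ha hmod).resolve_left (hg q t hqt hq ht)
    have hz : node e a S (t + 1) - (L + 1 : ℕ) * a = node e a S q - L * a := by
      rw [node_succ_of_mem ht, hnq]; push_cast; ring
    have key : ∀ n, q + 1 + n ≤ t → gapCount e a (q + 1 + n)
        (S.filter (fun v => q < v ∧ v < t) ∪ insert q J) w +
        pathCount e a (node e a S q - L * a) (L + 1) w = gapCount e a (q + 1 + n) S w +
        (if w = node e a S q - L * a - a - e then 1 else 0) +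
        pathCount e a (node e a S q - L * a + e) L w := by
      intro n
      induction n with
      | zero =>
        intro _
        rw [add_zero, gapCount_succ_of_mem (S := _ ∪ _) mem_hook_self, gapCount_succ_of_notMem hq,
          gapCount_congr (S := _ ∪ _) fun v hv => mem_hook_of_lt hv, pathCount,
          Finset.sum_range_succ, ← pathCount, sub_add_cancel]
        omega
      | succ n ihn =>
        intro hn
        have ihn := ihn (by omega)
        have hm := mem_hook_of_gt (S := S) (t := t) h.subset (v := q + 1 + n) (by omega) (by omega)
        rw [← add_assoc]
        by_cases hv : q + 1 + n ∈ S
        · rw [gapCount_succ_of_mem hv, gapCount_succ_of_mem (hm.2 hv)]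
          omega
        · rw [gapCount_succ_of_notMem hv, gapCount_succ_of_notMem fun h' => hv (hm.1 h'),
            h.node_hook hq (by omega) (by omega)]
          omega
    rw [hz, gapCount_succ_of_mem ht, gapCount_succ_of_notMem (notMem_hook h.subset hqt),
      h.node_hook hq hqt le_rfl]
    have h1 := key (t - q - 1) (by omega)
    rw [show q + 1 + (t - q - 1) = t by omega] at h1
    have h2 : pathCount e a (node e a S q - L * a + e) (L + 1) w =
        pathCount e a (node e a S q - L * a + e) L w + if w = node e a S t then 1 else 0 := by
      rw [pathCount, Finset.sum_range_succ, ← pathCount, hnq]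
      congr 3
      linear_combination e_add_e e
    rw [h2]
    omega

theorem gapCount_mono {t t' : ℕ} (h : t ≤ t') (w : ZMod (2 * e)) :
    gapCount e a t S w ≤ gapCount e a t' S w :=
  Finset.card_le_card (Finset.filter_subset_filter _ (Finset.range_subset_range.2 h))

/-- The path is realised by actual gaps at strictly descending positions, so no gap is used twice.
-/
theorem Peel.pathCount_le {t L : ℕ} {J : Finset ℕ} (h : Peel e S t J L) (ha : IsStep e a)
    (hg : Good e a S) (he : 0 < e) (w : ZMod (2 * e)) :
    pathCount e a (node e a S t - L * a) L w ≤ gapCount e a t S w := by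
  induction h with
  | @gap t L J ht h ih =>
    have hz : node e a S (t + 1) - (L + 1 : ℕ) * a = node e a S t - L * a := by
      rw [node_succ_of_notMem ht]; push_cast; ring
    rw [hz, gapCount_succ_of_notMem ht, pathCount, Finset.sum_range_succ, ← pathCount,
      sub_add_cancel]
    omega
  | free ht h => simp [pathCount]
  | @hook t q L J ht hq hqt hmod hlast h ih =>
    have hnq : node e a S q = node e a S t + e :=
      (node_eq_or he ha hmod).resolve_left (hg q t hqt hq ht)
    have hz : node e a S (t + 1) - (L + 1 : ℕ) * a = node e a S q - L * a := by
      rw [node_succ_of_mem ht, hnq]; push_cast; ring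
    have h1 := gapCount_mono (e := e) (a := a) (S := S) (show q + 1 ≤ t + 1 by omega) w
    rw [gapCount_succ_of_notMem hq] at h1
    rw [hz, pathCount, Finset.sum_range_succ, ← pathCount, sub_add_cancel]
    omega

/-- The path cannot be prolonged: every gap leading to its last node has already been used. The free
bead has no gap below it in its residue class, and later hooks avoid the path by `Peel.node_ne`. -/
theorem Peel.pathCount_eq {t L : ℕ} {J : Finset ℕ} (h : Peel e S t J L) (ha : IsStep e a)
    (hg : Good e a S) (he : 0 < e) :
    pathCount e a (node e a S t - L * a) L (node e a S t - L * a - a) =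
      gapCount e a t S (node e a S t - L * a - a) := by
  induction h with
  | @gap t L J ht h ih =>
    have hz : node e a S (t + 1) - (L + 1 : ℕ) * a = node e a S t - L * a := by
      rw [node_succ_of_notMem ht]; push_cast; ring
    rw [hz, gapCount_succ_of_notMem ht, pathCount, Finset.sum_range_succ, ← pathCount,
      sub_add_cancel, ih]
  | @free t ht h =>
    simp only [pathCount, Finset.range_zero, Finset.sum_empty]
    symm
    rw [gapCount, Finset.card_eq_zero, Finset.filter_eq_empty_iff]
    rintro v hv ⟨h1, h2⟩
    have h3 : v ≡ t [MOD e] := by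
      refine modEq_of_node_eq_add (S := S) (S' := S) ha ?_
      rw [h2, node_succ_of_mem ht]; push_cast; ring
    rcases Nat.lt_or_ge v t with h4 | h4
    · exact h1 (h v h4 h3)
    · have := Finset.mem_range.1 hv
      exact h1 (show v = t by omega ▸ ht)
  | @hook t q L J ht hq hqt hmod hlast h ih =>
    have hnq : node e a S q = node e a S t + e :=
      (node_eq_or he ha hmod).resolve_left (hg q t hqt hq ht)
    have hz : node e a S (t + 1) - (L + 1 : ℕ) * a = node e a S q - L * a := by
      rw [node_succ_of_mem ht, hnq]; push_cast; ring
    have key : ∀ n, q + 1 + n ≤ t → gapCount e a (q + 1 + n) S (node e a S q - L * a - a) =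
        gapCount e a (q + 1) S (node e a S q - L * a - a) := by
      intro n
      induction n with
      | zero => intro _; rfl
      | succ n ihn =>
        intro hn
        rw [← ihn (by omega), ← add_assoc]
        by_cases hv : q + 1 + n ∈ S
        · rw [gapCount_succ_of_mem hv]
        · rw [gapCount_succ_of_notMem hv, if_neg, add_zero]
          intro h1
          refine h.node_ne ha hg he ht hq hmod hlast le_rfl (v := q + 1 + n + 1) (by omega)
            (by omega) ?_
          rw [node_succ_of_notMem hv, ← h1]; ring
    have h1 := key (t - q - 1) (by omega)
    rw [show q + 1 + (t - q - 1) = t by omega] at h1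
    rw [hz, gapCount_succ_of_mem ht, h1, gapCount_succ_of_notMem hq, pathCount,
      Finset.sum_range_succ, ← pathCount, sub_add_cancel, ih]

end hook

end BeadSet

/-! ### Peeling pairs of sets of beads -/

namespace BeadSet

section

variable {e : ℕ} {a : ZMod (2 * e)} {H : ℕ} {S S' J : Finset ℕ}

theorem pathCount_add (z : ZMod (2 * e)) (m n : ℕ) (w : ZMod (2 * e)) :
    pathCount e a z (m + n) w = pathCount e a z m w + pathCount e a (z + m * a) n w := by
  unfold pathCount
  rw [Finset.sum_range_add]
  congr 1
  refine Finset.sum_congr rfl fun i _ => ?_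
  rw [show z + ((m + i : ℕ) : ZMod (2 * e)) * a = z + m * a + i * a by push_cast; ring]

/-- A longer path would need one more gap at the node where `K` has exhausted them. Applied in both
directions, this makes the length of a maximal path a function of the gap counts. -/
theorem pathLen_le {N : ZMod (2 * e)} {G : ZMod (2 * e) → ℕ} {K L : ℕ}
    (hL : ∀ w, pathCount e a (N - L * a) L w ≤ G w)
    (hK : pathCount e a (N - K * a) K (N - K * a - a) = G (N - K * a - a)) : L ≤ K := by
  by_contra hlt
  obtain ⟨m, rfl⟩ : ∃ m, L = m + 1 + K := ⟨L - K - 1, by omega⟩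
  have h1 := hL (N - K * a - a)
  have h2 : N - ((m + 1 + K : ℕ) : ZMod (2 * e)) * a + (m + 1 : ℕ) * a = N - K * a := by
    push_cast; ring
  rw [pathCount_add, h2, hK, pathCount, Finset.sum_range_succ, if_pos] at h1
  · omega
  · push_cast; ring

theorem gapCount_add_of_gaps {c k : ℕ} (h : ∀ v, c ≤ v → v < c + k → v ∉ S) (w : ZMod (2 * e)) :
    node e a S (c + k) = node e a S c + k * a ∧
      gapCount e a (c + k) S w = gapCount e a c S w + pathCount e a (node e a S c) k w := by
  induction k with
  | zero => simp [pathCount]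
  | succ k ih =>
    obtain ⟨h1, h2⟩ := ih fun v h1 h2 => h v h1 (by omega)
    have h3 := h (c + k) (by omega) (by omega)
    rw [← add_assoc, node_succ_of_notMem h3, gapCount_succ_of_notMem h3, h2, h1, pathCount,
      pathCount, Finset.sum_range_succ]
    exact ⟨by push_cast; ring, by omega⟩

/-- If `S` is good and `S'` is the opposite arrangement with the same numbers of beads and gaps,
then peeling `S` corresponds to the removal of the topmost bead of `S'`. -/
theorem SameData.peel (ha : IsStep e a) (he : 0 < e) (hS : S ⊆ Finset.range H)
    (hS' : S' ⊆ Finset.range H) (hg : Good e a S) (hg' : EGood e a S')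
    (hd : SameData e a H S S') {L : ℕ} (hP : Peel e S H J L) {c : ℕ} (hc : c ∈ S')
    (hmax : ∀ b ∈ S', b ≤ c) :
    c + L + 1 = H ∧ SameData e a H J (S'.erase c) ∧ EGood e a (S'.erase c) := by
  have hcH := Finset.mem_range.1 (hS' hc)
  obtain ⟨K, hK⟩ : ∃ K, H = c + 1 + K := ⟨H - c - 1, by omega⟩
  have htop : node e a S' H = node e a S H := by rw [node_top hS, node_top hS', hd.1]
  have hgaps : ∀ v, c + 1 ≤ v → v < c + 1 + K → v ∉ S' := fun v h1 _ h2 => by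
    have := hmax v h2; omega
  have hz : node e a S' (c + 1) = node e a S H - K * a := by
    rw [← htop, hK, (gapCount_add_of_gaps hgaps 0).1]; ring
  have hG : ∀ w, gapCount e a H S w =
      gapCount e a (c + 1) S' w + pathCount e a (node e a S H - K * a) K w := by
    intro w
    rw [hd.2.2, hK, (gapCount_add_of_gaps hgaps w).2, hz, hK]
  -- A gap here would lead to the same node as the topmost bead `c`, against `EGood`. So the gaps
  -- above `c` form a maximal path.
  have hzero : gapCount e a (c + 1) S' (node e a S H - K * a - a) = 0 := by
    rw [gapCount, Finset.card_eq_zero, Finset.filter_eq_empty_iff]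
    rintro v hv ⟨h1, h2⟩
    have h3 := Finset.mem_range.1 hv
    have h4 : v ≠ c := fun h => h1 (h ▸ hc)
    refine hg' v c (by omega) h1 hc ?_
    rw [h2, ← hz, node_succ_of_mem hc]; ring
  have hLK : L = K := by
    apply le_antisymm
    · exact pathLen_le (hP.pathCount_le ha hg he) (by rw [hG, hzero, zero_add])
    · exact pathLen_le (G := gapCount e a H S) (fun w => by rw [hG]; omega)
        (hP.pathCount_eq ha hg he)
  subst hLK
  have hnc : node e a S' c = node e a S H - L * a - a - e := by
    rw [← hz, node_succ_of_mem hc]; ring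
  have herase : ∀ v < c, v ∈ S'.erase c ↔ v ∈ S' := fun v hv => by
    rw [Finset.mem_erase]; exact ⟨fun h => h.2, fun h => ⟨by omega, h⟩⟩
  have hS'' : S'.erase c ⊆ Finset.range H := (Finset.erase_subset _ _).trans hS'
  refine ⟨by omega, ⟨?_, ?_, ?_⟩, ?_⟩
  · have h1 := below_add_one_of_peel hP
    rw [below_eq_card fun b hb => Finset.mem_range.1 (hS hb),
      below_eq_card fun b hb => Finset.mem_range.1 (hP.subset hb), hd.1] at h1
    rw [Finset.card_erase_of_mem hc]
    omega
  · ext w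
    have h1 := hP.beadsTo_eq ha hg he w
    rw [beadsTo_eq_beadCount hS, beadsTo_eq_beadCount hP.subset, hd.2.1,
      ← beadsTo_eq_beadCount hS', hK] at h1
    have h2 : ∀ k, k ≤ L → beadsTo e a (c + 1 + k) S' w =
        beadsTo e a (c + 1 + k) (S'.erase c) w + if w = node e a S' c then 1 else 0 := by
      intro k
      induction k with
      | zero =>
        intro _
        rw [add_zero, beadsTo_succ_of_mem hc, beadsTo_succ_of_notMem (by simp), beadsTo_congr herase]
      | succ k ih =>
        intro hk
        have h3 := hgaps (c + 1 + k) (by omega) (by omega)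
        rw [← add_assoc, beadsTo_succ_of_notMem h3, beadsTo_succ_of_notMem, ih (by omega)]
        exact fun h => h3 (Finset.mem_of_mem_erase h)
    rw [h2 L le_rfl, hnc, ← hK, beadsTo_eq_beadCount hS''] at h1
    omega
  · ext w
    have h1 := hP.gapCount_eq ha hg he w
    rw [hG, gapCount_succ_of_mem hc] at h1
    have h2 : gapCount e a H (S'.erase c) w = gapCount e a c S' w +
        (if w = node e a S H - L * a - a - e then 1 else 0) +
        pathCount e a (node e a S H - L * a + e) L w := by
      conv_lhs => rw [hK]
      rw [(gapCount_add_of_gaps (fun v h1 h2 h3 => hgaps v h1 h2 (Finset.mem_of_mem_erase h3)) w).2,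
        gapCount_succ_of_notMem (by simp), node_succ_of_notMem (by simp), gapCount_congr herase,
        node_congr herase, hnc]
      congr 2
      linear_combination -e_add_e e
    omega
  · intro p b hpb hp hb
    have hb' := Finset.mem_of_mem_erase hb
    have h1 : b ≠ c := Finset.ne_of_mem_erase hb
    have h2 := hmax b hb'
    rw [node_congr (v := p) (S' := S') fun v hv => herase v (by omega),
      node_congr (v := b) (S' := S') fun v hv => herase v (by omega)]
    exact hg' p b hpb (fun h => hp ((herase p (by omega)).2 h)) hb'

end

/-! ### The peeled set as a recursive function, and its first gap -/

/-- The peeled set, by the recursion of the `e`-rim. -/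
def peel (e : ℕ) (S : Finset ℕ) : ℕ → Finset ℕ
  | 0 => ∅
  | t + 1 =>
    if t ∈ S then
      if h : 0 < e ∧ e ≤ t then
        S.filter (fun v => t - e < v ∧ v < t) ∪ insert (t - e) (peel e S (t - e + 1))
      else S.filter (· < t)
    else peel e S t
termination_by t => t

section peel

variable {e : ℕ} {S : Finset ℕ} {t : ℕ}

theorem peel_succ_of_notMem (h : t ∉ S) : peel e S (t + 1) = peel e S t := by
  rw [peel, if_neg h]

theorem peel_succ_of_lt (h : t ∈ S) (ht : t < e) : peel e S (t + 1) = S.filter (· < t) := by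
  rw [peel, if_pos h, dif_neg (by omega)]

theorem peel_succ_of_le (h : t ∈ S) (he : 0 < e) (ht : e ≤ t) : peel e S (t + 1) =
    S.filter (fun v => t - e < v ∧ v < t) ∪ insert (t - e) (peel e S (t - e + 1)) := by
  rw [peel, if_pos h, dif_pos ⟨he, ht⟩]

/-- A run of beads at `t`, `t - e`, `t - 2e`, … merges the corresponding `e`-segments into one hook
ending at the nearest gap of that residue, or into a free bead if there is none. The bead at `0`
keeps the descent from running off the bottom. -/
theorem exists_peel (he : 0 < e) (h0 : 0 ∈ S) (ht : 0 < t) : ∃ L, Peel e S t (peel e S t) L := by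
  induction t using Nat.strong_induction_on with
  | _ t ih =>
    obtain ⟨t, rfl⟩ : ∃ u, t = u + 1 := ⟨t - 1, by omega⟩
    by_cases hm : t ∈ S
    swap
    · have h1 : 0 < t := by
        rcases Nat.eq_zero_or_pos t with h | h
        · exact absurd (h ▸ h0) hm
        · exact h
      obtain ⟨L, hL⟩ := ih t (by omega) h1
      rw [peel_succ_of_notMem hm]
      exact ⟨L + 1, .gap hm hL⟩
    rcases Nat.lt_or_ge t e with hte | hte
    · rw [peel_succ_of_lt hm hte]
      refine ⟨0, .free hm fun q hq hmod => ?_⟩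
      have := Nat.ModEq.eq_of_lt_of_lt hmod (by omega) hte
      omega
    rw [peel_succ_of_le hm he hte]
    have hmodt : t - e ≡ t [MOD e] := (Nat.modEq_iff_dvd' (by omega)).2 ⟨1, by omega⟩
    have hnear : ∀ v, t - e < v → v < t → ¬ v ≡ t [MOD e] := by
      intro v h1 h2 h3
      have := Nat.le_of_dvd (by omega) ((Nat.modEq_iff_dvd' (by omega)).1 h3)
      omega
    by_cases hu : t - e ∈ S
    · obtain ⟨L, hL⟩ := ih (t - e + 1) (by omega) (by omega)
      generalize peel e S (t - e + 1) = J at hL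
      cases hL with
      | gap hu' _ => exact absurd hu hu'
      | free _ hfree =>
        refine ⟨0, ?_⟩
        convert Peel.free hm ?_ using 1
        · ext v
          simp only [Finset.mem_union, Finset.mem_filter, Finset.mem_insert]
          constructor
          · rintro (h | h | h)
            · exact ⟨h.1, h.2.2⟩
            · exact ⟨h ▸ hu, by omega⟩
            · exact ⟨h.1, by omega⟩
          · rintro ⟨h1, h2⟩
            rcases lt_trichotomy v (t - e) with h3 | h3 | h3
            · exact Or.inr (Or.inr ⟨h1, h3⟩)
            · exact Or.inr (Or.inl h3)
            · exact Or.inl ⟨h1, h3, h2⟩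
        · intro q hq hmod
          rcases lt_trichotomy q (t - e) with h3 | h3 | h3
          · exact hfree q h3 (hmod.trans hmodt.symm)
          · exact h3 ▸ hu
          · exact absurd hmod (hnear q h3 hq)
      | @hook _ q L J _ hq hqt hmod hlast h =>
        refine ⟨L + 1, ?_⟩
        convert Peel.hook hm hq (show q < t by omega) (hmod.trans hmodt) ?_ h using 1
        · ext v
          simp only [Finset.mem_union, Finset.mem_filter, Finset.mem_insert]
          constructor
          · rintro (h | h | h | h | h)
            · exact Or.inl ⟨h.1, by omega, by omega⟩
            · exact Or.inl ⟨h ▸ hu, by omega, by omega⟩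
            · exact Or.inl ⟨h.1, by omega, by omega⟩
            · exact Or.inr (Or.inl h)
            · exact Or.inr (Or.inr h)
          · rintro (h | h | h)
            · rcases lt_trichotomy v (t - e) with h3 | h3 | h3
              · exact Or.inr (Or.inr (Or.inl ⟨h.1, by omega, h3⟩))
              · exact Or.inr (Or.inl h3)
              · exact Or.inl ⟨h.1, h3, by omega⟩
            · exact Or.inr (Or.inr (Or.inr (Or.inl h)))
            · exact Or.inr (Or.inr (Or.inr (Or.inr h)))
        · intro v h1 h2 h3
          rcases lt_trichotomy v (t - e) with h4 | h4 | h4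
          · exact hlast v h1 h4 (h3.trans hmodt.symm)
          · exact h4 ▸ hu
          · exact absurd h3 (hnear v h4 h2)
    · have h1 : 0 < t - e := by
        rcases Nat.eq_zero_or_pos (t - e) with h | h
        · exact absurd (h ▸ h0) hu
        · exact h
      obtain ⟨L, hL⟩ := ih (t - e) (by omega) h1
      rw [peel_succ_of_notMem hu]
      exact ⟨L + 1, .hook hm hu (by omega) hmodt (fun v h2 h3 h4 => absurd h4 (hnear v h2 h3)) hL⟩

theorem peel_subset (he : 0 < e) (t : ℕ) : peel e S t ⊆ Finset.range t := by
  induction t using Nat.strong_induction_on with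
  | _ t ih =>
    rcases t with _ | t
    · simp [peel]
    by_cases hm : t ∈ S
    swap
    · rw [peel_succ_of_notMem hm]
      exact (ih t (by omega)).trans (Finset.range_subset_range.2 (by omega))
    intro v hv
    rw [Finset.mem_range]
    rcases Nat.lt_or_ge t e with hte | hte
    · rw [peel_succ_of_lt hm hte, Finset.mem_filter] at hv
      omega
    · rw [peel_succ_of_le hm he hte] at hv
      simp only [Finset.mem_union, Finset.mem_filter, Finset.mem_insert] at hv
      rcases hv with h | h | h
      · omega
      · omega
      · have := Finset.mem_range.1 (ih (t - e + 1) (by omega) h)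
        omega

theorem notMem_peel_succ (he : 0 < e) (t : ℕ) : t ∉ peel e S (t + 1) := by
  intro hv
  by_cases hm : t ∈ S
  swap
  · rw [peel_succ_of_notMem hm] at hv
    simpa using peel_subset he t hv
  rcases Nat.lt_or_ge t e with hte | hte
  · rw [peel_succ_of_lt hm hte, Finset.mem_filter] at hv
    omega
  · rw [peel_succ_of_le hm he hte] at hv
    simp only [Finset.mem_union, Finset.mem_filter, Finset.mem_insert] at hv
    rcases hv with h | h | h
    · omega
    · omega
    · have := Finset.mem_range.1 (peel_subset he _ h)
      omega

/-- The first gap. -/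
noncomputable def firstGap (S : Finset ℕ) : ℕ := sInf {v | v ∉ S}

theorem firstGap_notMem (S : Finset ℕ) : firstGap S ∉ S := by
  have : {v | v ∉ S}.Nonempty := Infinite.exists_notMem_finset S
  exact Nat.sInf_mem this

theorem mem_of_lt_firstGap {v : ℕ} (h : v < firstGap S) : v ∈ S := by
  by_contra h'
  exact Nat.notMem_of_lt_sInf h h'

theorem firstGap_le {f : ℕ} (h : f ∉ S) : firstGap S ≤ f := Nat.sInf_le h

theorem firstGap_eq {f : ℕ} (h : ∀ v < f, v ∈ S) (hf : f ∉ S) : firstGap S = f := by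
  rcases lt_trichotomy (firstGap S) f with h1 | h1 | h1
  · exact absurd (h _ h1) (firstGap_notMem S)
  · exact h1
  · exact absurd (mem_of_lt_firstGap h1) hf

theorem le_firstGap {f : ℕ} (h : ∀ v < f, v ∈ S) : f ≤ firstGap S := by
  by_contra h1
  exact firstGap_notMem S (h _ (by omega))

theorem firstGap_lt {H : ℕ} (hS : S.card < H) : firstGap S < H := by
  by_contra h
  have : Finset.range H ⊆ S := fun v hv => mem_of_lt_firstGap (by
    have := Finset.mem_range.1 hv; omega)
  have := Finset.card_le_card this
  rw [Finset.card_range] at this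
  omega

theorem peel_interval (he : 0 < e) {n : ℕ} (h : ∀ v ≤ n, v ∈ S) :
    peel e S (n + 1) = Finset.range n := by
  induction n using Nat.strong_induction_on with
  | _ n ih =>
    rcases Nat.lt_or_ge n e with hn | hn
    · rw [peel_succ_of_lt (h n le_rfl) hn]
      ext v
      simp only [Finset.mem_filter, Finset.mem_range]
      exact ⟨fun h => h.2, fun h' => ⟨h v (by omega), h'⟩⟩
    · rw [peel_succ_of_le (h n le_rfl) he hn, ih (n - e) (by omega) fun v hv => h v (by omega)]
      ext v
      simp only [Finset.mem_union, Finset.mem_filter, Finset.mem_insert, Finset.mem_range]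
      constructor
      · omega
      · intro h1
        have := h v (by omega)
        rcases lt_trichotomy v (n - e) with h3 | h3 | h3
        · exact Or.inr (Or.inr h3)
        · exact Or.inr (Or.inl h3)
        · exact Or.inl ⟨this, h3, h1⟩

/-- One segment accounts for a descent by `e`: the bead at `t` is traded for one at `t - e`. -/
theorem sum_peel_succ (he : 0 < e) (hm : t ∈ S) (hte : e ≤ t) :
    sumTo (t + 1) S + ∑ v ∈ peel e S (t - e + 1), v =
      sumTo (t - e + 1) S + ∑ v ∈ peel e S (t + 1), v + e := by
  rw [peel_succ_of_le hm he hte, Finset.sum_union, Finset.sum_insert (notMem_peel_succ he _)]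
  · have h1 : ∀ k, t - e + 1 + k ≤ t → sumTo (t - e + 1 + k) S = sumTo (t - e + 1) S +
        ∑ v ∈ S.filter (fun v => t - e < v ∧ v < t - e + 1 + k), v := by
      intro k
      induction k with
      | zero =>
        intro _
        rw [Finset.filter_false_of_mem fun v _ => by omega]; simp
      | succ k ih =>
        intro hk
        rw [← add_assoc]
        by_cases h2 : t - e + 1 + k ∈ S
        · have h3 : S.filter (fun v => t - e < v ∧ v < t - e + 1 + k + 1) =
              insert (t - e + 1 + k) (S.filter fun v => t - e < v ∧ v < t - e + 1 + k) := by
            ext v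
            simp only [Finset.mem_filter, Finset.mem_insert]
            constructor
            · rintro ⟨h3, h4⟩
              by_cases h5 : v = t - e + 1 + k
              · exact Or.inl h5
              · exact Or.inr ⟨h3, by omega⟩
            · rintro (h3 | h3)
              · exact ⟨h3 ▸ h2, by omega⟩
              · exact ⟨h3.1, by omega⟩
          rw [sumTo_succ_of_mem h2, ih (by omega), h3, Finset.sum_insert (by simp)]
          omega
        · have h3 : S.filter (fun v => t - e < v ∧ v < t - e + 1 + k + 1) =
              S.filter fun v => t - e < v ∧ v < t - e + 1 + k := by
            refine Finset.filter_congr fun v hv => ?_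
            have : v ≠ t - e + 1 + k := fun h => h2 (h ▸ hv)
            omega
          rw [sumTo_succ_of_notMem h2, ih (by omega), h3]
    have h2 := h1 (e - 1) (by omega)
    rw [show t - e + 1 + (e - 1) = t by omega] at h2
    rw [sumTo_succ_of_mem hm, h2]
    omega
  · rw [Finset.disjoint_left]
    intro v h1 h2
    simp only [Finset.mem_filter, Finset.mem_insert] at h1 h2
    rcases h2 with h2 | h2
    · omega
    · have := Finset.mem_range.1 (peel_subset he _ h2)
      omega

theorem sumTo_of_le_firstGap {n : ℕ} (hn : n ≤ firstGap S) :
    sumTo n S = ∑ v ∈ Finset.range n, v := by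
  refine Finset.sum_congr rfl fun v hv => if_pos (mem_of_lt_firstGap ?_)
  have := Finset.mem_range.1 hv; omega

/-- The first gap of the peeled set tells whether the number of removed boxes is divisible
by `e`. -/
theorem firstGap_peel (he : 0 < e) (hf : e ≤ firstGap S) (ht : firstGap S < t) :
    (∃ m, sumTo t S = ∑ v ∈ peel e S t, v + m * e + (firstGap S - 1) ∧
      firstGap (peel e S t) = firstGap S - 1) ∨
    ∃ m r, 0 < r ∧ r < e ∧ sumTo t S + r = ∑ v ∈ peel e S t, v + m * e + firstGap S ∧
      firstGap (peel e S t) = firstGap S := by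
  induction t using Nat.strong_induction_on with
  | _ t ih =>
    obtain ⟨t, rfl⟩ : ∃ u, t = u + 1 := ⟨t - 1, by omega⟩
    set f := firstGap S with hfdef
    have hbase : peel e S (f + 1) = Finset.range (f - 1) := by
      rw [peel_succ_of_notMem (firstGap_notMem S)]
      have := peel_interval (n := f - 1) he fun v hv => mem_of_lt_firstGap (S := S) (by omega)
      rwa [show f - 1 + 1 = f by omega] at this
    have hrange : ∀ n, firstGap (Finset.range n) = n := fun n => firstGap_eq (by simp) (by simp)
    -- Nothing is left above the first gap: the segments end exactly there, and no partial segment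
    -- remains.
    by_cases htf : t = f
    · left
      refine ⟨0, ?_, ?_⟩
      · rw [htf, hbase, sumTo_succ_of_notMem (firstGap_notMem S), sumTo_of_le_firstGap le_rfl,
          ← hfdef]
        conv_lhs => rw [show f = f - 1 + 1 by omega, Finset.sum_range_succ]
        omega
      · rw [htf, hbase, hrange]
    by_cases hm : t ∈ S
    swap
    · rw [peel_succ_of_notMem hm, sumTo_succ_of_notMem hm]
      exact ih t (by omega) (by omega)
    have hte : e ≤ t := by omega
    have hsum := sum_peel_succ he hm hte
    have hmem := fun v => by
      have := Finset.ext_iff.1 (peel_succ_of_le hm he hte) v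
      rwa [Finset.mem_union, Finset.mem_insert, Finset.mem_filter] at this
    -- In the first case the last segment crosses the first gap. The `f - (t - e)` positions of it
    -- that lie above `t - e` and at or below `f` carry no boxes; this number is the remainder `r`.
    rcases Nat.lt_or_ge (t - e) f with hu | hu
    · right
      have hJ : peel e S (t - e + 1) = Finset.range (t - e) :=
        peel_interval he fun v hv => mem_of_lt_firstGap (by omega)
      refine ⟨1, f - (t - e), by omega, by omega, ?_, ?_⟩
      · rw [hJ, sumTo_of_le_firstGap (S := S) (n := t - e + 1) (by omega), Finset.sum_range_succ] at hsum
        omega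
      · refine firstGap_eq (fun v hv => ?_) fun h => ?_
        · rw [hmem, hJ, Finset.mem_range]
          have := mem_of_lt_firstGap (S := S) hv
          rcases lt_trichotomy v (t - e) with h | h | h
          · exact Or.inr (Or.inr h)
          · exact Or.inr (Or.inl h)
          · exact Or.inl ⟨this, h, by omega⟩
        · rw [hmem, hJ, Finset.mem_range] at h
          rcases h with h | h | h
          · exact firstGap_notMem S h.1
          · omega
          · omega
    · have hkeep : firstGap (peel e S (t - e + 1)) ≠ t - e →
          firstGap (peel e S (t - e + 1)) ≤ f →
          firstGap (peel e S (t + 1)) = firstGap (peel e S (t - e + 1)) := by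
        intro h1 h2
        refine firstGap_eq (fun v hv => ?_) fun h => ?_
        · rw [hmem]; exact Or.inr (Or.inr (mem_of_lt_firstGap hv))
        · rw [hmem] at h
          rcases h with h | h | h
          · omega
          · exact h1 h
          · exact firstGap_notMem _ h
      rcases ih (t - e + 1) (by omega) (by omega) with ⟨m, h1, h2⟩ | ⟨m, r, hr, hre, h1, h2⟩
      · left
        refine ⟨m + 1, ?_, by rw [hkeep (by omega) (by omega), h2]⟩
        rw [add_mul]; omega
      · right
        refine ⟨m + 1, r, hr, hre, by rw [add_mul]; omega, ?_⟩
        rw [hkeep _ (by omega), h2]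
        intro h3
        have h4 : t - e = f := by omega
        rw [h4, hbase, hrange] at h2
        omega

/-- Peeling commutes with the insertion of a bead at the first gap. -/
theorem peel_insert_firstGap (he : 0 < e) (hf : e ≤ firstGap S) (ht : firstGap S < t) :
    peel e (insert (firstGap S) S) t = insert (firstGap (peel e S t)) (peel e S t) := by
  induction t using Nat.strong_induction_on with
  | _ t ih =>
    obtain ⟨t, rfl⟩ : ∃ u, t = u + 1 := ⟨t - 1, by omega⟩
    set f := firstGap S with hfdef
    have hbase : peel e S (f + 1) = Finset.range (f - 1) := by
      rw [peel_succ_of_notMem (firstGap_notMem S)]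
      have := peel_interval (n := f - 1) he fun v hv => mem_of_lt_firstGap (S := S) (by omega)
      rwa [show f - 1 + 1 = f by omega] at this
    have hrange : ∀ n, firstGap (Finset.range n) = n := fun n => firstGap_eq (by simp) (by simp)
    have hint : ∀ n ≤ f, peel e (insert f S) (n + 1) = Finset.range n := fun n hn =>
      peel_interval he fun v hv => by
        rcases Nat.lt_or_ge v f with h | h
        · exact Finset.mem_insert_of_mem (mem_of_lt_firstGap h)
        · rw [show v = f by omega]; exact Finset.mem_insert_self _ _
    by_cases htf : t = f
    · rw [htf, hint f le_rfl, hbase, hrange]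
      ext v; simp only [Finset.mem_range, Finset.mem_insert]; omega
    by_cases hm : t ∈ S
    swap
    · rw [peel_succ_of_notMem hm, peel_succ_of_notMem (by simp [htf, hm])]
      exact ih t (by omega) (by omega)
    have hte : e ≤ t := by omega
    have hmem := fun v => by
      have := Finset.ext_iff.1 (peel_succ_of_le hm he hte) v
      rwa [Finset.mem_union, Finset.mem_insert, Finset.mem_filter] at this
    have hmem' := fun v => by
      have := Finset.ext_iff.1 (peel_succ_of_le (S := insert f S)
        (Finset.mem_insert_of_mem hm) he hte) v
      rwa [Finset.mem_union, Finset.mem_insert, Finset.mem_filter] at this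
    rcases Nat.lt_or_ge (t - e) f with hu | hu
    · have hJ : peel e S (t - e + 1) = Finset.range (t - e) :=
        peel_interval he fun v hv => mem_of_lt_firstGap (by omega)
      have h1 : firstGap (peel e S (t + 1)) = f := by
        refine firstGap_eq (fun v hv => ?_) fun h => ?_
        · rw [hmem, hJ, Finset.mem_range]
          have := mem_of_lt_firstGap (S := S) hv
          rcases lt_trichotomy v (t - e) with h | h | h
          · exact Or.inr (Or.inr h)
          · exact Or.inr (Or.inl h)
          · exact Or.inl ⟨this, h, by omega⟩
        · rw [hmem, hJ, Finset.mem_range] at h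
          rcases h with h | h | h
          · exact firstGap_notMem S h.1
          · omega
          · omega
      rw [h1]
      ext v
      rw [hmem', hint _ hu.le, Finset.mem_insert, Finset.mem_insert, hmem, hJ]
      by_cases hvf : v = f
      · simp only [hvf, true_or, true_and, iff_true]
        left; omega
      · simp [hvf]
    · rcases Nat.eq_or_lt_of_le hu with hu | hu
      · have h1 : firstGap (peel e S (t + 1)) = f - 1 := by
          refine firstGap_eq (fun v hv => ?_) fun h => ?_
          · rw [hmem, ← hu, hbase, Finset.mem_range]; exact Or.inr (Or.inr hv)
          · rw [hmem, ← hu, hbase, Finset.mem_range] at h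
            omega
        rw [h1]
        ext v
        rw [hmem', ← hu, hint f le_rfl, Finset.mem_insert, Finset.mem_insert, hmem, ← hu, hbase, Finset.mem_range,
          Finset.mem_range]
        by_cases hvf : v = f
        · simp [hvf]
        · by_cases hv : v ∈ S <;> simp only [hvf, hv, true_and, false_and, false_or] <;> omega
      · have hg : firstGap (peel e S (t - e + 1)) ≤ f := by
          rcases firstGap_peel (t := t - e + 1) he hf (by omega) with ⟨m, h1, h2⟩ | ⟨m, r, h1, h2, h3, h4⟩
          · omega
          · omega
        have h1 : firstGap (peel e S (t + 1)) = firstGap (peel e S (t - e + 1)) := by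
          refine firstGap_eq (fun v hv => ?_) fun h => ?_
          · rw [hmem]; exact Or.inr (Or.inr (mem_of_lt_firstGap hv))
          · rw [hmem] at h
            rcases h with h | h | h
            · omega
            · omega
            · exact firstGap_notMem _ h
        ext v
        rw [hmem', ih (t - e + 1) (by omega) (by omega), Finset.mem_insert, Finset.mem_insert,
          Finset.mem_insert, hmem, h1]
        by_cases hvf : v = f
        · subst hvf
          constructor
          · rintro (h | h | h | h)
            · omega
            · omega
            · exact Or.inl h
            · exact Or.inr (Or.inr (Or.inr h))
          · rintro (h | h | h | h)
            · exact Or.inr (Or.inr (Or.inl h))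
            · omega
            · omega
            · exact Or.inr (Or.inr (Or.inr h))
        · simp only [hvf, false_or]; tauto

/-- The set of beads after the removal of the `e`-rim. -/
noncomputable def rimRemoved (e H : ℕ) (S : Finset ℕ) : Finset ℕ :=
  insert (firstGap (peel e S H)) (peel e S H)

end peel

/-! ### Simultaneous removal of the `e`-rims of a pair -/

/-- A maximal and a conjugate minimal arrangement with the same numbers of beads. -/
structure Paired (e H : ℕ) (S T : Finset ℕ) : Prop where
  left_subset : S ⊆ Finset.range H
  right_subset : T ⊆ Finset.range H
  left_good : Good e 1 S
  right_good : Good e (1 + e) T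
  sameData : SameData e 1 H S (conj H T)

section

variable {e H : ℕ} {S T : Finset ℕ}

theorem conj_insert {f : ℕ} (hf : f < H) : conj H (insert f T) = (conj H T).erase (H - 1 - f) := by
  ext v
  simp only [mem_conj, Finset.mem_erase, Finset.mem_insert, not_or]
  constructor
  · rintro ⟨h1, h2, h3⟩; exact ⟨by omega, h1, h3⟩
  · rintro ⟨h1, h2, h3⟩; exact ⟨h2, by omega, h3⟩

/-- The first gap of `T` is reflected to the topmost bead of the conjugate. -/
theorem le_of_mem_conj {b : ℕ} (hb : b ∈ conj H T) : b ≤ H - 1 - firstGap T := by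
  rw [mem_conj] at hb
  have := firstGap_le hb.2
  omega

theorem one_add_e_add_e (e : ℕ) : (1 : ZMod (2 * e)) + e + e = 1 := by
  rw [add_assoc, e_add_e, add_zero]

/-- Both members of a pair lose their `e`-rims at the same time. -/
theorem Paired.next (h : Paired e H S T) (he : 0 < e) (hS : e ≤ firstGap S) (hT : e ≤ firstGap T) :
    Paired e H (rimRemoved e H S) (rimRemoved e H T) ∧ firstGap T < H ∧
    firstGap (peel e S H) < H ∧
    ∑ v ∈ S, v + firstGap T + firstGap (peel e S H) + 1 = ∑ v ∈ rimRemoved e H S, v + H ∧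
    ∑ v ∈ T, v + firstGap T + firstGap (peel e S H) + 1 = ∑ v ∈ rimRemoved e H T, v + H := by
  have hS0 : 0 ∈ S := mem_of_lt_firstGap (by omega)
  have hT0 : 0 ∈ T := mem_of_lt_firstGap (by omega)
  have hH : 0 < H := by simpa using h.left_subset hS0
  have hcard := card_conj h.right_subset
  have hSpos : 0 < S.card := Finset.card_pos.2 ⟨0, hS0⟩
  have h1 := h.sameData.1
  have hfT : firstGap T < H := firstGap_lt (by omega)
  obtain ⟨L, hL⟩ := exists_peel he hS0 hH
  have hmem : H - 1 - firstGap T ∈ conj H T := (mem_conj_flip hfT).2 (firstGap_notMem T)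
  have hEG : EGood e 1 (conj H T) := by
    rw [← good_conj (conj_subset H T), conj_conj h.right_subset]
    exact h.right_good
  -- First half: `S` is peeled and `T` gains a bead at its first gap.
  obtain ⟨hc, hd, hEG'⟩ := h.sameData.peel (isStep_one e) he h.left_subset (conj_subset H T)
    h.left_good hEG hL hmem fun b hb => le_of_mem_conj hb
  have hJcard := hd.1
  rw [← conj_insert hfT] at hd hEG'
  rw [Finset.card_erase_of_mem hmem] at hJcard
  have hT1 : insert (firstGap T) T ⊆ Finset.range H :=
    Finset.insert_subset (Finset.mem_range.2 hfT) h.right_subset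
  have hJ := peel_subset (S := S) he H
  have hfJ : firstGap (peel e S H) < H := firstGap_lt (by
    have := Finset.card_le_card h.left_subset
    rw [Finset.card_range] at this
    omega)
  have hT1good : Good e (1 + e) (insert (firstGap T) T) := by
    have := (good_conj (conj_subset H _)).2 hEG'
    rwa [conj_conj hT1] at this
  have hd1 := hd.conj hJ (conj_subset H _)
  rw [conj_conj hT1] at hd1
  have hEGJ : EGood e (1 + e) (conj H (peel e S H)) := by
    rw [← good_conj (conj_subset H _), conj_conj hJ, one_add_e_add_e]
    exact hL.good (isStep_one e) h.left_good he
  obtain ⟨L', hL'⟩ := exists_peel (e := e) he (Finset.mem_insert_of_mem hT0 : 0 ∈ insert (firstGap T) T) hH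
  have hmem' : H - 1 - firstGap (peel e S H) ∈ conj H (peel e S H) :=
    (mem_conj_flip hfJ).2 (firstGap_notMem _)
  -- Second half, with the roles exchanged and step `1 + e`: the enlarged `T` is peeled and the
  -- first gap of the peeled `S` is filled.
  obtain ⟨hc', hd', hEG''⟩ := hd1.symm.peel (isStep_one e).add he hT1 (conj_subset H _)
    hT1good hEGJ hL' hmem' fun b hb => le_of_mem_conj hb
  have hgood' := hL'.good (isStep_one e).add hT1good he
  rw [← conj_insert hfJ] at hd' hEG''
  -- On the side of `T` the bead was added before peeling, while the removal of the rim adds it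
  -- afterwards; the order does not matter.
  have hrT : peel e (insert (firstGap T) T) H = rimRemoved e H T := peel_insert_firstGap he hT hfT
  have hrTsub : rimRemoved e H T ⊆ Finset.range H := hrT ▸ peel_subset he H
  have hrSsub : rimRemoved e H S ⊆ Finset.range H :=
    Finset.insert_subset (Finset.mem_range.2 hfJ) hJ
  have hsumS := hL.sumTo_eq
  rw [sumTo_eq_sum h.left_subset, sumTo_eq_sum hJ] at hsumS
  have hsumT := hL'.sumTo_eq
  rw [sumTo_eq_sum hT1, Finset.sum_insert (firstGap_notMem T), hrT, sumTo_eq_sum hrTsub] at hsumT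
  rw [hrT] at hd' hgood'
  refine ⟨⟨hrSsub, hrTsub, ?_, hgood', ?_⟩, hfT, hfJ, ?_, ?_⟩
  · have := (good_conj (conj_subset H _)).2 hEG''
    rwa [one_add_e_add_e, ← rimRemoved, conj_conj hrSsub] at this
  · have := hd'.symm.conj (conj_subset H _) hrTsub
    rwa [one_add_e_add_e, ← rimRemoved, conj_conj hrSsub] at this
  · rw [rimRemoved, Finset.sum_insert (firstGap_notMem _)]
    omega
  · omega

end

end BeadSet

/-! ### The beads of a partition -/

namespace BeadSet

theorem below_add_le (S : Finset ℕ) (v k : ℕ) : below S (v + k) ≤ below S v + k := by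
  induction k with
  | zero => simp
  | succ k ih =>
    rw [← add_assoc]
    by_cases h : v + k ∈ S
    · rw [below_succ_of_mem h]; omega
    · rw [below_succ_of_notMem h]; omega

theorem gaps_lt_gaps {S : Finset ℕ} {v w : ℕ} (h : v ∉ S) (hvw : v < w) :
    v - below S v < w - below S w := by
  have h1 := below_succ_of_notMem h
  have h2 := below_add_le S (v + 1) (w - (v + 1))
  rw [show v + 1 + (w - (v + 1)) = w by omega] at h2
  have h3 := below_le S v
  omega

end BeadSet

namespace YoungDiagram

open BeadSet

/-- The set of `N` beads that encodes a partition with at most `N` parts. -/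
def beads (N : ℕ) (μ : YoungDiagram) : Finset ℕ :=
  (Finset.range N).image fun i => μ.rowLen i + (N - 1 - i)

section

variable {N : ℕ} {μ ν : YoungDiagram}

theorem rowLen_eq_zero {i : ℕ} (h : μ.colLen 0 ≤ i) : μ.rowLen i = 0 := by
  by_contra h1
  have h2 : (i, 0) ∈ μ := mem_iff_lt_rowLen.2 (by omega)
  have := mem_iff_lt_colLen.1 h2
  omega

theorem mem_beads {b : ℕ} : b ∈ beads N μ ↔ ∃ i < N, μ.rowLen i + (N - 1 - i) = b := by
  simp [beads]

theorem bead_strictAnti {i k : ℕ} (hik : i < k) (hk : k < N) :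
    μ.rowLen k + (N - 1 - k) < μ.rowLen i + (N - 1 - i) := by
  have := μ.rowLen_anti i k hik.le
  omega

theorem bead_injOn : Set.InjOn (fun i => μ.rowLen i + (N - 1 - i)) (Finset.range N : Set ℕ) := by
  intro i hi k hk h
  simp only [Finset.coe_range, Set.mem_Iio] at hi hk h
  rcases lt_trichotomy i k with h1 | h1 | h1
  · have := bead_strictAnti (μ := μ) h1 hk; omega
  · exact h1
  · have := bead_strictAnti (μ := μ) h1 hi; omega

theorem card_beads (N : ℕ) (μ : YoungDiagram) : (beads N μ).card = N := by
  rw [beads, Finset.card_image_of_injOn bead_injOn, Finset.card_range]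

theorem sum_beads {M : Type*} [AddCommMonoid M] (f : ℕ → M) :
    ∑ b ∈ beads N μ, f b = ∑ i ∈ Finset.range N, f (μ.rowLen i + (N - 1 - i)) :=
  Finset.sum_image bead_injOn

theorem le_bead_iff {i v : ℕ} (hi : i < N) :
    v ≤ μ.rowLen i + (N - 1 - i) ↔ i + below (beads N μ) v < N := by
  have hf : (beads N μ).filter (· < v) = ((Finset.range N).filter fun k =>
      μ.rowLen k + (N - 1 - k) < v).image fun k => μ.rowLen k + (N - 1 - k) := by
    rw [beads, Finset.filter_image]
  have hb : below (beads N μ) v = ((Finset.range N).filter fun k =>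
      μ.rowLen k + (N - 1 - k) < v).card := by
    rw [below, hf, Finset.card_image_of_injOn]
    exact bead_injOn.mono (by simp only [Finset.coe_filter]; exact fun x hx => by simpa using hx.1)
  rw [hb]
  constructor
  · intro h
    have : ((Finset.range N).filter fun k => μ.rowLen k + (N - 1 - k) < v) ⊆
        Finset.Ioo i N := by
      intro k hk
      simp only [Finset.mem_filter, Finset.mem_range, Finset.mem_Ioo] at hk ⊢
      refine ⟨?_, hk.1⟩
      by_contra h1
      have := μ.rowLen_anti k i (by omega)
      omega
    have := Finset.card_le_card this
    rw [Nat.card_Ioo] at this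
    omega
  · intro h
    by_contra h1
    have : Finset.Ico i N ⊆ (Finset.range N).filter fun k => μ.rowLen k + (N - 1 - k) < v := by
      intro k hk
      simp only [Finset.mem_filter, Finset.mem_range, Finset.mem_Ico] at hk ⊢
      refine ⟨hk.2, ?_⟩
      have := μ.rowLen_anti i k hk.1
      omega
    have := Finset.card_le_card this
    rw [Nat.card_Ico] at this
    omega

/-- Position `N + j - i` names the diagonal of the box, and the beads below it count the rows that
end before that diagonal. For `i ≥ N` both sides fail. -/
theorem mem_iff_below (hN : μ.colLen 0 ≤ N) {i j : ℕ} :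
    (i, j) ∈ μ ↔ i + below (beads N μ) (N + j - i) < N := by
  rcases Nat.lt_or_ge i N with hi | hi
  · rw [← le_bead_iff hi, mem_iff_lt_rowLen]; omega
  · rw [mem_iff_lt_rowLen, rowLen_eq_zero (by omega)]; omega

theorem eq_of_beads_eq (hμ : μ.colLen 0 ≤ N) (hν : ν.colLen 0 ≤ N) (h : beads N μ = beads N ν) :
    μ = ν := by
  ext ⟨i, j⟩
  rw [mem_cells, mem_cells, mem_iff_below hμ, mem_iff_below hν, h]

/-- Hence the number of gaps below a bead is its part, which is how parities of parts enter the
walk. -/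
theorem below_bead {i : ℕ} (hi : i < N) :
    below (beads N μ) (μ.rowLen i + (N - 1 - i)) = N - 1 - i := by
  have h1 := (le_bead_iff (μ := μ) hi).1 le_rfl
  have h2 := (le_bead_iff (μ := μ) (v := μ.rowLen i + (N - 1 - i) + 1) hi).not.1 (by omega)
  rw [below_succ_of_mem (mem_beads.2 ⟨i, hi, rfl⟩)] at h2
  omega

theorem card_eq_sum_rowLen (hN : μ.colLen 0 ≤ N) :
    μ.card = ∑ i ∈ Finset.range N, μ.rowLen i := by
  rw [YoungDiagram.card, Finset.card_eq_sum_card_fiberwise (f := Prod.fst) (t := Finset.range N)]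
  · exact Finset.sum_congr rfl fun i _ => (μ.rowLen_eq_card).symm
  · rintro ⟨i, j⟩ h
    have h1 : (i, j) ∈ μ := by simpa using h
    have h2 : (i, 0) ∈ μ := μ.up_left_mem le_rfl (Nat.zero_le _) h1
    have := mem_iff_lt_colLen.1 h2
    simp only [Finset.coe_range, Set.mem_Iio]
    omega

theorem sum_beads_eq (hN : μ.colLen 0 ≤ N) :
    ∑ b ∈ beads N μ, b = μ.card + ∑ i ∈ Finset.range N, i := by
  rw [sum_beads, Finset.sum_add_distrib, card_eq_sum_rowLen hN,
    Finset.sum_range_reflect (fun i => i) N]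

theorem rowLen_le_card (μ : YoungDiagram) (i : ℕ) : μ.rowLen i ≤ μ.card := by
  rw [rowLen_eq_card]; exact Finset.card_le_card (Finset.filter_subset _ _)

theorem colLen_le_card (μ : YoungDiagram) (j : ℕ) : μ.colLen j ≤ μ.card := by
  rw [colLen_eq_card]; exact Finset.card_le_card (Finset.filter_subset _ _)

theorem card_transpose (μ : YoungDiagram) : μ.transpose.card = μ.card :=
  Finset.card_map _

theorem beads_subset {H : ℕ} (h : N + μ.rowLen 0 ≤ H) : beads N μ ⊆ Finset.range H := by
  intro b hb
  obtain ⟨i, hi, rfl⟩ := mem_beads.1 hb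
  have := μ.rowLen_anti 0 i (Nat.zero_le _)
  rw [Finset.mem_range]; omega

/-- Every set of beads comes from a partition. -/
theorem exists_beads_eq (S : Finset ℕ) : ∃ μ : YoungDiagram, μ.colLen 0 ≤ S.card ∧
    beads S.card μ = S := by
  set N := S.card with hN
  have hdown : ∀ {i i' j j' : ℕ}, i' ≤ i → j' ≤ j → i + below S (N + j - i) < N →
      i' + below S (N + j' - i') < N := by
    intro i i' j j' hi hj h
    have h1 := below_mono S (show N + j' - i' ≤ N + j - i' by omega)
    have h2 := below_add_le S (N + j - i) (i - i')
    rw [show N + j - i + (i - i') = N + j - i' by omega] at h2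
    omega
  let μ : YoungDiagram :=
    { cells := (Finset.range N ×ˢ Finset.range (S.sup id + 1)).filter fun c =>
        c.1 + below S (N + c.2 - c.1) < N
      isLowerSet := by
        rintro ⟨i, j⟩ ⟨i', j'⟩ ⟨h1, h2⟩ h
        simp only [Finset.coe_filter, Finset.mem_product, Finset.mem_range, Set.mem_ofPred_eq] at h h1 h2 ⊢
        exact ⟨⟨by omega, by omega⟩, hdown h1 h2 h.2⟩ }
  have hmem : ∀ i j, (i, j) ∈ μ ↔ i + below S (N + j - i) < N := by
    intro i j
    rw [← mem_cells]
    simp only [μ, Finset.mem_filter, Finset.mem_product, Finset.mem_range, and_iff_right_iff_imp]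
    intro h
    refine ⟨by omega, ?_⟩
    by_contra h1
    have h2 : below S (N + j - i) = S.card := below_eq_card fun b hb => by
      have := Finset.le_sup (f := id) hb
      simp only [id] at this
      omega
    omega
  refine ⟨μ, ?_, ?_⟩
  · by_contra h
    have := (hmem N 0).1 (mem_iff_lt_colLen.2 (by omega))
    omega
  · symm
    apply Finset.eq_of_subset_of_card_le _ (by rw [card_beads])
    intro b hb
    have h1 : below S b < N := by
      have h1 := below_succ_of_mem hb
      have h2 := below_le_card S (b + 1)
      omega
    have h0 := below_le S b
    refine mem_beads.2 ⟨N - 1 - below S b, by omega, ?_⟩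
    have h2 : μ.rowLen (N - 1 - below S b) = b - below S b := by
      apply le_antisymm
      · by_contra h2
        have h3 := (hmem (N - 1 - below S b) (b - below S b)).1 (mem_iff_lt_rowLen.2 (by omega))
        rw [show N + (b - below S b) - (N - 1 - below S b) = b + 1 by omega,
          below_succ_of_mem hb] at h3
        omega
      · by_contra h2
        have h3 := (hmem (N - 1 - below S b) (b - below S b - 1)).not.1 (by
          rw [mem_iff_lt_rowLen]; omega)
        rw [show N + (b - below S b - 1) - (N - 1 - below S b) = b by omega] at h3
        omega
    rw [h2]; omega

/-- The beads of the conjugate partition. -/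
theorem notMem_beads_col {j : ℕ} : N + j - μ.colLen j ∉ beads N μ := by
  intro h
  obtain ⟨k, hk, h⟩ := mem_beads.1 h
  have h1 := μ.colLen_anti 0 j (Nat.zero_le _)
  by_cases hm : (k, j) ∈ μ
  · have := mem_iff_lt_rowLen.1 hm
    have := mem_iff_lt_colLen.1 hm
    omega
  · have := mem_iff_lt_rowLen.not.1 hm
    have := mem_iff_lt_colLen.not.1 hm
    omega

theorem beads_transpose {N' : ℕ} (hN : μ.colLen 0 ≤ N) (hN' : μ.rowLen 0 ≤ N') :
    beads N' μ.transpose = conj (N + N') (beads N μ) := by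
  have hsub := beads_subset (N := N) (μ := μ) (H := N + N') (by omega)
  apply Finset.eq_of_subset_of_card_le
  · intro b hb
    obtain ⟨j, hj, rfl⟩ := mem_beads.1 hb
    have h1 := μ.colLen_anti 0 j (Nat.zero_le _)
    rw [rowLen_transpose, mem_conj]
    refine ⟨by omega, ?_⟩
    rw [show N + N' - 1 - (μ.colLen j + (N' - 1 - j)) = N + j - μ.colLen j by omega]
    exact notMem_beads_col
  · have := card_conj hsub
    rw [card_beads] at this ⊢
    omega

/-! ### Removal of parts of the rim -/

theorem mem_rim {c : ℕ × ℕ} : c ∈ μ.rim ↔ c ∈ μ ∧ (c.1 + 1, c.2 + 1) ∉ μ := by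
  simp [rim, rimHook]

/-- One more bead below `v` moves the boundary in by one box on the diagonal of `v`. If this happens
at most once per diagonal, exactly the rim boxes on the marked diagonals disappear. -/
theorem cells_eq_sdiff_rim (hμ : μ.colLen 0 ≤ N) (hν : ν.colLen 0 ≤ N) (V : ℕ → Prop)
    [DecidablePred V] (h : ∀ v, below (beads N ν) v = below (beads N μ) v + if V v then 1 else 0) :
    ν.cells = μ.cells \ μ.rim.filter fun c => V (N + c.2 - c.1) := by
  ext ⟨i, j⟩
  rw [Finset.mem_sdiff, Finset.mem_filter, mem_rim, mem_cells, mem_cells, mem_iff_below hν,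
    mem_iff_below hμ, mem_iff_below hμ, h, show N + (j + 1) - (i + 1) = N + j - i by omega]
  split_ifs with hV
  · simp only [hV, and_true, not_and, not_not]
    constructor
    · intro h; exact ⟨by omega, fun _ => by omega⟩
    · rintro ⟨h1, h2⟩
      have := h2 h1
      omega
  · simp [hV]

theorem below_replace {S : Finset ℕ} {b g : ℕ} (hb : b ∈ S) (hg : g ∉ S) (hgb : g < b) (v : ℕ) :
    below (insert g (S.erase b)) v = below S v + if g < v ∧ v ≤ b then 1 else 0 := by
  have hm : ∀ w, w ≠ g → w ≠ b → (w ∈ insert g (S.erase b) ↔ w ∈ S) := fun w h1 h2 => by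
    simp [h1, h2]
  induction v with
  | zero => simp [below_zero]
  | succ v ih =>
    rcases eq_or_ne v g with rfl | h1
    · rw [below_succ_of_mem (Finset.mem_insert_self _ _), below_succ_of_notMem hg, ih,
        if_neg (by omega), if_pos (by omega)]
    rcases eq_or_ne v b with rfl | h2
    · rw [below_succ_of_notMem (by simp [h1]), below_succ_of_mem hb, ih,
        if_pos (by omega), if_neg (by omega)]
    have h3 : (if g < v + 1 ∧ v + 1 ≤ b then 1 else 0) = if g < v ∧ v ≤ b then 1 else 0 := by
      congr 1
      exact propext (by omega)
    by_cases h : v ∈ S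
    · rw [below_succ_of_mem ((hm v h1 h2).2 h), below_succ_of_mem h, ih, h3]; omega
    · rw [below_succ_of_notMem (fun h' => h ((hm v h1 h2).1 h')), below_succ_of_notMem h, ih, h3]

theorem sum_replace {S : Finset ℕ} {b g : ℕ} (hb : b ∈ S) (hg : g ∉ S) :
    ∑ v ∈ insert g (S.erase b), v + b = ∑ v ∈ S, v + g := by
  rw [Finset.sum_insert (by simp [hg])]
  have := Finset.add_sum_erase S (fun v => v) hb
  omega

theorem card_replace {S : Finset ℕ} {b g : ℕ} (hb : b ∈ S) (hg : g ∉ S) :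
    (insert g (S.erase b)).card = S.card := by
  rw [Finset.card_insert_of_notMem (by simp [hg]), Finset.card_erase_of_mem hb]
  have : 0 < S.card := Finset.card_pos.2 ⟨b, hb⟩
  omega

/-- Along the rim the diagonals decrease one by one, so the hook is the interval between the foot of
column `j` and the end of row `i`. -/
theorem rimHook_eq {i j : ℕ} (hN : μ.colLen 0 ≤ N) (hc : (i, j) ∈ μ) :
    μ.rimHook (i, j) = μ.rim.filter fun c => N + j - μ.colLen j < N + c.2 - c.1 ∧
      N + c.2 - c.1 ≤ μ.rowLen i + (N - 1 - i) := by
  have h0 := μ.colLen_anti 0 j (Nat.zero_le _)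
  have hi := mem_iff_lt_colLen.1 hc
  ext ⟨i', j'⟩
  rw [Finset.mem_filter, mem_rim]
  simp only [rimHook, Finset.mem_filter, mem_cells]
  constructor
  · rintro ⟨h1, h2, h3, h4⟩
    refine ⟨⟨h1, h4⟩, ?_⟩
    have h5 := mem_iff_lt_colLen.1 h1
    have h6 := mem_iff_lt_rowLen.1 h1
    have h7 := μ.colLen_anti j j' h3
    have h8 := μ.rowLen_anti i i' h2
    omega
  · rintro ⟨⟨h1, h4⟩, h2, h3⟩
    have h5 := mem_iff_lt_colLen.1 h1
    have h6 := μ.colLen_anti 0 j' (Nat.zero_le _)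
    have h7 := mem_iff_lt_colLen.not.1 h4
    have h8 := mem_iff_lt_rowLen.not.1 h4
    refine ⟨h1, ?_, ?_, h4⟩
    · by_contra h
      have := μ.rowLen_anti (i' + 1) i (by omega)
      omega
    · by_contra h
      have := μ.colLen_anti (j' + 1) j (by omega)
      omega

/-- The removal of a rim hook moves a bead to a gap below it. -/
theorem rimHook_remove (hN : μ.colLen 0 ≤ N) {c : ℕ × ℕ} (hc : c ∈ μ) {b g : ℕ}
    (hb : b = μ.rowLen c.1 + (N - 1 - c.1)) (hg : g = N + c.2 - μ.colLen c.2) :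
    b ∈ beads N μ ∧ g ∉ beads N μ ∧ g + (μ.rimHook c).card = b ∧
      ∃ ν : YoungDiagram, ν.colLen 0 ≤ N ∧ ν.cells = μ.cells \ μ.rimHook c ∧
        beads N ν = insert g ((beads N μ).erase b) := by
  obtain ⟨i, j⟩ := c
  simp only at hb hg
  have h0 := μ.colLen_anti 0 j (Nat.zero_le _)
  have hi := mem_iff_lt_colLen.1 hc
  have hj := mem_iff_lt_rowLen.1 hc
  have hbm : b ∈ beads N μ := mem_beads.2 ⟨i, by omega, hb.symm⟩
  have hgm : g ∉ beads N μ := hg ▸ notMem_beads_col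
  have hgb : g < b := by omega
  obtain ⟨ν, hν, hν'⟩ := exists_beads_eq (insert g ((beads N μ).erase b))
  rw [card_replace hbm hgm, card_beads] at hν hν'
  have hcells : ν.cells = μ.cells \ μ.rimHook (i, j) := by
    rw [rimHook_eq hN hc, ← hb, ← hg]
    exact cells_eq_sdiff_rim hN hν (fun v => g < v ∧ v ≤ b) fun v => by
      rw [hν', below_replace hbm hgm hgb]
  refine ⟨hbm, hgm, ?_, ν, hν, hcells, hν'⟩
  have h1 := sum_replace hbm hgm
  rw [← hν', sum_beads_eq hν, sum_beads_eq hN] at h1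
  have h2 : ν.card + (μ.rimHook (i, j)).card = μ.card := by
    rw [YoungDiagram.card, YoungDiagram.card, hcells]
    exact Finset.card_sdiff_add_card_eq_card (Finset.filter_subset _ _)
  omega

/-- The row is the index of the bead, and the column is the number of gaps below `g`. -/
theorem exists_box_of_bead (hN : μ.colLen 0 ≤ N) {b g : ℕ} (hb : b ∈ beads N μ)
    (hg : g ∉ beads N μ) (hgb : g < b) : ∃ c ∈ μ, b = μ.rowLen c.1 + (N - 1 - c.1) ∧
      g = N + c.2 - μ.colLen c.2 := by
  set S := beads N μ with hS
  obtain ⟨i, hi, hbi⟩ := mem_beads.1 hb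
  have h1 := gaps_lt_gaps hg hgb
  have h2 : below S b = N - 1 - i := by rw [← hbi, hS, below_bead hi]
  have h3 := below_le S g
  have h4 := below_le_card S g
  rw [hS, card_beads, ← hS] at h4
  have hcol : ∀ k, (k, g - below S g) ∈ μ ↔ k < N - below S g := by
    intro k
    rw [mem_iff_below hN, ← hS]
    rcases Nat.lt_or_ge (k + below S g) N with h | h
    · have h5 := below_add_le S (g + 1) (N - below S g - k - 1)
      rw [below_succ_of_notMem hg,
        show g + 1 + (N - below S g - k - 1) = N + (g - below S g) - k by omega] at h5
      omega
    · have h5 := below_add_le S (N + (g - below S g) - k) (g - (N + (g - below S g) - k))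
      rw [show N + (g - below S g) - k + (g - (N + (g - below S g) - k)) = g by omega] at h5
      omega
  have h5 : μ.colLen (g - below S g) = N - below S g := by
    apply le_antisymm
    · by_contra h
      have := (hcol (N - below S g)).1 (mem_iff_lt_colLen.2 (by omega))
      omega
    · by_contra h
      have := (hcol (μ.colLen (g - below S g))).2 (by omega)
      have := mem_iff_lt_colLen.1 this
      omega
  refine ⟨(i, g - below S g), ?_, hbi.symm, ?_⟩
  · rw [mem_iff_lt_rowLen]
    omega
  · simp only [h5]; omega

theorem isCore_iff {e : ℕ} (hN : μ.colLen 0 ≤ N) (he : 0 < e) :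
    μ.IsCore e ↔ ∀ b ∈ beads N μ, e ≤ b → b - e ∈ beads N μ := by
  constructor
  · intro h b hb heb
    by_contra hg
    obtain ⟨c, hc, hcb, hcg⟩ := exists_box_of_bead hN hb hg (by omega)
    obtain ⟨-, -, h1, -⟩ := rimHook_remove hN hc hcb hcg
    exact h c hc (by omega)
  · intro h c hc hcard
    obtain ⟨hb, hg, h1, -⟩ := rimHook_remove hN hc rfl rfl
    rw [hcard] at h1
    refine hg ?_
    have h2 := h _ hb (by omega)
    rwa [← h1, Nat.add_sub_cancel] at h2

end

end YoungDiagram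

/-! ### Residue counts, cores and runner matrices -/

namespace BeadSet

/-- The number of beads with a given residue. -/
def resCount (e : ℕ) (S : Finset ℕ) (n : ℕ) : ℕ := (S.filter fun b => b ≡ n [MOD e]).card

/-- The number of beads with a given residue and an odd number of gaps below. -/
def oddCount (e : ℕ) (S : Finset ℕ) (n : ℕ) : ℕ :=
  (S.filter fun b => b ≡ n [MOD e] ∧ Odd (b - below S b)).card

theorem resCount_replace {e : ℕ} {S : Finset ℕ} {b g : ℕ} (hb : b ∈ S) (hg : g ∉ S)
    (h : g ≡ b [MOD e]) : resCount e (insert g (S.erase b)) = resCount e S := by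
  ext n
  have h2 : S.filter (fun v => v ≡ n [MOD e]) =
      (insert b (S.erase b)).filter fun v => v ≡ n [MOD e] := by rw [Finset.insert_erase hb]
  rw [resCount, resCount, h2, Finset.filter_insert, Finset.filter_insert]
  have h3 : g ≡ n [MOD e] ↔ b ≡ n [MOD e] := ⟨fun h' => h.symm.trans h', fun h' => h.trans h'⟩
  simp only [h3]
  split_ifs
  · rw [Finset.card_insert_of_notMem (by simp [hg]), Finset.card_insert_of_notMem (by simp)]
  · rfl

/-- Cores are determined by the numbers of beads of each residue. -/
theorem eq_of_resCount_eq {e : ℕ} {S S' : Finset ℕ}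
    (hS : ∀ b ∈ S, e ≤ b → b - e ∈ S) (hS' : ∀ b ∈ S', e ≤ b → b - e ∈ S')
    (h : resCount e S = resCount e S') : S = S' := by
  have down : ∀ S : Finset ℕ, (∀ b ∈ S, e ≤ b → b - e ∈ S) → ∀ k v, v + k * e ∈ S → v ∈ S := by
    intro S hS k
    induction k with
    | zero => intro v hv; simpa using hv
    | succ k ih =>
      intro v hv
      refine ih v ?_
      have := hS _ hv (by rw [add_mul]; omega)
      rwa [show v + (k + 1) * e - e = v + k * e by rw [add_mul]; omega] at this
  have down' : ∀ S : Finset ℕ, (∀ b ∈ S, e ≤ b → b - e ∈ S) → ∀ v b, v ≤ b → v ≡ b [MOD e] →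
      b ∈ S → v ∈ S := by
    intro S hS v b hvb hmod hb
    obtain ⟨k, hk⟩ := (Nat.modEq_iff_dvd' hvb).1 hmod
    refine down S hS k v ?_
    rwa [mul_comm, ← hk, Nat.add_sub_cancel' hvb]
  have key : ∀ S S' : Finset ℕ, (∀ b ∈ S, e ≤ b → b - e ∈ S) → (∀ b ∈ S', e ≤ b → b - e ∈ S') →
      resCount e S = resCount e S' → ∀ b ∈ S, b ∈ S' := by
    intro S S' hS hS' h b hb
    by_contra hb'
    have h1 : S'.filter (fun v => v ≡ b [MOD e]) ⊂ S.filter fun v => v ≡ b [MOD e] := by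
      refine (Finset.ssubset_iff_of_subset fun v hv => ?_).2
        ⟨b, Finset.mem_filter.2 ⟨hb, rfl⟩, by simp [hb']⟩
      rw [Finset.mem_filter] at hv ⊢
      refine ⟨down' S hS v b ?_ hv.2 hb, hv.2⟩
      by_contra hlt
      exact hb' (down' S' hS' b v (by omega) hv.2.symm hv.1)
    have h2 := Finset.card_lt_card h1
    have h3 := congrFun h b
    unfold resCount at h3
    omega
  ext b
  exact ⟨key S S' hS hS' h b, key S' S hS' hS h.symm b⟩

end BeadSet

namespace YoungDiagram

open BeadSet

section

variable {N e : ℕ} {μ ν γ : YoungDiagram}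

theorem colLen_le_of_cells_subset (h : ν.cells ⊆ μ.cells) (j : ℕ) : ν.colLen j ≤ μ.colLen j := by
  by_contra h1
  have h2 : (μ.colLen j, j) ∈ ν := mem_iff_lt_colLen.2 (by omega)
  have h3 : (μ.colLen j, j) ∈ μ := by rw [← mem_cells] at h2 ⊢; exact h h2
  have := mem_iff_lt_colLen.1 h3
  omega

theorem RemovesHooks.resCount_eq {k : ℕ} (h : RemovesHooks e k μ ν) (hN : μ.colLen 0 ≤ N) :
    ν.colLen 0 ≤ N ∧ resCount e (beads N μ) = resCount e (beads N ν) ∧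
      μ.card = ν.card + e * k := by
  induction h with
  | refl μ => exact ⟨hN, rfl, by simp⟩
  | @step k μ ν κ c hc hcard hν h ih =>
    obtain ⟨hb, hg, h1, ν', hν', hcells, hbeads⟩ := rimHook_remove hN hc rfl rfl
    obtain rfl : ν' = ν := by
      ext x
      rw [hcells, hν]
    obtain ⟨h2, h3, h4⟩ := ih hν'
    refine ⟨h2, ?_, ?_⟩
    · rw [← h3, hbeads, resCount_replace hb hg]
      rw [← h1, hcard]
      simp [Nat.ModEq]
    · have h5 : ν'.card + (μ.rimHook c).card = μ.card := by
        rw [YoungDiagram.card, YoungDiagram.card, hcells]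
        exact Finset.card_sdiff_add_card_eq_card (Finset.filter_subset _ _)
      rw [mul_add]
      omega

theorem exists_hasCoreAndWeight (he : 0 < e) (μ : YoungDiagram) :
    ∃ γ w, HasCoreAndWeight e μ γ w := by
  induction hn : μ.card using Nat.strong_induction_on generalizing μ with
  | _ n ih =>
    by_cases hc : μ.IsCore e
    · exact ⟨μ, 0, hc, .refl μ⟩
    · unfold IsCore at hc
      push Not at hc
      obtain ⟨c, hc, hcard⟩ := hc
      obtain ⟨-, -, -, ν, -, hcells, -⟩ := rimHook_remove (N := μ.colLen 0) le_rfl hc rfl rfl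
      have h5 : ν.card + (μ.rimHook c).card = μ.card := by
        rw [YoungDiagram.card, YoungDiagram.card, hcells]
        exact Finset.card_sdiff_add_card_eq_card (Finset.filter_subset _ _)
      obtain ⟨γ, w, h1, h2⟩ := ih ν.card (by omega) ν rfl
      exact ⟨γ, w + 1, h1, .step c hc hcard hcells h2⟩

/-- Some core is always reached, residue counts survive the removal of hooks, and they determine a
core. -/
theorem exists_hasCoreAndWeight_of_resCount (he : 0 < e) (hγ : γ.IsCore e) (hμN : μ.colLen 0 ≤ N)
    (hγN : γ.colLen 0 ≤ N) (h : resCount e (beads N μ) = resCount e (beads N γ)) :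
    ∃ w, HasCoreAndWeight e μ γ w := by
  obtain ⟨γ', w, h3, h4⟩ := exists_hasCoreAndWeight he μ
  obtain ⟨h5, h6, -⟩ := h4.resCount_eq hμN
  obtain rfl : γ' = γ := by
    refine eq_of_beads_eq h5 hγN ?_
    exact eq_of_resCount_eq ((isCore_iff h5 he).1 h3) ((isCore_iff hγN he).1 hγ)
      (h6.symm.trans h)
  exact ⟨w, h3, h4⟩

theorem HasCoreAndWeight.resCount_eq {w : ℕ} (h : HasCoreAndWeight e μ γ w)
    (hN : μ.colLen 0 ≤ N) : resCount e (beads N μ) = resCount e (beads N γ) :=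
  (RemovesHooks.resCount_eq h.2 hN).2.1

theorem HasCoreAndWeight.card_eq {w : ℕ} (h : HasCoreAndWeight e μ γ w) :
    μ.card = γ.card + e * w :=
  (RemovesHooks.resCount_eq h.2 le_rfl).2.2

/-- Adding `N - 1 - i` to both sides turns the congruence for the row `i` into one for its bead. The
empty rows are even, so they add nothing to the count. -/
theorem runnerMatrix_eq (hN : μ.colLen 0 ≤ N) (x : Fin (2 - 1)) (y : Fin e) :
    μ.runnerMatrix 2 e x y = oddCount e (beads N μ) (y + N) := by
  rw [runnerMatrix, Matrix.of_apply, oddCount]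
  refine Finset.card_bij (fun i _ => μ.rowLen i + (N - 1 - i)) ?_ ?_ ?_
  · intro i hi
    simp only [Finset.mem_filter, Finset.mem_range] at hi ⊢
    have hiN : i < N := by omega
    refine ⟨mem_beads.2 ⟨i, hiN, rfl⟩, ?_, ?_⟩
    · have := hi.2.2.add_right (N - 1 - i)
      rwa [show i + 1 + (y : ℕ) + (N - 1 - i) = y + N by omega] at this
    · rw [below_bead hiN, Nat.add_sub_cancel, Nat.odd_iff]
      have := hi.2.1
      unfold Nat.ModEq at this
      omega
  · intro i hi k hk h
    simp only [Finset.mem_filter, Finset.mem_range] at hi hk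
    exact bead_injOn (by simpa using by omega) (by simpa using by omega) h
  · intro b hb
    simp only [Finset.mem_filter] at hb
    obtain ⟨hb, h1, h2⟩ := hb
    obtain ⟨i, hi, rfl⟩ := mem_beads.1 hb
    rw [below_bead hi, Nat.add_sub_cancel] at h2
    refine ⟨i, ?_, rfl⟩
    simp only [Finset.mem_filter, Finset.mem_range]
    refine ⟨?_, ?_, ?_⟩
    · by_contra h3
      rw [rowLen_eq_zero (by omega)] at h2
      simp at h2
    · rw [Nat.odd_iff] at h2
      unfold Nat.ModEq
      omega
    · rw [show (y : ℕ) + N = i + 1 + y + (N - 1 - i) by omega] at h1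
      exact h1.add_right_cancel' _

/-! ### The dominance order -/

theorem DominatedBy.antisymm (h : μ.DominatedBy ν) (h' : ν.DominatedBy μ) : μ = ν := by
  have h1 : ∀ k, ∑ i ∈ Finset.range k, μ.rowLen i = ∑ i ∈ Finset.range k, ν.rowLen i :=
    fun k => le_antisymm (h.2 k) (h'.2 k)
  ext ⟨i, j⟩
  have h2 := h1 (i + 1)
  rw [Finset.sum_range_succ, Finset.sum_range_succ, h1 i] at h2
  rw [mem_cells, mem_cells, mem_iff_lt_rowLen, mem_iff_lt_rowLen, Nat.add_left_cancel h2]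

/-- Take for `x` the bead of index `k` of `ν`: truncation at `x` is exact on the first `k` beads of
`ν` and kills the others, while for `μ` the truncated sum bounds the untruncated one over the first
`k` beads from above. -/
theorem dominatedBy_of_beads (hμ : μ.colLen 0 ≤ N) (hν : ν.colLen 0 ≤ N)
    (hcard : μ.card = ν.card)
    (h : ∀ x, ∑ b ∈ beads N μ, (b - x) ≤ ∑ b ∈ beads N ν, (b - x)) : μ.DominatedBy ν := by
  refine ⟨hcard, fun k => ?_⟩
  rcases Nat.lt_or_ge k N with hk | hk
  · set x := ν.rowLen k + (N - 1 - k) with hx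
    have h1 := h x
    rw [sum_beads, sum_beads] at h1
    have h2 : ∑ i ∈ Finset.range N, (ν.rowLen i + (N - 1 - i) - x) =
        ∑ i ∈ Finset.range k, (ν.rowLen i + (N - 1 - i) - x) := by
      symm
      refine Finset.sum_subset (Finset.range_subset_range.2 hk.le) fun i _ hi => ?_
      have h3 := ν.rowLen_anti k i (by simpa using hi)
      have h4 : k ≤ i := by simpa using hi
      omega
    have h3 : ∑ i ∈ Finset.range k, (μ.rowLen i + (N - 1 - i) - x) ≤
        ∑ i ∈ Finset.range N, (μ.rowLen i + (N - 1 - i) - x) :=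
      Finset.sum_le_sum_of_subset (Finset.range_subset_range.2 hk.le)
    have h4 : ∑ i ∈ Finset.range k, (μ.rowLen i + (N - 1 - i)) ≤
        ∑ i ∈ Finset.range k, (μ.rowLen i + (N - 1 - i) - x + x) :=
      Finset.sum_le_sum fun i _ => by omega
    have h5 : ∑ i ∈ Finset.range k, (ν.rowLen i + (N - 1 - i)) =
        ∑ i ∈ Finset.range k, (ν.rowLen i + (N - 1 - i) - x + x) :=
      Finset.sum_congr rfl fun i hi => by
        have h6 := Finset.mem_range.1 hi
        have := ν.rowLen_anti i k h6.le
        omega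
    rw [Finset.sum_add_distrib, Finset.sum_add_distrib] at h4 h5
    omega
  · rw [← card_eq_sum_rowLen (by omega), ← card_eq_sum_rowLen (by omega), hcard]

end

end YoungDiagram

/-! ### Conjugation and dominance -/

namespace BeadSet

theorem sum_conj_sub {H x : ℕ} {T : Finset ℕ} (hT : T ⊆ Finset.range H) (hx : x < H) :
    ∑ b ∈ conj H T, (b - x) + ∑ v ∈ T, (v - (H - 1 - x)) + T.card * (H - 1 - x) =
      ∑ v ∈ Finset.range H, (H - 1 - x - v) + ∑ v ∈ T, v := by
  have h1 : ∑ b ∈ conj H T, (b - x) = ∑ v ∈ Finset.range H \ T, (H - 1 - x - v) := by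
    refine Finset.sum_bij (fun v _ => H - 1 - v) ?_ ?_ ?_ ?_
    · intro v hv
      rw [mem_conj] at hv
      simp only [Finset.mem_sdiff, Finset.mem_range]
      exact ⟨by omega, hv.2⟩
    · intro v hv w hw hvw
      rw [mem_conj] at hv hw
      omega
    · intro v hv
      simp only [Finset.mem_sdiff, Finset.mem_range] at hv
      refine ⟨H - 1 - v, (mem_conj_flip hv.1).2 hv.2, ?_⟩
      have := hv.1
      show H - 1 - (H - 1 - v) = v
      omega
    · intro v hv
      rw [mem_conj] at hv
      omega
  have h2 := Finset.sum_sdiff (f := fun v => H - 1 - x - v) hT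
  have h3 : ∑ v ∈ T, (v - (H - 1 - x)) + T.card * (H - 1 - x) =
      ∑ v ∈ T, (H - 1 - x - v) + ∑ v ∈ T, v := by
    rw [← smul_eq_mul, ← Finset.sum_const, ← Finset.sum_add_distrib, ← Finset.sum_add_distrib]
    exact Finset.sum_congr rfl fun v _ => by omega
  omega

/-- Conjugation reverses the dominance order. -/
theorem sum_conj_le {H : ℕ} {T T' : Finset ℕ} (hT : T ⊆ Finset.range H)
    (hT' : T' ⊆ Finset.range H) (hcard : T.card = T'.card) (hsum : ∑ v ∈ T, v = ∑ v ∈ T', v)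
    (h : ∀ x, ∑ v ∈ T, (v - x) ≤ ∑ v ∈ T', (v - x)) (x : ℕ) :
    ∑ v ∈ conj H T', (v - x) ≤ ∑ v ∈ conj H T, (v - x) := by
  rcases Nat.lt_or_ge x H with hx | hx
  · have h1 := sum_conj_sub hT hx
    have h2 := sum_conj_sub hT' hx
    have h3 := h (H - 1 - x)
    rw [hcard, hsum] at h1
    omega
  · rw [Finset.sum_eq_zero]
    · exact Nat.zero_le _
    · intro v hv
      have := Finset.mem_range.1 (conj_subset H _ hv)
      omega

end BeadSet

/-! ### Residues and parities -/

namespace BeadSet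

section

variable {e : ℕ} {S S' : Finset ℕ}

theorem resCount_congr {n m : ℕ} (h : n ≡ m [MOD e]) : resCount e S n = resCount e S m := by
  unfold resCount
  congr 1
  exact Finset.filter_congr fun b _ => ⟨fun h' => h'.trans h, fun h' => h'.trans h.symm⟩

theorem oddCount_congr {n m : ℕ} (h : n ≡ m [MOD e]) : oddCount e S n = oddCount e S m := by
  unfold oddCount
  congr 1
  refine Finset.filter_congr fun b _ => and_congr_left fun _ => ?_
  exact ⟨fun h' => h'.trans h, fun h' => h'.trans h.symm⟩

theorem add_self_modEq (n e : ℕ) : n + e ≡ n [MOD e] := by simp [Nat.ModEq]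

theorem exists_lt_modEq (he : 0 < e) (v n : ℕ) : ∃ k < e, v + k ≡ n [MOD e] := by
  refine ⟨(n + (e - 1) * v) % e, Nat.mod_lt _ he, ?_⟩
  calc v + (n + (e - 1) * v) % e ≡ v + (n + (e - 1) * v) [MOD e] := (Nat.mod_modEq _ _).add_left v
    _ = n + e * v := by
        obtain ⟨d, rfl⟩ : ∃ d, e = d + 1 := ⟨e - 1, by omega⟩
        rw [Nat.add_sub_cancel]; ring
    _ ≡ n [MOD e] := by simp [Nat.ModEq]

theorem oddCount_ext (he : 0 < e) {N : ℕ}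
    (h : ∀ y < e, oddCount e S (y + N) = oddCount e S' (y + N)) : oddCount e S = oddCount e S' := by
  ext n
  obtain ⟨k, hk, hn⟩ := exists_lt_modEq he N n
  rw [← oddCount_congr hn, ← oddCount_congr hn, add_comm, h k hk]

theorem card_eq_sum_resCount (he : 0 < e) (S : Finset ℕ) :
    S.card = ∑ r ∈ Finset.range e, resCount e S r := by
  rw [Finset.card_eq_sum_card_fiberwise (f := fun b => b % e) (t := Finset.range e)]
  · refine Finset.sum_congr rfl fun r hr => ?_
    rw [resCount]
    congr 1
    refine Finset.filter_congr fun b _ => ?_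
    rw [Nat.ModEq, Nat.mod_eq_of_lt (Finset.mem_range.1 hr)]
  · intro b _
    simpa using Nat.mod_lt b he

/-- As `e` is odd, a node is a residue mod `e` and a parity, and modulo `2` the node `v + e * below
S v` is the number of gaps below `v`. -/
theorem node_one_eq_iff (hodd : Odd e) (v n : ℕ) : node e 1 S v = (n : ZMod (2 * e)) ↔
    v ≡ n [MOD e] ∧ (Odd (v - below S v) ↔ Odd n) := by
  have h1 : node e 1 S v = ((v + e * below S v : ℕ) : ZMod (2 * e)) := by
    rw [node]; push_cast; ring
  rw [h1, ZMod.natCast_eq_natCast_iff,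
    ← Nat.modEq_and_modEq_iff_modEq_mul (Nat.coprime_two_left.2 hodd), and_comm]
  have h2 := below_le S v
  refine and_congr (by simp [Nat.ModEq]) ?_
  obtain ⟨m, rfl⟩ := hodd
  rw [Nat.odd_iff, Nat.odd_iff, Nat.ModEq,
    show v + (2 * m + 1) * below S v = (v - below S v) + 2 * (below S v + m * below S v) by
      rw [mul_add, add_mul, mul_assoc]; omega]
  omega

theorem beadCount_of_odd (hodd : Odd e) {n : ℕ} (hn : Odd n) :
    beadCount e 1 S n = oddCount e S n := by
  unfold beadCount oddCount
  congr 1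
  refine Finset.filter_congr fun b _ => ?_
  rw [node_one_eq_iff hodd]
  simp [hn]

theorem beadCount_of_even (hodd : Odd e) {n : ℕ} (hn : ¬ Odd n) :
    beadCount e 1 S n + oddCount e S n = resCount e S n := by
  have h1 : beadCount e 1 S n = ((S.filter fun b => b ≡ n [MOD e]).filter fun b =>
      ¬ Odd (b - below S b)).card := by
    rw [beadCount, Finset.filter_filter]
    congr 1
    refine Finset.filter_congr fun b _ => ?_
    rw [node_one_eq_iff hodd]
    simp [hn]
  have h2 : oddCount e S n = ((S.filter fun b => b ≡ n [MOD e]).filter fun b =>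
      Odd (b - below S b)).card := by
    rw [oddCount, Finset.filter_filter]
  rw [h1, h2, resCount, add_comm]
  exact Finset.card_filter_add_card_filter_not _

/-- Over each residue lie one odd and one even node, `n` and `n + e` in some order. The odd one
counts the odd parts, the even one the rest of the residue class. -/
theorem beadCount_eq_iff (he : 0 < e) (hodd : Odd e) : beadCount e 1 S = beadCount e 1 S' ↔
    resCount e S = resCount e S' ∧ oddCount e S = oddCount e S' := by
  have hpar : ∀ n, Odd (n + e) ↔ ¬ Odd n := fun n => by
    rw [Nat.odd_add]; simp [hodd, ← Nat.not_odd_iff_even]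
  constructor
  · intro h
    have h1 : oddCount e S = oddCount e S' := by
      ext n
      by_cases hn : Odd n
      · rw [← beadCount_of_odd hodd hn, h, beadCount_of_odd hodd hn]
      · have hn' := (hpar n).2 hn
        rw [← oddCount_congr (add_self_modEq n e), ← beadCount_of_odd hodd hn', h,
          beadCount_of_odd hodd hn', oddCount_congr (add_self_modEq n e)]
    have h2 : ∀ n, ¬ Odd n → resCount e S n = resCount e S' n := fun n hn => by
      rw [← beadCount_of_even hodd hn, ← beadCount_of_even hodd hn, h, h1]
    refine ⟨?_, h1⟩
    ext n
    by_cases hn : Odd n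
    · rw [← resCount_congr (add_self_modEq n e), h2 _ (by rw [hpar]; simpa using hn),
        resCount_congr (add_self_modEq n e)]
    · exact h2 n hn
  · rintro ⟨h1, h2⟩
    have : NeZero (2 * e) := ⟨by omega⟩
    ext w
    rw [← ZMod.natCast_zmod_val w]
    by_cases hn : Odd w.val
    · rw [beadCount_of_odd hodd hn, beadCount_of_odd hodd hn, h2]
    · have h3 := beadCount_of_even (S := S) hodd hn
      have h4 := beadCount_of_even (S := S') hodd hn
      rw [h1, h2] at h3
      omega

/-- Any numbers of beads at the nodes can be prescribed. -/
theorem exists_beadCount_eq (he : 0 < e) (β : ZMod (2 * e) → ℕ) :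
    ∃ S : Finset ℕ, beadCount e 1 S = β := by
  have : NeZero (2 * e) := ⟨by omega⟩
  induction hn : ∑ w, β w generalizing β with
  | zero =>
    refine ⟨∅, funext fun w => ?_⟩
    have := (Finset.sum_eq_zero_iff.1 hn) w (Finset.mem_univ _)
    simp [beadCount, this]
  | succ n ih =>
    obtain ⟨w0, hw0⟩ : ∃ w, 0 < β w := by
      by_contra h
      push Not at h
      rw [Finset.sum_eq_zero fun w _ => by have := h w; omega] at hn
      omega
    obtain ⟨S, hS⟩ := ih (Function.update β w0 (β w0 - 1)) (by
      have h1 := Finset.add_sum_erase Finset.univ β (Finset.mem_univ w0)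
      have h2 := Finset.add_sum_erase Finset.univ (Function.update β w0 (β w0 - 1))
        (Finset.mem_univ w0)
      rw [Finset.sum_congr rfl (g := fun w => β w) fun w hw => Function.update_of_ne
        (Finset.ne_of_mem_erase hw) _ _, Function.update_self] at h2
      omega)
    -- A position above all of `S` whose node is `w0`; beads already present keep their nodes.
    set v := (w0 - e * S.card).val + 2 * e * (S.sup id + 1) with hv
    have hlt : ∀ b ∈ S, b < v := by
      intro b hb
      have h1 := Finset.le_sup (f := id) hb
      simp only [id] at h1
      have : S.sup id + 1 ≤ 2 * e * (S.sup id + 1) := Nat.le_mul_of_pos_left _ (by omega)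
      omega
    have hvS : v ∉ S := fun h => lt_irrefl _ (hlt v h)
    have hlow : ∀ u ≤ v, node e 1 (insert v S) u = node e 1 S u := fun u hu =>
      node_congr fun x hx => by
        rw [Finset.mem_insert]; exact ⟨fun h => h.resolve_left (by omega), Or.inr⟩
    have hnv : node e 1 S v = w0 := by
      rw [node, below_eq_card hlt, hv]
      have := ZMod.natCast_self (2 * e)
      push_cast at this ⊢
      rw [ZMod.natCast_zmod_val]
      linear_combination ((S.sup id : ℕ) + 1 : ZMod (2 * e)) * this
    refine ⟨insert v S, funext fun w => ?_⟩
    have h1 : (insert v S).filter (fun u => node e 1 (insert v S) u = w) =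
        (insert v S).filter fun u => node e 1 S u = w := by
      refine Finset.filter_congr fun u hu => ?_
      rw [hlow]
      rcases Finset.mem_insert.1 hu with h | h
      · exact h.le
      · exact (hlt u h).le
    have h2 := congrFun hS w
    rw [beadCount, h1, Finset.filter_insert, hnv]
    unfold beadCount at h2
    by_cases hw : w0 = w
    · subst hw
      rw [if_pos rfl, Finset.card_insert_of_notMem (by simp [hvS]), h2, Function.update_self]
      omega
    · rw [if_neg hw, h2, Function.update_of_ne (Ne.symm hw)]

theorem sum_sq_le (S : Finset ℕ) : ∑ v ∈ S, v ^ 2 ≤ (∑ v ∈ S, v) ^ 2 := by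
  rw [pow_two (∑ v ∈ S, v), Finset.sum_mul]
  refine Finset.sum_le_sum fun v hv => ?_
  rw [pow_two]
  exact Nat.mul_le_mul_left v (Finset.single_le_sum (f := fun v => v) (fun _ _ => Nat.zero_le _) hv)

/-- Improving step by step leads to a good set of beads. -/
theorem exists_good {a : ZMod (2 * e)} {C : Finset ℕ → Prop}
    (hC : ∀ S, C S → ¬ Good e a S → ∃ S2, C S2 ∧ ∑ v ∈ S2, v = ∑ v ∈ S, v ∧
      (∀ x, ∑ v ∈ S, (v - x) ≤ ∑ v ∈ S2, (v - x)) ∧ ∑ v ∈ S, v ^ 2 < ∑ v ∈ S2, v ^ 2)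
    (h : C S) : ∃ S', C S' ∧ Good e a S' ∧ ∀ x, ∑ v ∈ S, (v - x) ≤ ∑ v ∈ S', (v - x) := by
  -- The sum stays fixed while the sum of squares grows and is bounded by the square of the sum, so
  -- the improvement stops.
  induction hn : (∑ v ∈ S, v) ^ 2 - ∑ v ∈ S, v ^ 2 using Nat.strong_induction_on generalizing S with
  | _ n ih =>
    by_cases hg : Good e a S
    · exact ⟨S, h, hg, fun _ => le_rfl⟩
    · obtain ⟨S2, h1, h2, h3, h4⟩ := hC S h hg
      have h5 := sum_sq_le S2
      obtain ⟨S', h6, h7, h8⟩ := ih _ (by rw [h2] at h5; rw [← hn, h2]; omega) h1 rfl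
      exact ⟨S', h6, h7, fun x => (h3 x).trans (h8 x)⟩

theorem below_of_le_firstGap {n : ℕ} (h : n ≤ firstGap S) : below S n = n := by
  rw [below_congr (S' := Finset.range n) fun w hw => by
    simp [hw, mem_of_lt_firstGap (show w < firstGap S by omega)],
    below_eq_card fun b hb => Finset.mem_range.1 hb, Finset.card_range]

end

end BeadSet

/-! ### The sets `E_R(γ)` -/

namespace YoungDiagram

open BeadSet

section

variable {e N n : ℕ} {β : ZMod (2 * e) → ℕ} {E : Set YoungDiagram}

/-- The partitions of `n` with prescribed numbers of beads at the nodes, where `n` is minimal. -/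
structure IsMinimalClass (e N n : ℕ) (β : ZMod (2 * e) → ℕ) (E : Set YoungDiagram) : Prop where
  le : n + e ≤ N
  mem_iff : ∀ μ : YoungDiagram, μ ∈ E ↔ μ.colLen 0 ≤ N ∧ beadCount e 1 (beads N μ) = β ∧ μ.card = n
  minimal : ∀ μ : YoungDiagram, μ.colLen 0 ≤ N → beadCount e 1 (beads N μ) = β → n ≤ μ.card
  nonempty : E.Nonempty
  exists_zero : ∃ y, ∀ S, beadCount e 1 S = β → oddCount e S y = 0

theorem mem_beads_of_lt {μ : YoungDiagram} {v : ℕ} (hv : v + μ.colLen 0 < N) : v ∈ beads N μ := by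
  refine mem_beads.2 ⟨N - 1 - v, by omega, ?_⟩
  rw [rowLen_eq_zero (by omega)]
  omega

/-- With enough extra beads every residue class of the core holds at least as many beads as any
entry of `R`. The odd nodes then receive the entries and the even nodes the remaining beads of the
class. -/
theorem exists_hasCoreAndWeight_runnerMatrix (he : 1 < e) (hodd : Odd e) {γ : YoungDiagram}
    (hγ : γ.IsCore e) (R : Matrix (Fin (2 - 1)) (Fin e) ℕ) :
    ∃ w, ∃ μ : YoungDiagram, HasCoreAndWeight e μ γ w ∧ μ.runnerMatrix 2 e = R := by
  have : NeZero (2 * e) := ⟨by omega⟩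
  obtain ⟨M, hM⟩ : ∃ M, ∀ y, R 0 y ≤ M :=
    ⟨∑ y, R 0 y, fun y => Finset.single_le_sum (fun _ _ => Nat.zero_le _) (Finset.mem_univ y)⟩
  set N := γ.colLen 0 + e * (M + 1) with hN
  set B := beads N γ with hB
  have hlarge : ∀ m, M ≤ resCount e B m := by
    intro m
    have h1 : (Finset.range M).image (fun k => m % e + e * k) ⊆
        B.filter fun b => b ≡ m [MOD e] := by
      intro b hb
      obtain ⟨k, hk, rfl⟩ := Finset.mem_image.1 hb
      have hk := Finset.mem_range.1 hk
      have h2 := Nat.mod_lt m (show e > 0 by omega)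
      have h3 : e * (k + 1) ≤ e * M := Nat.mul_le_mul_left e hk
      rw [mul_add] at h3 hN
      refine Finset.mem_filter.2 ⟨mem_beads_of_lt (by omega), ?_⟩
      simp [Nat.ModEq]
    have h2 := Finset.card_le_card h1
    rwa [Finset.card_image_of_injective, Finset.card_range] at h2
    intro k k' h
    exact Nat.eq_of_mul_eq_mul_left (show 0 < e by omega) (Nat.add_left_cancel h)
  -- The summand `(e - 1) * N` stands for `-N` mod `e` and undoes the shift in `runnerMatrix_eq`.
  let ρ : ℕ → ℕ := fun m => R 0 ⟨(m + (e - 1) * N) % e, Nat.mod_lt _ (by omega)⟩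
  have hρ : ∀ m m', m ≡ m' [MOD e] → ρ m = ρ m' := by
    intro m m' h
    have h1 : (m + (e - 1) * N) % e = (m' + (e - 1) * N) % e := h.add_right _
    simp only [ρ, h1]
  have hρM : ∀ m, ρ m ≤ resCount e B m := fun m => (hM _).trans (hlarge m)
  obtain ⟨S, hS⟩ := exists_beadCount_eq (e := e) (by omega) fun w =>
    if Odd w.val then ρ w.val else resCount e B w.val - ρ w.val
  have hβ : ∀ m : ℕ, beadCount e 1 S m = if Odd m then ρ m else resCount e B m - ρ m := by
    intro m
    rw [hS]
    beta_reduce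
    rw [ZMod.val_natCast]
    have h1 : m % (2 * e) ≡ m [MOD e] := (Nat.mod_modEq m (2 * e)).of_mul_left 2
    have h2 : Odd (m % (2 * e)) ↔ Odd m := by
      rw [Nat.odd_iff, Nat.odd_iff, Nat.mod_mod_of_dvd _ (dvd_mul_right 2 e)]
    simp only [h2, hρ _ _ h1, resCount_congr h1]
  have hpar : ∀ m, Odd (m + e) ↔ ¬ Odd m := fun m => by
    rw [Nat.odd_add]; simp [hodd, ← Nat.not_odd_iff_even]
  have hoc : ∀ m, oddCount e S m = ρ m := by
    intro m
    by_cases hm : Odd m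
    · rw [← beadCount_of_odd hodd hm, hβ, if_pos hm]
    · have hm' := (hpar m).2 hm
      rw [← oddCount_congr (add_self_modEq m e), ← beadCount_of_odd hodd hm', hβ, if_pos hm',
        hρ _ _ (add_self_modEq m e)]
  have hrc' : ∀ m, ¬ Odd m → resCount e S m = resCount e B m := by
    intro m hm
    rw [← beadCount_of_even hodd hm, hoc, hβ, if_neg hm]
    have := hρM m
    omega
  have hrc : resCount e S = resCount e B := by
    ext m
    by_cases hm : Odd m
    · rw [← resCount_congr (add_self_modEq m e), hrc' _ (by rw [hpar]; simpa using hm),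
        resCount_congr (add_self_modEq m e)]
    · exact hrc' m hm
  have hcard : S.card = N := by
    rw [card_eq_sum_resCount (show 0 < e by omega), hrc, ← card_eq_sum_resCount (by omega), hB,
      card_beads]
  obtain ⟨μ, h1, h2⟩ := exists_beads_eq S
  rw [hcard] at h1 h2
  obtain ⟨w, hw⟩ := exists_hasCoreAndWeight_of_resCount (μ := μ) (by omega) hγ h1
    (show γ.colLen 0 ≤ N by omega) (by rw [h2, hrc])
  refine ⟨w, μ, hw, ?_⟩
  ext x y
  rw [runnerMatrix_eq h1, h2, hoc, show x = 0 from Fin.ext (by omega)]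
  simp only [ρ]
  congr 1
  ext
  obtain ⟨d, rfl⟩ : ∃ d, e = d + 1 := ⟨e - 1, by omega⟩
  simp only [Nat.add_sub_cancel]
  rw [show (y : ℕ) + N + d * N = y + (d + 1) * N by ring, Nat.add_mul_mod_self_left,
    Nat.mod_eq_of_lt y.2]

/-- For a fixed core, minimal weight means minimal size. The choice `N = n + e` leaves `e` beads
below the first gap of every member, as the analysis of the `e`-rim requires. -/
theorem exists_isMinimalClass (he : 1 < e) (hodd : Odd e) {γ : YoungDiagram} (hγ : γ.IsCore e)
    (R : Matrix (Fin (2 - 1)) (Fin e) ℕ) (hR : ∃ y : Fin e, R 0 y = 0) :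
    ∃ N n β, IsMinimalClass e N n β (minWeightSet 2 e γ R) := by
  obtain ⟨μ₀, h0, h0'⟩ : minWeight 2 e γ R ∈
      {w | ∃ μ : YoungDiagram, HasCoreAndWeight e μ γ w ∧ μ.runnerMatrix 2 e = R} :=
    Nat.sInf_mem (exists_hasCoreAndWeight_runnerMatrix he hodd hγ R)
  set n := γ.card + e * minWeight 2 e γ R with hn
  set N := n + e with hN
  have hγN : γ.colLen 0 ≤ N := (γ.colLen_le_card 0).trans (by omega)
  have h0N : μ₀.colLen 0 ≤ N := (μ₀.colLen_le_card 0).trans (by rw [h0.card_eq]; omega)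
  have hclass : ∀ μ : YoungDiagram, μ.colLen 0 ≤ N →
      beadCount e 1 (beads N μ) = beadCount e 1 (beads N μ₀) →
      ∃ w, HasCoreAndWeight e μ γ w ∧ μ.runnerMatrix 2 e = R := by
    intro μ hμ h
    rw [beadCount_eq_iff (by omega) hodd] at h
    obtain ⟨w, hw⟩ := exists_hasCoreAndWeight_of_resCount (by omega) hγ hμ hγN
      (h.1.trans (h0.resCount_eq h0N))
    refine ⟨w, hw, ?_⟩
    rw [← h0']
    ext x y
    rw [runnerMatrix_eq hμ, runnerMatrix_eq h0N, h.2]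
  refine ⟨N, n, beadCount e 1 (beads N μ₀), le_rfl, fun μ => ⟨?_, ?_⟩, ?_, ⟨μ₀, h0, h0'⟩, ?_⟩
  · rintro ⟨h1, h2⟩
    have hμ : μ.colLen 0 ≤ N := (μ.colLen_le_card 0).trans (by rw [h1.card_eq]; omega)
    refine ⟨hμ, ?_, h1.card_eq⟩
    rw [beadCount_eq_iff (by omega) hodd]
    refine ⟨(h1.resCount_eq hμ).trans (h0.resCount_eq h0N).symm, ?_⟩
    refine oddCount_ext (N := N) (by omega) fun y hy => ?_
    rw [← runnerMatrix_eq hμ 0 ⟨y, hy⟩, ← runnerMatrix_eq h0N 0 ⟨y, hy⟩, h2, h0']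
  · rintro ⟨h1, h2, h3⟩
    obtain ⟨w, hw, hw'⟩ := hclass μ h1 h2
    have h4 := hw.card_eq
    have h5 : w = minWeight 2 e γ R :=
      Nat.eq_of_mul_eq_mul_left (show 0 < e by omega) (by omega)
    exact ⟨h5 ▸ hw, hw'⟩
  · intro μ h1 h2
    obtain ⟨w, hw, hw'⟩ := hclass μ h1 h2
    have h5 : minWeight 2 e γ R ≤ w := Nat.sInf_le ⟨μ, hw, hw'⟩
    have := Nat.mul_le_mul_left e h5
    rw [hw.card_eq]
    omega
  · obtain ⟨y, hy⟩ := hR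
    refine ⟨y + N, fun S hS => ?_⟩
    rw [beadCount_eq_iff (by omega) hodd] at hS
    rw [hS.2, ← runnerMatrix_eq h0N 0 y, h0', hy]

theorem card_eq_of_beadCount_eq {a : ZMod (2 * e)} (he : 0 < e) {S S' : Finset ℕ}
    (h : beadCount e a S = beadCount e a S') : S.card = S'.card := by
  have : NeZero (2 * e) := ⟨by omega⟩
  rw [card_eq_sum_beadCount (e := e) a S, card_eq_sum_beadCount (e := e) a S', h]

theorem IsMinimalClass.exists_eq_beads (h : IsMinimalClass e N n β E) (he : 0 < e) {S : Finset ℕ}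
    (hS : beadCount e 1 S = β) : ∃ μ : YoungDiagram, μ.colLen 0 ≤ N ∧ beads N μ = S ∧ n ≤ μ.card ∧
      ∑ v ∈ S, v = μ.card + ∑ i ∈ Finset.range N, i := by
  obtain ⟨μ₀, hμ₀⟩ := h.nonempty
  obtain ⟨h1, h2, h3⟩ := (h.mem_iff μ₀).1 hμ₀
  have hcard := card_eq_of_beadCount_eq he (hS.trans h2.symm)
  rw [card_beads] at hcard
  obtain ⟨μ, h4, h5⟩ := exists_beads_eq S
  rw [hcard] at h4 h5
  exact ⟨μ, h4, h5, h.minimal μ h4 (by rw [h5, hS]), by rw [← h5, sum_beads_eq h4]⟩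

/-- The maximal element of the class. -/
theorem IsMinimalClass.exists_max (h : IsMinimalClass e N n β E) (he : 0 < e) :
    ∃ lam ∈ E, Good e 1 (beads N lam) ∧ ∀ ν ∈ E, ν.DominatedBy lam := by
  have hC : ∀ S, (beadCount e 1 S = β ∧ ∑ v ∈ S, v = n + ∑ i ∈ Finset.range N, i) →
      ¬ Good e 1 S → ∃ S2, (beadCount e 1 S2 = β ∧ ∑ v ∈ S2, v = n + ∑ i ∈ Finset.range N, i) ∧
      ∑ v ∈ S2, v = ∑ v ∈ S, v ∧ (∀ x, ∑ v ∈ S, (v - x) ≤ ∑ v ∈ S2, (v - x)) ∧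
      ∑ v ∈ S, v ^ 2 < ∑ v ∈ S2, v ^ 2 := by
    rintro S ⟨h1, h2⟩ hg
    have hmin : ∀ S2, beadCount e 1 S2 = beadCount e 1 S → ∑ v ∈ S, v ≤ ∑ v ∈ S2, v := by
      intro S2 hS2
      obtain ⟨μ, -, -, h3, h4⟩ := h.exists_eq_beads he (hS2.trans h1)
      omega
    rcases exists_exchange (isStep_one e) hg with ⟨p, b, -, -, -, S2, h3, h4⟩ | ⟨S2, h3, -, h4⟩
    · have := hmin S2 h3; omega
    · rcases h4 with h4 | ⟨h4, h5, h6⟩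
      · have := hmin S2 h3; omega
      · exact ⟨S2, ⟨h3.trans h1, h4.trans h2⟩, h4, h5, h6⟩
  have hex : ∀ ν ∈ E, ∃ lam ∈ E, Good e 1 (beads N lam) ∧ ν.DominatedBy lam := by
    intro ν hν
    obtain ⟨h1, h2, h3⟩ := (h.mem_iff ν).1 hν
    obtain ⟨S', ⟨h4, h5⟩, h6, h7⟩ := exists_good hC (S := beads N ν)
      ⟨h2, by rw [sum_beads_eq h1, h3]⟩
    obtain ⟨lam, h8, rfl, -, h9⟩ := h.exists_eq_beads he h4
    have hcard : lam.card = n := by omega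
    exact ⟨lam, (h.mem_iff lam).2 ⟨h8, h4, hcard⟩, h6,
      dominatedBy_of_beads h1 h8 (by omega) h7⟩
  obtain ⟨ν₀, hν₀⟩ := h.nonempty
  obtain ⟨lam, h1, h2, -⟩ := hex ν₀ hν₀
  refine ⟨lam, h1, h2, fun ν hν => ?_⟩
  obtain ⟨lam', h3, h4, h5⟩ := hex ν hν
  have h6 := (h.mem_iff lam).1 h1
  have h7 := (h.mem_iff lam').1 h3
  -- Every member climbs to some good one, and there is only one with these bead counts.
  rwa [eq_of_beads_eq h6.1 h7.1 (h2.eq_of_beadCount h4 (h6.2.1.trans h7.2.1.symm))]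

/-- A single bead above `e` gaps gives all residues an odd part in the conjugate. -/
theorem oddCount_conj_pos (he : 0 < e) {H p b : ℕ} {T : Finset ℕ} (hT : T ⊆ Finset.range H)
    (hpb : p + e ≤ b) (hb : b ∈ T) (hone : ∀ v ∈ T, p ≤ v → v = b) (y : ℕ) :
    0 < oddCount e (conj H T) y := by
  have hbH := Finset.mem_range.1 (hT hb)
  obtain ⟨k, hk, hy⟩ := exists_lt_modEq he (H - p - e) y
  -- After reflection, the `e` positions just above `p` are consecutive beads with exactly one gap
  -- below them, the image of `b`.
  set u := H - p - e + k with hu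
  refine Finset.card_pos.2 ⟨u, Finset.mem_filter.2 ⟨?_, hy, ?_⟩⟩
  · rw [mem_conj]
    refine ⟨by omega, fun h => ?_⟩
    have := hone _ h (by omega)
    omega
  · have h1 : (conj H T).filter (· < u) = (Finset.range u).erase (H - 1 - b) := by
      ext v
      simp only [Finset.mem_filter, mem_conj, Finset.mem_erase, Finset.mem_range]
      constructor
      · rintro ⟨⟨h1, h2⟩, h3⟩
        refine ⟨fun h4 => h2 ?_, h3⟩
        rwa [h4, show H - 1 - (H - 1 - b) = b by omega]
      · rintro ⟨h1, h2⟩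
        refine ⟨⟨by omega, fun h3 => ?_⟩, h2⟩
        have := hone _ h3 (by omega)
        omega
    rw [below, h1, Finset.card_erase_of_mem (by rw [Finset.mem_range]; omega), Finset.card_range,
      show u - (u - 1) = 1 by omega]
    exact odd_one

/-- The conjugate of the minimal element of the class. -/
theorem IsMinimalClass.exists_min (h : IsMinimalClass e N n β E) (he : 0 < e) :
    ∃ kap : YoungDiagram, kap.transpose ∈ E ∧ Good e (1 + e) (beads N kap) ∧
      ∀ ν ∈ E, kap.transpose.DominatedBy ν := by
  have hle := h.le
  obtain ⟨ν₀, hν₀⟩ := h.nonempty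
  obtain ⟨h₀N, h₀β, h₀n⟩ := (h.mem_iff ν₀).1 hν₀
  have hsub : ∀ μ : YoungDiagram, μ.card = n → beads N μ ⊆ Finset.range (N + N) := fun μ hμ =>
    beads_subset (by have := μ.rowLen_le_card 0; omega)
  set H := N + N with hH
  have hstep : IsStep e (1 + e : ZMod (2 * e)) := (isStep_one e).add
  -- the class of the conjugates
  let C : Finset ℕ → Prop := fun T => T ⊆ Finset.range H ∧
    SameData e (1 + e) H T (conj H (beads N ν₀)) ∧ ∑ v ∈ T, v = n + ∑ i ∈ Finset.range N, i
  have hβ : ∀ T, T ⊆ Finset.range H → SameData e (1 + e) H T (conj H (beads N ν₀)) →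
      beadCount e 1 (conj H T) = β := by
    intro T hT hd
    have := (hd.conj hT (conj_subset _ _)).2.1
    rwa [one_add_e_add_e, conj_conj (hsub ν₀ h₀n), h₀β] at this
  have hcardT : ∀ T, T ⊆ Finset.range H → SameData e (1 + e) H T (conj H (beads N ν₀)) →
      T.card = N := by
    intro T hT hd
    have h1 := card_conj (hsub ν₀ h₀n)
    rw [card_beads, ← hd.1] at h1
    omega
  -- the bead set of a conjugate
  have hback : ∀ T, C T → ∃ kap : YoungDiagram, beads N kap = T ∧ kap.transpose ∈ E := by
    rintro T ⟨h1, h2, h3⟩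
    obtain ⟨kap, h4, h5⟩ := exists_beads_eq T
    rw [hcardT T h1 h2] at h4 h5
    have h6 := sum_beads_eq h4
    rw [h5, h3] at h6
    have hcard : kap.card = n := by omega
    refine ⟨kap, h5, (h.mem_iff _).2 ⟨?_, ?_, ?_⟩⟩
    · rw [colLen_transpose]
      have := kap.rowLen_le_card 0
      omega
    · rw [beads_transpose h4 (by have := kap.rowLen_le_card 0; omega), h5]
      exact hβ T h1 h2
    · rw [card_transpose, hcard]
  have hfwd : ∀ ν ∈ E, C (beads N ν.transpose) := by
    intro ν hν
    obtain ⟨h1, h2, h3⟩ := (h.mem_iff ν).1 hν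
    have h4 : ν.rowLen 0 ≤ N := (ν.rowLen_le_card 0).trans (by omega)
    refine ⟨hsub _ (by rw [card_transpose, h3]), ?_, ?_⟩
    · rw [beads_transpose h1 h4]
      exact (sameData_of_beadCount he (hsub ν h3) (hsub ν₀ h₀n) (h2.trans h₀β.symm)).conj
        (hsub ν h3) (hsub ν₀ h₀n)
    · rw [sum_beads_eq (by rwa [colLen_transpose]), card_transpose, h3]
  have hC : ∀ T, C T → ¬ Good e (1 + e) T → ∃ T2, C T2 ∧ ∑ v ∈ T2, v = ∑ v ∈ T, v ∧
      (∀ x, ∑ v ∈ T, (v - x) ≤ ∑ v ∈ T2, (v - x)) ∧ ∑ v ∈ T, v ^ 2 < ∑ v ∈ T2, v ^ 2 := by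
    rintro T ⟨h1, h2, h3⟩ hg
    rcases exists_exchange hstep hg with ⟨p, b, h4, h5, h6, -⟩ | ⟨T2, h4, h5, h6⟩
    -- The lone bead is the one obstruction, and the zero entry removes it.
    · obtain ⟨y, hy⟩ := h.exists_zero
      have := oddCount_conj_pos he h1 h4 h5 h6 y
      rw [hy _ (hβ T h1 h2)] at this
      omega
    · have hcard2 : T2.card = N := by
        rw [card_eq_of_beadCount_eq he h4, hcardT T h1 h2]
      obtain ⟨kap, h7, h8⟩ := exists_beads_eq T2
      rw [hcard2] at h7 h8
      have h9 := sum_beads_eq h7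
      rw [h8] at h9
      have hle2 : ∑ v ∈ T2, v ≤ ∑ v ∈ T, v := by omega
      have hsub2 : T2 ⊆ Finset.range H := by
        rw [← h8]
        exact beads_subset (by have := kap.rowLen_le_card 0; omega)
      have hd2 : SameData e (1 + e) H T2 (conj H (beads N ν₀)) :=
        ⟨by rw [hcard2, ← h2.1, hcardT T h1 h2], h4.trans h2.2.1, by
          ext w
          rw [h5 H h1 hsub2, h2.2.2]⟩
      have hmin : n ≤ kap.card := by
        rw [← card_transpose]
        refine h.minimal _ ?_ ?_
        · rw [colLen_transpose]
          have := kap.rowLen_le_card 0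
          omega
        · rw [beads_transpose h7 (by have := kap.rowLen_le_card 0; omega), h8]
          exact hβ T2 hsub2 hd2
      rcases h6 with h6 | ⟨h6, h10, h11⟩
      · omega
      · exact ⟨T2, ⟨hsub2, hd2, h6.trans h3⟩, h6, h10, h11⟩
  have hex : ∀ ν ∈ E, ∃ kap : YoungDiagram, kap.transpose ∈ E ∧ Good e (1 + e) (beads N kap) ∧
      C (beads N kap) ∧ kap.transpose.DominatedBy ν := by
    intro ν hν
    obtain ⟨T, h1, h2, h3⟩ := exists_good hC (hfwd ν hν)
    obtain ⟨kap, rfl, h4⟩ := hback T h1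
    refine ⟨kap, h4, h2, h1, ?_⟩
    have h5 := (h.mem_iff ν).1 hν
    have h6 := (h.mem_iff _).1 h4
    refine dominatedBy_of_beads h6.1 h5.1 (by omega) fun x => ?_
    have h7 := sum_conj_le (hfwd ν hν).1 h1.1 (by rw [card_beads, card_beads])
      ((hfwd ν hν).2.2.trans h1.2.2.symm) h3 x
    have h8 : ν.rowLen 0 ≤ N := (ν.rowLen_le_card 0).trans (by omega)
    have h9 : kap.colLen 0 ≤ N := by
      have h10 := kap.transpose.rowLen_le_card 0
      rw [rowLen_transpose] at h10
      omega
    have h10 : kap.rowLen 0 ≤ N := by rw [← colLen_transpose]; exact h6.1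
    rwa [beads_transpose h5.1 h8, conj_conj (hsub ν h5.2.2), ← beads_transpose h9 h10] at h7
  obtain ⟨kap, h1, h2, h3, -⟩ := hex ν₀ hν₀
  refine ⟨kap, h1, h2, fun ν hν => ?_⟩
  obtain ⟨kap', h4, h5, h6, h7⟩ := hex ν hν
  have hcol : ∀ kap : YoungDiagram, kap.transpose ∈ E → kap.colLen 0 ≤ N := by
    intro kap hk
    have h10 := kap.transpose.rowLen_le_card 0
    rw [rowLen_transpose, ((h.mem_iff _).1 hk).2.2] at h10
    omega
  rwa [eq_of_beads_eq (hcol kap h1) (hcol kap' h4)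
    (h2.eq_of_beadCount h5 (h3.2.1.2.1.trans h6.2.1.2.1.symm))]

/-! ### Regularity -/

/-- Equal parts are consecutive beads without gaps in between, so `e` of them meet every residue
with one and the same number of gaps below. -/
theorem exists_consecutive_of_not_isRegular (he : 0 < e) {μ : YoungDiagram} (hN : μ.colLen 0 ≤ N)
    (h : ¬ μ.IsRegular e) : ∃ v a, 0 < a ∧ ∀ k < e, v + k ∈ beads N μ ∧
      v + k - below (beads N μ) (v + k) = a := by
  unfold IsRegular at h
  push Not at h
  obtain ⟨a, ha⟩ := h
  have hcount : μ.rowLens.count a =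
      ((Finset.range (μ.colLen 0)).filter fun i => a = μ.rowLen i).card := by
    have h1 : μ.rowLens.count a =
        Multiset.count a ((Finset.range (μ.colLen 0)).val.map μ.rowLen) := by
      rw [Finset.range_val, Multiset.range, Multiset.map_coe, Multiset.coe_count, rowLens]
    rw [h1, Multiset.count_map]
    rfl
  rw [hcount] at ha
  set I := (Finset.range (μ.colLen 0)).filter fun i => a = μ.rowLen i with hI
  have hne : I.Nonempty := Finset.card_pos.1 (by omega)
  have hmin := Finset.min'_mem I hne
  have hmax := Finset.max'_mem I hne
  have hsub : I ⊆ Finset.Icc (I.min' hne) (I.max' hne) := fun i hi =>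
    Finset.mem_Icc.2 ⟨Finset.min'_le I i hi, Finset.le_max' I i hi⟩
  have hc := Finset.card_le_card hsub
  rw [Nat.card_Icc] at hc
  generalize I.min' hne = i₀ at *
  generalize I.max' hne = i₁ at *
  simp only [hI, Finset.mem_filter, Finset.mem_range] at hmin hmax
  refine ⟨a + (N - 1 - (i₀ + (e - 1))), a, ?_, fun k hk => ?_⟩
  · have := mem_iff_lt_rowLen.1 (mem_iff_lt_colLen.2 hmin.1)
    omega
  · have h1 := μ.rowLen_anti i₀ (i₀ + (e - 1 - k)) (by omega)
    have h2 := μ.rowLen_anti (i₀ + (e - 1 - k)) i₁ (by omega)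
    have h3 : μ.rowLen (i₀ + (e - 1 - k)) = a := by omega
    have h4 : a + (N - 1 - (i₀ + (e - 1))) + k =
        μ.rowLen (i₀ + (e - 1 - k)) + (N - 1 - (i₀ + (e - 1 - k))) := by omega
    rw [h4, below_bead (by omega), h3]
    exact ⟨mem_beads.2 ⟨i₀ + (e - 1 - k), by omega, by rw [h3]⟩, by omega⟩

/-- If the repeated part is odd, every residue has an odd part, against the zero entry. If it is
even, one of the `e` beads has the node of the first gap, which has zero gaps below it, against
goodness. -/
theorem isRegular_of_good_one (he : 0 < e) (hodd : Odd e) {μ : YoungDiagram}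
    (hN : μ.colLen 0 ≤ N) (hg : Good e 1 (beads N μ)) {y : ℕ}
    (hy : oddCount e (beads N μ) y = 0) : μ.IsRegular e := by
  by_contra h
  obtain ⟨v, a, ha, hv⟩ := exists_consecutive_of_not_isRegular he hN h
  by_cases hpar : Odd a
  · obtain ⟨k, hk, hmod⟩ := exists_lt_modEq he v y
    have : v + k ∈ (beads N μ).filter fun b => b ≡ y [MOD e] ∧ Odd (b - below (beads N μ) b) :=
      Finset.mem_filter.2 ⟨(hv k hk).1, hmod, by rw [(hv k hk).2]; exact hpar⟩
    have := Finset.card_pos.2 ⟨_, this⟩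
    unfold oddCount at hy
    omega
  · set S := beads N μ with hS
    have h0 := hv 0 he
    rw [add_zero] at h0
    have hf : firstGap S < v := by
      by_contra h1
      have := below_of_le_firstGap (S := S) (n := v) (by omega)
      omega
    obtain ⟨k, hk, hmod⟩ := exists_lt_modEq he v (firstGap S)
    refine hg (firstGap S) (v + k) (by omega) (firstGap_notMem S) (hv k hk).1 ?_
    have h1 : node e 1 S (v + k) = ((v + k + e * below S (v + k) : ℕ) : ZMod (2 * e)) := by
      rw [node]; push_cast; ring
    have h2 := (node_one_eq_iff hodd _ _).1 h1
    rw [(hv k hk).2] at h2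
    rw [h1, node_one_eq_iff hodd, below_of_le_firstGap le_rfl, Nat.sub_self]
    exact ⟨hmod.symm.trans h2.1, by simp [← h2.2, hpar]⟩

/-- For step `1 + e` a bead is a step by `1`. From the last gap `g` before the run, one gap and `e -
1` beads add up to `2e = 0`, so the bead `g + e` has the node of `g`. -/
theorem isRegular_of_good_add (he : 0 < e) {μ : YoungDiagram} (hN : μ.colLen 0 ≤ N)
    (hg : Good e (1 + e) (beads N μ)) : μ.IsRegular e := by
  by_contra h
  obtain ⟨v, a, ha, hv⟩ := exists_consecutive_of_not_isRegular he hN h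
  set S := beads N μ with hS
  have hne : ((Finset.range v).filter (· ∉ S)).Nonempty := by
    by_contra h1
    rw [Finset.not_nonempty_iff_eq_empty, Finset.filter_eq_empty_iff] at h1
    have h2 : v ≤ firstGap S := le_firstGap fun w hw => by
      simpa using h1 (Finset.mem_range.2 hw)
    have h3 := below_of_le_firstGap h2
    have h4 := (hv 0 he).2
    rw [add_zero] at h4
    omega
  have hmax := Finset.max'_mem _ hne
  have hle : ∀ w ∈ (Finset.range v).filter (· ∉ S), w ≤ Finset.max' _ hne :=
    fun w hw => Finset.le_max' _ w hw
  generalize ((Finset.range v).filter (· ∉ S)).max' hne = g at hmax hle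
  simp only [Finset.mem_filter, Finset.mem_range] at hmax hle
  have hbeads : ∀ w, g < w → w < v + e → w ∈ S := by
    intro w h1 h2
    rcases Nat.lt_or_ge w v with h3 | h3
    · by_contra h4
      have := hle w ⟨h3, h4⟩
      omega
    · have := (hv (w - v) (by omega)).1
      rwa [Nat.add_sub_cancel' h3] at this
  refine hg g (g + e) (by omega) hmax.2 (hbeads _ (by omega) (by omega)) ?_
  have hnode : ∀ k < e, node e (1 + e) S (g + 1 + k) = node e (1 + e) S g + 1 + e + k := by
    intro k
    induction k with
    | zero => intro _; rw [add_zero, node_succ_of_notMem hmax.2]; push_cast; ring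
    | succ k ih =>
      intro hk
      rw [← add_assoc, node_succ_of_mem (hbeads _ (by omega) (by omega)), ih (by omega)]
      push_cast
      linear_combination e_add_e e
  have h1 := hnode (e - 1) (by omega)
  rw [show g + 1 + (e - 1) = g + e by omega] at h1
  rw [h1]
  push_cast [show 1 ≤ e by omega]
  linear_combination -e_add_e e

end

end YoungDiagram

/-! ### The `e`-rim -/

namespace BeadSet

/-- The positions of the boxes of the `e`-rim. -/
def rimPos (e : ℕ) (S : Finset ℕ) : ℕ → Finset ℕ
  | 0 => ∅
  | t + 1 =>
    if t ∈ S then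
      if h : 0 < e ∧ e ≤ t then Finset.Ioc (t - e) t ∪ rimPos e S (t - e + 1)
      else Finset.range (t + 1)
    else rimPos e S t
termination_by t => t

section

variable {e : ℕ} {S S' : Finset ℕ} {t : ℕ}

theorem rimPos_succ_of_notMem (h : t ∉ S) : rimPos e S (t + 1) = rimPos e S t := by
  rw [rimPos, if_neg h]

theorem rimPos_succ_of_lt (h : t ∈ S) (ht : t < e) :
    rimPos e S (t + 1) = Finset.range (t + 1) := by
  rw [rimPos, if_pos h, dif_neg (by omega)]

theorem rimPos_succ_of_le (h : t ∈ S) (he : 0 < e) (ht : e ≤ t) :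
    rimPos e S (t + 1) = Finset.Ioc (t - e) t ∪ rimPos e S (t - e + 1) := by
  rw [rimPos, if_pos h, dif_pos ⟨he, ht⟩]

theorem rimPos_subset (he : 0 < e) (t : ℕ) : rimPos e S t ⊆ Finset.range t := by
  induction t using Nat.strong_induction_on with
  | _ t ih =>
    rcases t with _ | t
    · simp [rimPos]
    by_cases hm : t ∈ S
    swap
    · rw [rimPos_succ_of_notMem hm]
      exact (ih t (by omega)).trans (Finset.range_subset_range.2 (by omega))
    rcases Nat.lt_or_ge t e with hte | hte
    · rw [rimPos_succ_of_lt hm hte]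
    · rw [rimPos_succ_of_le hm he hte]
      refine Finset.union_subset (fun v hv => ?_)
        ((ih _ (by omega)).trans (Finset.range_subset_range.2 (by omega)))
      rw [Finset.mem_Ioc] at hv
      rw [Finset.mem_range]; omega

/-- Within a segment the peeled set has caught up with `S`; elsewhere it is one bead behind. Thus
the rim positions are those where the boundary moves once the missing bead is restored at the
bottom. -/
theorem below_peel (he : 0 < e) (h0 : 0 ∈ S) (ht : 0 < t) {v : ℕ} (hv : v ≤ t) :
    below (peel e S t) v + 1 = below S v + if v ∈ rimPos e S t then 1 else 0 := by
  induction t using Nat.strong_induction_on generalizing v with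
  | _ t ih =>
    obtain ⟨t, rfl⟩ : ∃ u, t = u + 1 := ⟨t - 1, by omega⟩
    have htop : t + 1 ∉ rimPos e S (t + 1) := fun h => by simpa using rimPos_subset he _ h
    have hlast : below (peel e S (t + 1)) (t + 1) = below (peel e S (t + 1)) t :=
      below_succ_of_notMem (notMem_peel_succ he t)
    by_cases hm : t ∈ S
    swap
    · have htpos : 0 < t := Nat.pos_of_ne_zero fun h => hm (h ▸ h0)
      rcases Nat.lt_or_ge t v with h1 | h1
      · obtain rfl : v = t + 1 := by omega
        rw [if_neg htop, hlast, peel_succ_of_notMem hm, below_succ_of_notMem hm,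
          ih t (by omega) htpos le_rfl, if_neg]
        intro h; simpa using rimPos_subset he _ h
      · rw [peel_succ_of_notMem hm, rimPos_succ_of_notMem hm]
        exact ih t (by omega) htpos h1
    suffices hmain : ∀ v ≤ t, below (peel e S (t + 1)) v + 1 =
        below S v + if v ∈ rimPos e S (t + 1) then 1 else 0 by
      rcases Nat.lt_or_ge t v with h1 | h1
      · obtain rfl : v = t + 1 := by omega
        have h2 := hmain t le_rfl
        rw [if_pos] at h2
        · rw [if_neg htop, hlast, below_succ_of_mem hm, h2]
        · rcases Nat.lt_or_ge t e with hte | hte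
          · rw [rimPos_succ_of_lt hm hte]; simp
          · rw [rimPos_succ_of_le hm he hte, Finset.mem_union, Finset.mem_Ioc]
            left; omega
      · exact hmain v h1
    intro v hv
    rcases Nat.lt_or_ge t e with hte | hte
    · rw [peel_succ_of_lt hm hte, rimPos_succ_of_lt hm hte,
        below_congr fun w hw => mem_filter_lt (show w < t by omega),
        if_pos (Finset.mem_range.2 (by omega))]
    have hmem := fun w => by
      have := Finset.ext_iff.1 (peel_succ_of_le hm he hte) w
      rwa [Finset.mem_union, Finset.mem_insert, Finset.mem_filter] at this
    have hsub := peel_subset (S := S) he (t - e + 1)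
    have hlow : ∀ w < t - e, w ∈ peel e S (t + 1) ↔ w ∈ peel e S (t - e + 1) := by
      intro w hw
      rw [hmem]
      constructor
      · rintro (h | h | h)
        · omega
        · omega
        · exact h
      · exact fun h => Or.inr (Or.inr h)
    rw [rimPos_succ_of_le hm he hte]
    simp only [Finset.mem_union, Finset.mem_Ioc]
    rcases Nat.lt_or_ge (t - e) v with hu | hu
    · rw [if_pos (Or.inl ⟨hu, hv⟩)]
      congr 1
      have hkey : ∀ k, t - e + 1 + k ≤ t → below (peel e S (t + 1)) (t - e + 1 + k) =
          below S (t - e + 1 + k) := by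
        intro k
        induction k with
        | zero =>
          intro _
          have h1 := ih (t - e + 1) (by omega) (by omega) le_rfl
          rw [below_succ_of_notMem (notMem_peel_succ he _), if_neg] at h1
          · rw [add_zero, below_succ_of_mem ((hmem _).2 (Or.inr (Or.inl rfl))), below_congr hlow]
            exact h1
          · intro h; simpa using rimPos_subset he _ h
        | succ k ihk =>
          intro hk
          have h1 : t - e + 1 + k ∈ peel e S (t + 1) ↔ t - e + 1 + k ∈ S := by
            rw [hmem]
            constructor
            · rintro (h | h | h)
              · exact h.1
              · omega
              · have := Finset.mem_range.1 (hsub h); omega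
            · exact fun h => Or.inl ⟨h, by omega, by omega⟩
          rw [← add_assoc]
          by_cases h2 : t - e + 1 + k ∈ S
          · rw [below_succ_of_mem h2, below_succ_of_mem (h1.2 h2), ihk (by omega)]
          · rw [below_succ_of_notMem h2, below_succ_of_notMem fun h => h2 (h1.1 h), ihk (by omega)]
      have h1 := hkey (v - (t - e + 1)) (by omega)
      rwa [show t - e + 1 + (v - (t - e + 1)) = v by omega] at h1
    · rw [below_congr fun w hw => hlow w (by omega), ih (t - e + 1) (by omega) (by omega) (by omega)]
      congr 2
      exact propext ⟨Or.inr, fun h => h.resolve_left (by omega)⟩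

theorem card_peel (he : 0 < e) (h0 : 0 ∈ S) {H : ℕ} (hS : S ⊆ Finset.range H) :
    (peel e S H).card + 1 = S.card := by
  have hH : 0 < H := by simpa using hS h0
  obtain ⟨L, hL⟩ := exists_peel he h0 hH
  have := below_add_one_of_peel hL
  rwa [below_eq_card fun b hb => Finset.mem_range.1 (hS hb),
    below_eq_card fun b hb => Finset.mem_range.1 (hL.subset hb)] at this

theorem card_rimRemoved (he : 0 < e) (h0 : 0 ∈ S) {H : ℕ} (hS : S ⊆ Finset.range H) :
    (rimRemoved e H S).card = S.card := by
  rw [rimRemoved, Finset.card_insert_of_notMem (firstGap_notMem _), card_peel he h0 hS]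

theorem below_insert_firstGap (S : Finset ℕ) (v : ℕ) : below (insert (firstGap S) S) v =
    below S v + if firstGap S < v then 1 else 0 := by
  rw [below, below, Finset.filter_insert]
  split_ifs
  · rw [Finset.card_insert_of_notMem]
    intro h
    exact firstGap_notMem S (Finset.mem_of_mem_filter _ h)
  · rfl

theorem below_rimRemoved (he : 0 < e) (hf : e ≤ firstGap S) {H : ℕ} (hS : S ⊆ Finset.range H)
    (hH : firstGap S < H) (v : ℕ) : below (rimRemoved e H S) v = below S v +
      if v ∈ rimPos e S H ∧ firstGap (peel e S H) < v then 1 else 0 := by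
  have h0 : 0 ∈ S := mem_of_lt_firstGap (by omega)
  have hfJ : firstGap (peel e S H) ≤ firstGap S := by
    rcases firstGap_peel he hf hH with ⟨m, h1, h2⟩ | ⟨m, r, h1, h2, h3, h4⟩ <;> omega
  rw [rimRemoved, below_insert_firstGap]
  rcases Nat.lt_or_ge H v with hv | hv
  · have h1 := card_peel he h0 hS
    rw [below_eq_card fun b hb => (Finset.mem_range.1 (hS hb)).trans hv,
      below_eq_card fun b hb => (Finset.mem_range.1 (peel_subset he H hb)).trans hv,
      if_pos (by omega), if_neg]
    · omega
    · rintro ⟨h, -⟩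
      have := Finset.mem_range.1 (rimPos_subset he H h)
      omega
  · have h1 := below_peel he h0 (by omega) hv
    by_cases h2 : firstGap (peel e S H) < v
    · simp only [h2, if_true, and_true]
      omega
    · simp only [h2, if_false, and_false]
      rw [below_of_le_firstGap (by omega), below_of_le_firstGap (by omega)]

/-! ### Recovering a set of beads from its peeled set and its sum -/

/-- The selected beads. -/
theorem exists_selected (he : 0 < e) (h0 : 0 ∈ S) (ht : 0 < t) : ∃ Q : Finset ℕ,
    (∃ x₀ ∈ Q, x₀ < e ∧ (∀ p ∈ Q, p < e → p = x₀) ∧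
      ∃ m, sumTo t S = ∑ v ∈ peel e S t, v + m * e + x₀) ∧
    (∃ q ∈ Q, q < t ∧ (∀ p ∈ Q, p ≤ q) ∧ ∀ j ∈ peel e S t, j < q) ∧
    (∀ p ∈ Q, e ≤ p → ∃ p' ∈ Q, p' ≤ p - e ∧ p - e ∈ peel e S t ∧
      ∀ j ∈ peel e S t, p' ≤ j → p - e ≤ j) ∧
    (∀ p' ∈ Q, ∀ j ∈ peel e S t, p' ≤ j → (∀ i ∈ peel e S t, p' ≤ i → j ≤ i) → j + e ∈ Q) ∧
    ∀ v < t, v ∈ S ↔ (v ∈ peel e S t ∧ v + e ∉ Q) ∨ v ∈ Q := by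
  -- The set `Q` collects the beads at which segments start. Its least element is the sum defect mod
  -- `e`, and each later one is `e` above the first bead of the peeled set at or above its
  -- predecessor.
  induction t using Nat.strong_induction_on with
  | _ t ih =>
    obtain ⟨t, rfl⟩ : ∃ u, t = u + 1 := ⟨t - 1, by omega⟩
    by_cases hm : t ∈ S
    swap
    · have htpos : 0 < t := Nat.pos_of_ne_zero fun h => hm (h ▸ h0)
      obtain ⟨Q, h1, ⟨q, hq, hqt, hQ, hJ⟩, h3, h4, h5⟩ := ih t (by omega) htpos
      rw [peel_succ_of_notMem hm, sumTo_succ_of_notMem hm]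
      refine ⟨Q, h1, ⟨q, hq, by omega, hQ, hJ⟩, h3, h4, fun v hv => ?_⟩
      rcases Nat.lt_or_ge v t with h | h
      · exact h5 v h
      · obtain rfl : v = t := by omega
        refine ⟨fun h => absurd h hm, ?_⟩
        rintro (h | h)
        · have := hJ _ h.1; omega
        · have := hQ _ h; omega
    rcases Nat.lt_or_ge t e with hte | hte
    · rw [peel_succ_of_lt hm hte]
      refine ⟨{t}, ⟨t, by simp, hte, by simp, 0, ?_⟩, ⟨t, by simp, by omega, by simp, ?_⟩, ?_, ?_, ?_⟩
      · rw [sumTo_succ_of_mem hm, sumTo_congr fun v hv => (mem_filter_lt hv).symm, sumTo_eq_sum]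
        · omega
        · intro v hv
          rw [Finset.mem_filter] at hv
          exact Finset.mem_range.2 hv.2
      · intro j hj; exact (Finset.mem_filter.1 hj).2
      · intro p hp hep; rw [Finset.mem_singleton] at hp; omega
      · intro p' hp' j hj h
        rw [Finset.mem_singleton] at hp'
        have := (Finset.mem_filter.1 hj).2
        omega
      · intro v hv
        rw [Finset.mem_filter, Finset.mem_singleton, Finset.mem_singleton]
        rcases Nat.lt_or_ge v t with h | h
        · exact ⟨fun h' => Or.inl ⟨⟨h', h⟩, by omega⟩, fun h' => (h'.resolve_right (by omega)).1.1⟩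
        · obtain rfl : v = t := by omega
          simp [hm]
    obtain ⟨Q, ⟨x₀, hx, hxe, hxu, m, hsum⟩, ⟨q, hq, hqt, hQ, hJ⟩, h3, h4, h5⟩ :=
      ih (t - e + 1) (by omega) (by omega)
    have hs := sum_peel_succ he hm hte
    have hnot := notMem_peel_succ (S := S) he (t - e)
    have hmem := fun w => by
      have := Finset.ext_iff.1 (peel_succ_of_le hm he hte) w
      rwa [Finset.mem_union, Finset.mem_insert, Finset.mem_filter] at this
    have hcase : ∀ j ∈ peel e S (t + 1), j ∈ peel e S (t - e + 1) ∨ (t - e ≤ j ∧ j < t) := by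
      intro j hj
      rw [hmem] at hj
      rcases hj with h | h | h
      · right; omega
      · right; omega
      · exact Or.inl h
    refine ⟨insert t Q, ⟨x₀, Finset.mem_insert_of_mem hx, hxe, ?_, m + 1, ?_⟩,
      ⟨t, Finset.mem_insert_self _ _, by omega, ?_, ?_⟩, ?_, ?_, ?_⟩
    · intro p hp hpe
      rcases Finset.mem_insert.1 hp with h | h
      · omega
      · exact hxu p h hpe
    · rw [add_mul]; omega
    · intro p hp
      rcases Finset.mem_insert.1 hp with h | h
      · omega
      · have := hQ p h; omega
    · intro j hj
      rcases hcase j hj with h | h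
      · have := hJ j h; omega
      · omega
    · intro p hp hep
      rcases Finset.mem_insert.1 hp with rfl | h
      · refine ⟨q, Finset.mem_insert_of_mem hq, by omega, (hmem _).2 (Or.inr (Or.inl rfl)), ?_⟩
        intro j hj hqj
        rcases hcase j hj with h | h
        · have := hJ j h; omega
        · omega
      · obtain ⟨p', h6, h7, h8, h9⟩ := h3 p h hep
        refine ⟨p', Finset.mem_insert_of_mem h6, h7, (hmem _).2 (Or.inr (Or.inr h8)), ?_⟩
        intro j hj hpj
        have := hQ p h
        rcases hcase j hj with h | h
        · exact h9 j h hpj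
        · omega
    · intro p' hp' j hj hpj hleast
      rcases Finset.mem_insert.1 hp' with h | h
      · rcases hcase j hj with h' | h'
        · have := hJ j h'; omega
        · omega
      · rcases hcase j hj with h' | h'
        · exact Finset.mem_insert_of_mem (h4 p' h j h' hpj fun i hi =>
            hleast i ((hmem _).2 (Or.inr (Or.inr hi))))
        · have h6 := hQ p' h
          have h7 := hleast (t - e) ((hmem _).2 (Or.inr (Or.inl rfl))) (by omega)
          rw [show j + e = t by omega]
          exact Finset.mem_insert_self _ _
    · intro v hv
      rw [hmem, Finset.mem_insert, Finset.mem_insert]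
      have hQv : t - e < v → v ∉ Q := fun h h' => by have := hQ v h'; omega
      have hQve : t - e ≤ v → v + e ∉ Q := fun h h' => by have := hQ _ h'; omega
      have hJv : t - e ≤ v → v ∉ peel e S (t - e + 1) := fun h h' => by
        have := hJ v h'; omega
      rcases lt_trichotomy v (t - e) with h | h | h
      · rw [h5 v (by omega)]
        simp only [show ¬ (t - e < v) by omega, show v ≠ t - e by omega, show v + e ≠ t by omega,
          show v ≠ t by omega, false_and, and_false, false_or]
      · have h6 := h5 v (by omega)
        simp only [hJv h.ge, false_and, false_or] at h6
        rw [h6]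
        simp only [show v + e = t by omega, true_or, not_true_eq_false, and_false, false_or,
          show v ≠ t by omega]
      · simp only [hJv h.le, hQve h.le, hQv h, show v + e ≠ t by omega, show v ≠ t - e by omega,
          or_false, not_false_eq_true, and_true]
        by_cases hvt : v = t
        · simp [hvt, hm]
        · simp only [hvt, or_false, h, show v < t by omega, and_true]

/-- A set of beads is determined by the peeled set and the sum. -/
theorem eq_of_peel_eq (he : 0 < e) {H : ℕ} (hS : S ⊆ Finset.range H) (hS' : S' ⊆ Finset.range H)
    (h0 : 0 ∈ S) (h0' : 0 ∈ S') (hJ : peel e S H = peel e S' H)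
    (hsum : ∑ v ∈ S, v = ∑ v ∈ S', v) : S = S' := by
  have hH : 0 < H := by simpa using hS h0
  obtain ⟨Q, ⟨x, hx, hxe, hxu, m, hm⟩, -, h3, h4, h5⟩ := exists_selected he h0 hH
  obtain ⟨Q', ⟨x', hx', hxe', hxu', m', hm'⟩, -, h3', h4', h5'⟩ := exists_selected he h0' hH
  rw [sumTo_eq_sum hS] at hm
  rw [sumTo_eq_sum hS', ← hsum, ← hJ] at hm'
  -- Peeled sets and sums agree, so the two lowest selected beads are congruent mod `e`; both are
  -- less than `e`.
  have hxx : x = x' := by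
    have h1 : m * e + x = m' * e + x' := by omega
    have h2 := congrArg (· % e) h1
    simp only [Nat.add_mod, Nat.mul_mod_left, zero_add, Nat.mod_mod] at h2
    rwa [Nat.mod_eq_of_lt hxe, Nat.mod_eq_of_lt hxe'] at h2
  rw [← hJ] at h3' h4' h5'
  -- The selected beads are recovered upwards, each one from its predecessor and the peeled set.
  have key : ∀ Q Q' : Finset ℕ, (∀ p ∈ Q, p < e → p ∈ Q') →
      (∀ p ∈ Q, e ≤ p → ∃ p' ∈ Q, p' ≤ p - e ∧ p - e ∈ peel e S H ∧
        ∀ j ∈ peel e S H, p' ≤ j → p - e ≤ j) →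
      (∀ p' ∈ Q', ∀ j ∈ peel e S H, p' ≤ j → (∀ i ∈ peel e S H, p' ≤ i → j ≤ i) → j + e ∈ Q') →
      ∀ p ∈ Q, p ∈ Q' := by
    intro Q Q' hx h3 h4 p
    induction p using Nat.strong_induction_on with
    | _ p ih =>
      intro hp
      rcases Nat.lt_or_ge p e with h | h
      · exact hx p hp h
      · obtain ⟨p', h6, h7, h8, h9⟩ := h3 p hp h
        have := h4 p' (ih p' (by omega) h6) (p - e) h8 h7 h9
        rwa [Nat.sub_add_cancel h] at this
  have hQ : Q = Q' := by
    ext p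
    exact ⟨key Q Q' (fun p hp hpe => by rw [hxu p hp hpe, hxx]; exact hx') h3 h4' p,
      key Q' Q (fun p hp hpe => by rw [hxu' p hp hpe, ← hxx]; exact hx) h3' h4 p⟩
  ext v
  constructor
  · intro hv
    have := Finset.mem_range.1 (hS hv)
    rwa [h5' v this, ← hQ, ← h5 v this]
  · intro hv
    have := Finset.mem_range.1 (hS' hv)
    rwa [h5 v this, hQ, ← h5' v this]

end

end BeadSet

/-! ### The `e`-rim of a partition in terms of beads -/

namespace YoungDiagram

open BeadSet

section

variable {e N H : ℕ} {μ ν : YoungDiagram}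

theorem firstGap_beads (hN : μ.colLen 0 ≤ N) : firstGap (beads N μ) = N - μ.colLen 0 :=
  firstGap_eq (fun v hv => mem_beads_of_lt (by omega))
    (by simpa using notMem_beads_col (μ := μ) (N := N) (j := 0))

theorem rim_position (hN : μ.colLen 0 ≤ N) {c : ℕ × ℕ} (hc : c ∈ μ.rim) :
    c.1 + below (beads N μ) (N + c.2 - c.1) + 1 = N ∧
      below (beads N μ) (N + c.2 - c.1) + 1 + c.2 = N + c.2 - c.1 := by
  obtain ⟨i, j⟩ := c
  rw [mem_rim, mem_iff_below hN, mem_iff_below hN,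
    show N + (j + 1) - (i + 1) = N + j - i by omega] at hc
  simp only
  omega

theorem exists_rim_position (hN : μ.colLen 0 ≤ N) {v : ℕ} (h1 : below (beads N μ) v + 1 ≤ N)
    (h2 : below (beads N μ) v + 1 ≤ v) :
    (N - 1 - below (beads N μ) v, v - 1 - below (beads N μ) v) ∈ μ.rim ∧
      N + (v - 1 - below (beads N μ) v) - (N - 1 - below (beads N μ) v) = v := by
  refine ⟨?_, by omega⟩
  rw [mem_rim, mem_iff_below hN, mem_iff_below hN,
    show N + (v - 1 - below (beads N μ) v) - (N - 1 - below (beads N μ) v) = v by omega,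
    show N + (v - 1 - below (beads N μ) v + 1) - (N - 1 - below (beads N μ) v + 1) = v by omega]
  omega

/-- At height `t` the current row is the number of beads at or above `t`. A segment from the bead
`t` occupies the diagonals `t - e + 1, …, t`, and the row after its last box is the one belonging to
height `t - e + 1`. At or below the first gap both recursions yield no boxes. -/
theorem eRimFrom_eq (he : 0 < e) (hN : μ.colLen 0 + e ≤ N) (t : ℕ) :
    μ.eRimFrom e (N - below (beads N μ) t) =
      μ.rim.filter fun c => N + c.2 - c.1 ∈ rimPos e (beads N μ) t := by
  have hN' : μ.colLen 0 ≤ N := by omega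
  have hfg := firstGap_beads hN'
  have hlow : ∀ t, t ≤ N - μ.colLen 0 →
      (μ.rim.filter fun c => N + c.2 - c.1 ∈ rimPos e (beads N μ) (t + 1)) = ∅ := by
    intro t ht
    rw [Finset.filter_eq_empty_iff]
    intro c hc h
    have h1 := Finset.mem_range.1 (rimPos_subset he _ h)
    have h2 := (rim_position hN' hc).2
    rw [below_of_le_firstGap (by omega)] at h2
    omega
  have hend : ∀ r, μ.colLen 0 ≤ r → μ.eRimFrom e r = ∅ := by
    intro r hr
    rw [eRimFrom, dif_neg (by omega)]
  induction t using Nat.strong_induction_on with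
  | _ t ih =>
    rcases t with _ | t
    · rw [below_zero, hend _ (by omega), rimPos]
      simp
    by_cases hm : t ∈ beads N μ
    swap
    · rw [below_succ_of_notMem hm, rimPos_succ_of_notMem hm]
      exact ih t (by omega)
    obtain ⟨i, hi, hit⟩ := mem_beads.1 hm
    have hbt : below (beads N μ) t = N - 1 - i := by rw [← hit, below_bead hi]
    rw [show N - below (beads N μ) (t + 1) = i by rw [below_succ_of_mem hm]; omega]
    rcases Nat.lt_or_ge i (μ.colLen 0) with hic | hic
    swap
    · rw [hend i hic, hlow t]
      rw [rowLen_eq_zero hic] at hit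
      omega
    have hpos := mem_iff_lt_rowLen.1 (mem_iff_lt_colLen.2 hic)
    have hte : e ≤ t := by omega
    have hseg : μ.eRimSegment e i = μ.rim.filter fun c => N + c.2 - c.1 ∈ Finset.Ioc (t - e) t := by
      unfold eRimSegment content
      refine Finset.filter_congr fun c hc => ?_
      have := (rim_position hN' hc).1
      rw [Finset.mem_Ioc]
      omega
    have hbt' : below (beads N μ) (t - e + 1) ≤ N - 1 - i := hbt ▸ below_mono (beads N μ) (by omega)
    rw [eRimFrom, dif_pos ⟨he, hic⟩, rimPos_succ_of_le hm he hte]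
    simp only [Finset.mem_union]
    rw [Finset.filter_or, ← hseg]
    congr 1
    rcases Nat.lt_or_ge (firstGap (beads N μ)) (t - e + 1) with hf | hf
    · have hsup : (μ.eRimSegment e i).sup Prod.fst = N - 1 - below (beads N μ) (t - e + 1) := by
        apply le_antisymm
        · refine Finset.sup_le fun c hc => ?_
          rw [hseg, Finset.mem_filter, Finset.mem_Ioc] at hc
          have h1 := (rim_position hN' hc.1).1
          have h2 := below_mono (beads N μ) (show t - e + 1 ≤ N + c.2 - c.1 by omega)
          omega
        · have h3 : below (beads N μ) (t - e + 1) + 1 ≤ t - e + 1 := by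
            have h4 := gaps_lt_gaps (firstGap_notMem (beads N μ)) hf
            omega
          obtain ⟨h1, h2⟩ := exists_rim_position hN' (v := t - e + 1) (by omega) h3
          refine Finset.le_sup (f := Prod.fst) (b := (N - 1 - below (beads N μ) (t - e + 1),
            t - e + 1 - 1 - below (beads N μ) (t - e + 1))) ?_
          rw [hseg, Finset.mem_filter, Finset.mem_Ioc]
          refine ⟨h1, ?_⟩
          simp only
          rw [h2]; omega
      rw [hsup, show N - 1 - below (beads N μ) (t - e + 1) + 1 = N - below (beads N μ) (t - e + 1) by omega]
      exact ih _ (by omega)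
    · rw [hlow (t - e) (by omega)]
      apply hend
      have h0 : below (beads N μ) (N - μ.colLen 0 + 1) = N - μ.colLen 0 := by
        rw [below_succ_of_notMem (hfg ▸ firstGap_notMem (beads N μ)), below_of_le_firstGap (by omega)]
      obtain ⟨h1, h2⟩ := exists_rim_position hN' (v := N - μ.colLen 0 + 1) (by omega) (by omega)
      have := Finset.le_sup (f := Prod.fst) (s := μ.eRimSegment e i)
        (b := (N - 1 - below (beads N μ) (N - μ.colLen 0 + 1),
          N - μ.colLen 0 + 1 - 1 - below (beads N μ) (N - μ.colLen 0 + 1))) (by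
        rw [hseg, Finset.mem_filter, Finset.mem_Ioc]
        refine ⟨h1, ?_⟩
        simp only
        rw [h2]; omega)
      simp only at this
      omega

/-- Removal of the `e`-rim, in terms of beads. -/
theorem exists_rimRemoved (he : 0 < e) (hN : μ.colLen 0 + e ≤ N) (hH : N + μ.rowLen 0 ≤ H)
    (hμ : firstGap (beads N μ) < H) :
    ∃ ν : YoungDiagram, ν.colLen 0 ≤ μ.colLen 0 ∧ beads N ν = rimRemoved e H (beads N μ) ∧
      ν.cells = μ.cells \ μ.eRim e ∧ ν.card + (μ.eRim e).card = μ.card := by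
  have hN' : μ.colLen 0 ≤ N := by omega
  have hsub : (beads N μ) ⊆ Finset.range H := beads_subset hH
  have hfg : firstGap (beads N μ) = N - μ.colLen 0 := firstGap_beads hN'
  have h0 : 0 ∈ (beads N μ) := mem_of_lt_firstGap (by omega)
  have hcardS : (beads N μ).card = N := card_beads N μ
  obtain ⟨ν, h1, h2⟩ := exists_beads_eq (rimRemoved e H (beads N μ))
  rw [card_rimRemoved he h0 hsub, hcardS] at h1 h2
  have hrim : μ.eRim e = μ.rim.filter fun c => N + c.2 - c.1 ∈ rimPos e (beads N μ) H := by
    rw [eRim, ← eRimFrom_eq he hN,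
      below_eq_card fun b hb => Finset.mem_range.1 (hsub hb), hcardS, Nat.sub_self]
  have hcells : ν.cells = μ.cells \ μ.eRim e := by
    rw [cells_eq_sdiff_rim hN' h1 (fun v => v ∈ rimPos e (beads N μ) H ∧ firstGap (peel e (beads N μ) H) < v)
      (fun v => by rw [h2, below_rimRemoved he (by omega) hsub hμ]), hrim]
    congr 1
    -- No rim box lies at or below the first gap, and filling the gap of the peeled set affects only
    -- positions up to there.
    refine Finset.filter_congr fun c hc => and_iff_left_of_imp fun _ => ?_
    have hfJ : firstGap (peel e (beads N μ) H) ≤ firstGap (beads N μ) := by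
      rcases firstGap_peel he (by omega) hμ with ⟨m, h1, h2⟩ | ⟨m, r, h1, h2, h3, h4⟩ <;> omega
    have h3 := (rim_position hN' hc).2
    by_contra h4
    rw [below_of_le_firstGap (by omega)] at h3
    omega
  refine ⟨ν, colLen_le_of_cells_subset (by rw [hcells]; exact Finset.sdiff_subset) 0, h2, hcells, ?_⟩
  rw [YoungDiagram.card, YoungDiagram.card, hcells]
  exact Finset.card_sdiff_add_card_eq_card (by
    rw [hrim, rim, rimHook]
    exact (Finset.filter_subset _ _).trans (Finset.filter_subset _ _))

/-- This identifies the `ε` of the Mullineux symbol: peeling lowers the first gap by one exactly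
when the rim splits into full segments. -/
theorem dvd_card_eRim_iff (he : 0 < e) (hN : μ.colLen 0 + e ≤ N) (hH : N + μ.rowLen 0 ≤ H)
    (hμ : firstGap (beads N μ) < H) :
    firstGap (peel e (beads N μ) H) + 1 =
      firstGap (beads N μ) + if e ∣ (μ.eRim e).card then 0 else 1 := by
  have hN' : μ.colLen 0 ≤ N := by omega
  obtain ⟨ν, h1, h2, -, h3⟩ := exists_rimRemoved he hN hH hμ
  have hsub : beads N μ ⊆ Finset.range H := beads_subset hH
  have hfg : firstGap (beads N μ) = N - μ.colLen 0 := firstGap_beads hN'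
  have h4 := sum_beads_eq (μ := ν) (N := N) (by omega)
  have h5 := sum_beads_eq hN'
  rw [h2, rimRemoved, Finset.sum_insert (firstGap_notMem _)] at h4
  rcases firstGap_peel he (by omega) hμ with ⟨m, h6, h7⟩ | ⟨m, r, h6, h7, h8, h9⟩
  · rw [sumTo_eq_sum hsub] at h6
    rw [if_pos]
    · omega
    · exact ⟨m, by rw [mul_comm]; omega⟩
  · rw [sumTo_eq_sum hsub] at h8
    rw [if_neg]
    · omega
    · intro h10
      have h11 : (μ.eRim e).card + r = m * e := by omega
      have h12 : e ∣ r := (Nat.dvd_add_right h10).1 ⟨m, by rw [h11, mul_comm]⟩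
      have := Nat.le_of_dvd h6 h12
      omega

/-! ### Mullineux symbols -/

theorem card_eq_zero_iff : μ.card = 0 ↔ μ = ⊥ := by
  rw [YoungDiagram.card, Finset.card_eq_zero]
  constructor
  · intro h; ext c; simp [h]
  · rintro rfl; rfl

theorem eRim_card_pos (he : 0 < e) (h : μ ≠ ⊥) : 0 < (μ.eRim e).card := by
  have h1 : 0 < μ.colLen 0 := by
    by_contra h1
    have h2 := card_eq_sum_rowLen (μ := μ) (N := 0) (by omega)
    exact h (card_eq_zero_iff.1 (by simpa using h2))
  refine Finset.card_pos.2 ⟨(0, μ.rowLen 0 - 1), ?_⟩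
  rw [eRim, eRimFrom, dif_pos ⟨he, h1⟩]
  exact Finset.mem_union_left _ (rightmost_mem_eRimSegment he μ h1)

theorem beads_bound {n : ℕ} (hn : n + e ≤ N) (hμ : μ.card ≤ n) :
    μ.colLen 0 + e ≤ N ∧ N + μ.rowLen 0 ≤ N + N := by
  have := μ.colLen_le_card 0
  have := μ.rowLen_le_card 0
  omega

/-- Paired partitions have corresponding Mullineux symbols. -/
theorem exists_mullineuxSymbol {lam kap : YoungDiagram} (he : 0 < e)
    (h : Paired e (N + N) (beads N lam) (beads N kap)) (hcard : lam.card = kap.card)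
    (hN : lam.card + e ≤ N) : ∃ s, HasMullineuxSymbol e lam s ∧
      HasMullineuxSymbol e kap (s.map (mullineuxColumn e)) := by
  induction hn : lam.card using Nat.strong_induction_on generalizing lam kap with
  | _ n ih =>
    by_cases hlam : lam = ⊥
    · have hkap : kap = ⊥ := by
        rw [← card_eq_zero_iff, ← hcard, card_eq_zero_iff, hlam]
      subst hlam hkap
      exact ⟨[], .nil, .nil⟩
    have hkap : kap ≠ ⊥ := by
      rw [Ne, ← card_eq_zero_iff, ← hcard, card_eq_zero_iff]; exact hlam
    obtain ⟨b1, b2⟩ := beads_bound hN (le_refl lam.card)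
    obtain ⟨b3, b4⟩ := beads_bound (μ := kap) hN hcard.ge
    have hfl := firstGap_beads (μ := lam) (N := N) (by omega)
    have hfk := firstGap_beads (μ := kap) (N := N) (by omega)
    obtain ⟨lam', h1, h2, h3, h4⟩ := exists_rimRemoved he b1 b2 (by omega)
    obtain ⟨kap', h5, h6, h7, h8⟩ := exists_rimRemoved he b3 b4 (by omega)
    obtain ⟨hp, hfT, hfJ, hs1, hs2⟩ := h.next he (by omega) (by omega)
    have hdvd := dvd_card_eRim_iff (μ := lam) he b1 b2 (by omega)
    rw [← h2, ← h6] at hp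
    rw [← h2, sum_beads_eq (by omega), sum_beads_eq (by omega)] at hs1
    rw [← h6, sum_beads_eq (by omega), sum_beads_eq (by omega)] at hs2
    have hpos := eRim_card_pos he hlam
    have hposk : 0 < kap.colLen 0 := by
      by_contra hz
      have h9 := card_eq_sum_rowLen (μ := kap) (N := 0) (by omega)
      exact hkap (card_eq_zero_iff.1 (by simpa using h9))
    obtain ⟨s, hs, hs'⟩ := ih lam'.card (by omega) hp (by omega) (by omega) rfl
    refine ⟨((lam.eRim e).card, lam.colLen 0) :: s, .cons hlam h3 hs, ?_⟩
    -- The sum formulas of `Paired.next` give equal rim sizes `2N - 1 - firstGap T - firstGap (peel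
    -- S)`. Substituting `N - r` for the first gaps and the value of `ε` gives the rule for columns.
    have hcol : mullineuxColumn e ((lam.eRim e).card, lam.colLen 0) =
        ((kap.eRim e).card, kap.colLen 0) := by
      refine Prod.ext ?_ ?_
      · show (lam.eRim e).card = (kap.eRim e).card
        omega
      · show (lam.eRim e).card - lam.colLen 0 + (if e ∣ (lam.eRim e).card then 0 else 1) =
          kap.colLen 0
        split_ifs at hdvd ⊢ <;> omega
    rw [List.map_cons, hcol]
    exact .cons hkap h7 hs'

theorem HasMullineuxSymbol.unique {s s' : List (ℕ × ℕ)} (h : HasMullineuxSymbol e μ s)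
    (h' : HasMullineuxSymbol e μ s') : s = s' := by
  induction h generalizing s' with
  | nil =>
    cases h' with
    | nil => rfl
    | cons hμ _ _ => exact absurd rfl hμ
  | cons hμ hν h ih =>
    cases h' with
    | nil => exact absurd rfl hμ
    | cons hμ' hν' h' =>
      rw [ih (YoungDiagram.ext (hν.trans hν'.symm) ▸ h')]

/-- A partition is determined by its Mullineux symbol. -/
theorem HasMullineuxSymbol.injective (he : 0 < e) {s : List (ℕ × ℕ)} {μ' : YoungDiagram}
    (h : HasMullineuxSymbol e μ s) (h' : HasMullineuxSymbol e μ' s) : μ = μ' := by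
  induction s generalizing μ μ' with
  | nil =>
    cases h
    cases h'
    rfl
  | cons c s ih =>
    obtain ⟨A, r⟩ := c
    generalize hc : (A, r) :: s = l at h h'
    cases h with
    | nil => cases hc
    | @cons _ ν _ hμ hν h1 =>
      rw [List.cons.injEq, Prod.mk.injEq] at hc
      obtain ⟨⟨rfl, rfl⟩, rfl⟩ := hc
      generalize hc : ((μ.eRim e).card, μ.colLen 0) :: s = l at h'
      cases h' with
      | nil => cases hc
      | @cons _ ν' _ hμ' hν' h1' =>
        rw [List.cons.injEq, Prod.mk.injEq] at hc
        obtain ⟨⟨hA, hr⟩, rfl⟩ := hc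
        obtain rfl := ih h1 h1'
        obtain ⟨N, hN⟩ : ∃ N, N = μ.card + μ'.card + e := ⟨_, rfl⟩
        obtain ⟨b1, b2⟩ := beads_bound (μ := μ) (n := μ.card + μ'.card) hN.ge (by omega)
        obtain ⟨b3, b4⟩ := beads_bound (μ := μ') (n := μ.card + μ'.card) hN.ge (by omega)
        have hf := firstGap_beads (μ := μ) (N := N) (by omega)
        have hf' := firstGap_beads (μ := μ') (N := N) (by omega)
        obtain ⟨ν₁, -, h3, h4, h5⟩ := exists_rimRemoved he b1 b2 (by omega)
        obtain ⟨ν₂, -, h6, h7, h8⟩ := exists_rimRemoved he b3 b4 (by omega)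
        obtain rfl : ν₁ = ν := YoungDiagram.ext (h4.trans hν.symm)
        obtain rfl : ν₂ = ν₁ := YoungDiagram.ext (h7.trans hν'.symm)
        have d1 := dvd_card_eRim_iff he b1 b2 (by omega)
        have d2 := dvd_card_eRim_iff he b3 b4 (by omega)
        rw [hf, hA, hr] at d1
        rw [hf'] at d2
        -- The column `(A, r)` fixes the first gap of the peeled set, so the bead added by the
        -- removal of the rim can be identified and taken out again.
        have hfJ : firstGap (peel e (beads N μ) (N + N)) =
            firstGap (peel e (beads N μ') (N + N)) := by omega
        have hpeel : ∀ S : Finset ℕ, peel e S (N + N) =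
            (rimRemoved e (N + N) S).erase (firstGap (peel e S (N + N))) := fun S => by
          rw [rimRemoved, Finset.erase_insert (firstGap_notMem _)]
        refine eq_of_beads_eq (N := N) (by omega) (by omega) ?_
        refine eq_of_peel_eq he (beads_subset b2) (beads_subset b4)
          (mem_of_lt_firstGap (by omega)) (mem_of_lt_firstGap (by omega)) ?_ ?_
        · rw [hpeel (beads N μ), hpeel (beads N μ'), ← h3, ← h6, hfJ]
        · rw [sum_beads_eq (by omega), sum_beads_eq (by omega)]
          omega

theorem IsMullineuxImage.unique (he : 0 < e) {κ κ' : YoungDiagram} (h : IsMullineuxImage e μ κ)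
    (h' : IsMullineuxImage e μ κ') : κ = κ' := by
  obtain ⟨-, -, s, h1, h2⟩ := h
  obtain ⟨-, -, s', h3, h4⟩ := h'
  obtain rfl := h1.unique h3
  exact h2.injective he h4

theorem mullineux_eq (he : 0 < e) {κ : YoungDiagram} (h : IsMullineuxImage e μ κ) :
    mullineux e μ = κ := by
  have h1 : ∃ ν, IsMullineuxImage e μ ν := ⟨κ, h⟩
  rw [mullineux, dif_pos h1]
  exact h1.choose_spec.unique he h

/-- The minimal element of the class is the conjugate of the Mullineux image of the maximal one. -/
theorem IsMinimalClass.isMullineuxImage {n : ℕ} {β : ZMod (2 * e) → ℕ} {E : Set YoungDiagram}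
    (h : IsMinimalClass e N n β E) (he : 0 < e) (hodd : Odd e) {lam kap : YoungDiagram}
    (hlam : lam ∈ E) (hlg : Good e 1 (beads N lam)) (hkap : kap.transpose ∈ E)
    (hkg : Good e (1 + e) (beads N kap)) : IsMullineuxImage e lam kap := by
  obtain ⟨h1, h2, h3⟩ := (h.mem_iff _).1 hlam
  obtain ⟨h4, h5, h6⟩ := (h.mem_iff _).1 hkap
  have hle := h.le
  rw [colLen_transpose] at h4
  rw [card_transpose] at h6
  have hkN : kap.colLen 0 ≤ N := (kap.colLen_le_card 0).trans (by omega)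
  have hlN := lam.rowLen_le_card 0
  rw [beads_transpose hkN h4] at h5
  have hs1 : beads N lam ⊆ Finset.range (N + N) := beads_subset (by omega)
  obtain ⟨y, hy⟩ := h.exists_zero
  refine ⟨isRegular_of_good_one he hodd h1 hlg (hy _ h2), isRegular_of_good_add he hkN hkg,
    exists_mullineuxSymbol he ⟨hs1, beads_subset (by omega), hlg, hkg, ?_⟩ (by omega) (by omega)⟩
  exact sameData_of_beadCount he hs1 (conj_subset _ _) (h2.trans h5.symm)

end

end YoungDiagram

theorem mainTheorem5 (e : ℕ) (he : 1 < e) (hodd : Odd e)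
    (γ : YoungDiagram) (hγ : γ.IsCore e)
    (R : Matrix (Fin (2 - 1)) (Fin e) ℕ) (hR : ∃ y : Fin e, R 0 y = 0) :
    (∃ lam : YoungDiagram, YoungDiagram.IsUniqueMaximal (YoungDiagram.minWeightSet 2 e γ R) lam) ∧
      ∀ lam : YoungDiagram, YoungDiagram.IsUniqueMaximal (YoungDiagram.minWeightSet 2 e γ R) lam →
        lam.IsRegular e ∧
        (∃! ν : YoungDiagram, YoungDiagram.IsMullineuxImage e lam ν) ∧
        YoungDiagram.IsUniqueMinimal (YoungDiagram.minWeightSet 2 e γ R)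
          (YoungDiagram.mullineux e lam).transpose := by
  obtain ⟨N, n, β, h⟩ := YoungDiagram.exists_isMinimalClass he hodd hγ R hR
  have he0 : 0 < e := by omega
  obtain ⟨lam, hlam, hlg, hmax⟩ := h.exists_max he0
  obtain ⟨kap, hkap, hkg, hmin⟩ := h.exists_min he0
  have himg := h.isMullineuxImage he0 hodd hlam hlg hkap hkg
  have hU : YoungDiagram.IsUniqueMaximal (YoungDiagram.minWeightSet 2 e γ R) lam := by
    intro ν
    constructor
    · rintro ⟨h1, h2⟩
      exact (h2 lam hlam (hmax ν h1)).symm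
    · rintro rfl
      exact ⟨hlam, fun κ hκ hd => (hmax κ hκ).antisymm hd⟩
  refine ⟨⟨lam, hU⟩, fun lam' h' => ?_⟩
  -- Any unique maximal element lies in the class and is maximal there, so it is the good one.
  obtain rfl : lam' = lam := (hU lam').1 ((h' lam').2 rfl)
  refine ⟨himg.1, ⟨kap, himg, fun ν hν => hν.unique he0 himg⟩, ?_⟩
  rw [YoungDiagram.mullineux_eq he0 himg]
  intro ν
  constructor
  · rintro ⟨h1, h2⟩
    exact (h2 _ hkap (hmin ν h1)).symm
  · rintro rfl
    exact ⟨hkap, fun κ hκ hd => hd.antisymm (hmin κ hκ)⟩
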